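/- For $z \in \mathbb{H} = \{z \in \mathbb{C} : \mathrm{Im}(z) > 0\}$ and an even integer $k \ge 4$, let $E_k(z) = \frac12 \sum_{(c,d)=1} (cz+d)^{-k}$, the sum being over all pairs of coprime integers, and let $$E^*_{k,7}(z) = \frac{1}{7^{k/2}+1}\left(7^{k/2} E_k(7z) + E_k(z)\right)$$ be the Eisenstein series associated with the Fricke group $\Gamma_0^*(7)$. Let $$\mathbb{F}^*(7) = \left\{z \in \mathbb{H} : |z| \ge \tfrac{1}{\sqrt7},\ |z+\tfrac12| \ge \tfrac{1}{2\sqrt7},\ -\tfrac12 \le \mathrm{Re}(z) \le 0\right\} \cup \left\{z \in \mathbb{H} : |z| > \tfrac{1}{\sqrt7},\ |z-\tfrac12| > \tfrac{1}{2\sqrt7},\ 0 \le \mathrm{Re}(z) < \tfrac12\right\},$$ which is a fundamental domain for $\Gamma_0^*(7)$, and let $$A^*_7 = \mathbb{F}^*(7) \cap \left\{z \in \mathbb{C} : |z| = \tfrac{1}{\sqrt7} \text{ or } |z+\tfrac12| = \tfrac{1}{2\sqrt7}\right\}.$$ Proposition. For every even integer $k \ge 4$, all but at most $2$ of the zeros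 of $E^*_{k,7}$ in $\mathbb{F}^*(7)$, counted with multiplicity, lie on the arc $A^*_7$. That is, the sum of the orders of vanishing of $E^*_{k,7}$ over the points of $\mathbb{F}^*(7) \setminus A^*_7$ is at most $2$. -/

import Mathlib

open UpperHalfPlane

noncomputable section

namespace Fricke

/-- The point `p z` of the upper half plane, for a positive integer `p`. -/
def scale (p : ℕ) [NeZero p] (z : ℍ) : ℍ :=
  ⟨(p : ℂ) * (z : ℂ), by
    have hp : (0 : ℝ) < (p : ℝ) := Nat.cast_pos.mpr (Nat.pos_of_ne_zero (NeZero.ne p))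
    simpa using mul_pos hp z.im_pos⟩

/-- The Eisenstein series of weight `k` (an even integer, so that `k / 2` is exact) associated
with the Fricke group of level `p`:
`E*_{k,p}(z) = (p^{k/2} E_k(p z) + E_k(z)) / (p^{k/2} + 1)`.
Here `ModularForm.E` is `E_k(z) = (1/2) ∑_{(c,d)=1} (c z + d)^{-k}`. -/
def eisenstein (p : ℕ) [NeZero p] {k : ℕ} (hk : 3 ≤ k) (z : ℍ) : ℂ :=
  1 / ((p : ℂ) ^ (k / 2) + 1) *
    ((p : ℂ) ^ (k / 2) * ModularForm.E hk (scale p z) + ModularForm.E hk z)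

/-- The fundamental domain `F*(p)` of the Fricke group of level `p`, for `p = 5` and `p = 7`. -/
def fundamentalDomain (p : ℕ) : Set ℍ :=
  {z | 1 / √(p : ℝ) ≤ ‖(z : ℂ)‖ ∧ 1 / (2 * √(p : ℝ)) ≤ ‖(z : ℂ) + 1 / 2‖ ∧
      -1 / 2 ≤ z.re ∧ z.re ≤ 0} ∪
  {z | 1 / √(p : ℝ) < ‖(z : ℂ)‖ ∧ 1 / (2 * √(p : ℝ)) < ‖(z : ℂ) - 1 / 2‖ ∧
      0 ≤ z.re ∧ z.re < 1 / 2}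

/-- The arc `A*_p`: the part of `F*(p)` on the circles `|z| = 1/√p` and
`|z + 1/2| = 1/(2√p)`. -/
def arc (p : ℕ) : Set ℍ :=
  fundamentalDomain p ∩
    {z | ‖(z : ℂ)‖ = 1 / √(p : ℝ) ∨ ‖(z : ℂ) + 1 / 2‖ = 1 / (2 * √(p : ℝ))}

/-- The order of vanishing at `z` of a holomorphic function on the upper half plane. -/
def order (f : ℍ → ℂ) (z : ℍ) : ℕ∞ :=
  analyticOrderAt (fun w : ℂ => f (ofComplex w)) (z : ℂ)

/-- The number of zeros in `S`, counted with multiplicity, of a holomorphic function on the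
upper half plane: the sum of the orders of vanishing over all points of `S`, as the supremum of
the finite partial sums in `ℕ∞`. -/
def numZeros (f : ℍ → ℂ) (S : Set ℍ) : ℕ∞ :=
  ⨆ (T : Finset ℍ) (_ : (T : Set ℍ) ⊆ S), ∑ z ∈ T, order f z

end Fricke

end

section

open Complex Metric Real MeromorphicOn Filter Topology
open Function.Periodic (qParam)
open scoped MatrixGroups ModularForm

noncomputable section

namespace Fricke

/-! Write k = 2j. An upper bound for the number of zeros modulo the group is compared with a count
of zeros found on the arc.

Upper bound. The valence inequality is obtained from Jensen's formula and the Eisenstein series in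
s, with no contour around a fundamental domain. On the horocycle Im z = Y the function E*^N
Δ(z)Δ(7z) is O(Y^(-(Nk+24)/2)), because it is controlled by cusp forms. Jensen's formula in the
q-disc then bounds the sum of 2πN · order · (height − Y) over the zeros above Y, modulo translation,
by K + (Nk+24)/2 · log(H/Y) (`horocycle_inequality`). Integrating against Y^(s-2) bounds the sum of
order · height^s, with a simple pole at s = 1 (`sum_order_mul_height_rpow_le`). A zero z contributes
its whole Γ₀(7)-orbit, and the sum of Im(γz)^s over the orbit has residue 3/(8π) at s = 1
(`eventually_exists_sum_im_rpow_ge`). Comparing the poles gives 3Nμ ≤ 2Nk + 48 for the number μ of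
zeros modulo Γ₀(7). For N = 49 integrality gives 3μ ≤ 2k (`three_mul_sum_order_le`). A nonelliptic
zero in the domain and its Fricke image count as two (`three_mul_sum_order_fricke_le`).

Zeros on the arc. Put u = √7 z on the first circle and u = √7(2z+1) on the second, so |u| = 1. In
both cases an element of SL₂(ℤ) sends z to −7z̄, hence E*(z) is a nonzero multiple of Re(u^j
E_k(7z)). For j ≥ 6, E_k(7z) is within distance 1 of 1 except near the common vertex of the two
arcs, so the sign of this real part alternates at the arguments mπ/j. The arguments of the vertex on
the two circles differ by 2π/3 (`arcAngle₁_eq`), and the excluded neighbourhoods cost 1/8 + 3/8 of a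
step π/j (`floor_sub_ceil_ge`).

The zeros left over for the rest of the domain number at most 17/6, hence at most 2. For j < 6 the
valence inequality alone suffices. -/

/-! ### Jensen's formula in the unit disc -/

/-- All terms of the sum over zeros in Jensen's formula are nonnegative, so T may be any part of
them. The remaining terms involve r only through the order at 0 times log r, which r ≥ r₀ bounds
below; this makes K uniform in r. -/
theorem jensen_sum_le {G : ℂ → ℂ} (hG : AnalyticOnNhd ℂ G (ball 0 1))
    (h0 : analyticOrderAt G 0 ≠ ⊤) {r₀ : ℝ} (hr₀ : 0 < r₀) :
    ∃ K : ℝ, ∀ r M : ℝ, r₀ ≤ r → r < 1 → 1 ≤ M → (∀ q : ℂ, ‖q‖ = r → ‖G q‖ ≤ M) →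
      ∀ T : Finset ℂ, (∀ q ∈ T, q ≠ 0 ∧ ‖q‖ < r) →
        ∑ q ∈ T, (analyticOrderNatAt G q : ℝ) * Real.log (r / ‖q‖) ≤ K + Real.log M := by
  refine ⟨-(analyticOrderNatAt G 0 : ℝ) * Real.log r₀ -
    Real.log ‖meromorphicTrailingCoeffAt G 0‖, fun r M hr hr1 hM hbd T hT ↦ ?_⟩
  have hrpos : 0 < r := hr₀.trans_le hr
  have hsub : closedBall (0 : ℂ) |r| ⊆ ball 0 1 := by
    rw [abs_of_pos hrpos]; exact closedBall_subset_ball hr1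
  have hGr : AnalyticOnNhd ℂ G (closedBall 0 |r|) := hG.mono hsub
  have hmer := hGr.meromorphicOn
  have hJ := hmer.circleAverage_log_norm hrpos.ne'
  have havg : circleAverage (fun q ↦ Real.log ‖G q‖) 0 r ≤ Real.log M := by
    apply circleAverage_mono_on_of_le_circle
    · exact (hGr.mono sphere_subset_closedBall).meromorphicOn.circleIntegrable_log_norm
    · intro q hq
      have hq' : ‖q‖ = r := by simpa [abs_of_pos hrpos] using hq
      -- At a zero on the circle the integrand is `Real.log 0 = 0`, which is why 1 ≤ M is required.
      obtain h | h := eq_zero_or_norm_pos (G q)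
      · simpa [h] using Real.log_nonneg hM
      · exact Real.log_le_log h (hbd q hq')
  have hfin : ∀ q ∈ ball (0 : ℂ) 1, analyticOrderAt G q ≠ ⊤ := fun q hq ↦
    hG.analyticOrderAt_ne_top_of_isPreconnected (convex_ball (0 : ℂ) 1).isPreconnected
      (by simp) hq h0
  have hdiv : ∀ q ∈ closedBall (0 : ℂ) |r|,
      divisor G (closedBall 0 |r|) q = (analyticOrderNatAt G q : ℤ) := by
    intro q hq
    rw [hGr.divisor_apply hq]
    obtain ⟨n, hn⟩ := ENat.ne_top_iff_exists.mp (hfin q (hsub hq))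
    simp [analyticOrderNatAt, ← hn]
  have hnonneg : ∀ q, 0 ≤ (divisor G (closedBall 0 |r|) q : ℝ) * Real.log (r * ‖0 - q‖⁻¹) := by
    intro q
    by_cases hq : q ∈ closedBall (0 : ℂ) |r|
    · rw [hdiv q hq]
      rcases eq_or_ne q 0 with rfl | hq0
      · simp
      have hqr : ‖q‖ ≤ r := by simpa [abs_of_pos hrpos] using hq
      refine mul_nonneg (by positivity) (Real.log_nonneg ?_)
      rw [zero_sub, norm_neg, ← div_eq_mul_inv, one_le_div (norm_pos_iff.mpr hq0)]
      exact hqr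
    · simp [Function.locallyFinsuppWithin.apply_eq_zero_of_notMem _ hq]
  have hsupp : (Function.support fun q ↦
      (divisor G (closedBall 0 |r|) q : ℝ) * Real.log (r * ‖0 - q‖⁻¹)).Finite := by
    refine ((divisor G (closedBall 0 |r|)).finiteSupport (isCompact_closedBall 0 |r|)).subset ?_
    intro q hq hq'
    simp only [Function.mem_support, ne_eq] at hq
    exact hq (by rw [hq']; simp)
  have hsum : ∑ q ∈ T, (analyticOrderNatAt G q : ℝ) * Real.log (r / ‖q‖) ≤
      ∑ᶠ q, (divisor G (closedBall 0 |r|) q : ℝ) * Real.log (r * ‖0 - q‖⁻¹) := by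
    classical
    rw [finsum_eq_sum_of_support_subset (s := T ∪ hsupp.toFinset) _ (by intro q hq; simp_all)]
    calc _ = ∑ q ∈ T, (divisor G (closedBall 0 |r|) q : ℝ) * Real.log (r * ‖0 - q‖⁻¹) := by
          refine Finset.sum_congr rfl fun q hq ↦ ?_
          rw [hdiv q (by simpa [abs_of_pos hrpos] using (hT q hq).2.le)]
          simp [div_eq_mul_inv]
      _ ≤ _ := Finset.sum_le_sum_of_subset_of_nonneg Finset.subset_union_left
          fun q _ _ ↦ hnonneg q
  rw [hdiv 0 (by simp)] at hJ
  have hlog : Real.log r₀ ≤ Real.log r := Real.log_le_log hr₀ hr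
  have : (analyticOrderNatAt G 0 : ℝ) * Real.log r₀ ≤ analyticOrderNatAt G 0 * Real.log r := by
    gcongr
  push_cast at hJ
  linarith

/-! ### Functions of q and their growth on horocycles -/

/-- The Eisenstein series of the Fricke group of level `7`, as a function of `q = exp (2 π i z)`. -/
def qEis {k : ℕ} (hk : 3 ≤ k) (q : ℂ) : ℂ :=
  1 / ((7 : ℂ) ^ (k / 2) + 1) *
    ((7 : ℂ) ^ (k / 2) * cuspFunction 1 (ModularForm.E hk) (q ^ 7) +
      cuspFunction 1 (ModularForm.E hk) q)

/-- The product `Δ(z) Δ(7z)` as a function of `q = exp (2 π i z)`. -/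
def qDisc (q : ℂ) : ℂ :=
  cuspFunction 1 CuspForm.discriminant q * cuspFunction 1 CuspForm.discriminant (q ^ 7)

lemma qParam_scale (z : ℍ) : qParam 1 (scale 7 z : ℂ) = qParam 1 (z : ℂ) ^ 7 := by
  simp only [qParam, scale, ← Complex.exp_nat_mul]
  congr 1
  push_cast
  ring

lemma cuspFunction_qParam {k : ℤ} {F : Type*} [FunLike F ℍ ℂ] [ModularFormClass F 𝒮ℒ k]
    (f : F) (z : ℍ) : cuspFunction 1 f (qParam 1 (z : ℂ)) = f z :=
  SlashInvariantFormClass.eq_cuspFunction (h := 1) f z one_mem_strictPeriods_SL one_ne_zero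

lemma analyticOnNhd_cuspFunction {k : ℤ} {F : Type*} [FunLike F ℍ ℂ] [ModularFormClass F 𝒮ℒ k]
    (f : F) : AnalyticOnNhd ℂ (cuspFunction 1 f) (ball 0 1) := by
  refine DifferentiableOn.analyticOnNhd (fun q hq ↦ ?_) isOpen_ball
  exact (ModularFormClass.differentiableAt_cuspFunction (h := 1) f one_pos
    one_mem_strictPeriods_SL (by simpa using hq)).differentiableWithinAt

lemma pow_seven_mem_ball {q : ℂ} (hq : q ∈ ball (0 : ℂ) 1) : q ^ 7 ∈ ball (0 : ℂ) 1 := by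
  simp only [mem_ball_zero_iff, norm_pow] at hq ⊢
  exact pow_lt_one₀ (norm_nonneg _) hq (by norm_num)

lemma analyticOnNhd_cuspFunction_pow {k : ℤ} {F : Type*} [FunLike F ℍ ℂ]
    [ModularFormClass F 𝒮ℒ k] (f : F) :
    AnalyticOnNhd ℂ (fun q ↦ cuspFunction 1 f (q ^ 7)) (ball 0 1) :=
  (analyticOnNhd_cuspFunction f).comp (fun q _ ↦ by fun_prop) fun _ hq ↦ pow_seven_mem_ball hq

lemma analyticOnNhd_qEis {k : ℕ} (hk : 3 ≤ k) : AnalyticOnNhd ℂ (qEis hk) (ball 0 1) := by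
  intro q hq
  have h1 := analyticOnNhd_cuspFunction (ModularForm.E hk) q hq
  have h2 := analyticOnNhd_cuspFunction_pow (ModularForm.E hk) q hq
  exact analyticAt_const.mul ((analyticAt_const.mul h2).add h1)

lemma analyticOnNhd_qDisc : AnalyticOnNhd ℂ qDisc (ball 0 1) := fun q hq ↦
  (analyticOnNhd_cuspFunction CuspForm.discriminant q hq).mul
    (analyticOnNhd_cuspFunction_pow CuspForm.discriminant q hq)

lemma qEis_qParam {k : ℕ} (hk : 3 ≤ k) (z : ℍ) :
    qEis hk (qParam 1 (z : ℂ)) = eisenstein 7 hk z := by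
  simp [qEis, eisenstein, ← qParam_scale, cuspFunction_qParam]

lemma qDisc_qParam (z : ℍ) :
    qDisc (qParam 1 (z : ℂ)) =
      ModularForm.discriminant z * ModularForm.discriminant (scale 7 z) := by
  rw [qDisc, ← qParam_scale, cuspFunction_qParam, cuspFunction_qParam, CuspForm.coe_discriminant]

lemma seven_pow_add_one_ne_zero (n : ℕ) : (7 : ℂ) ^ n + 1 ≠ 0 := by
  have : ((7 ^ n + 1 : ℕ) : ℂ) ≠ 0 := Nat.cast_ne_zero.mpr (by positivity)
  simpa using this

lemma qEis_zero {k : ℕ} (hk : 3 ≤ k) (hk2 : Even k) : qEis hk 0 = 1 := by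
  have h : cuspFunction 1 (ModularForm.E hk) 0 = 1 := by
    rw [← EisensteinSeries.E_qExpansion_coeff_zero hk hk2, qExpansion_coeff]
    simp
  have := seven_pow_add_one_ne_zero (k / 2)
  simp only [qEis, zero_pow (by norm_num : (7 : ℕ) ≠ 0), h]
  field_simp

lemma exists_qParam {q : ℂ} (hq : q ≠ 0) (hq1 : ‖q‖ < 1) : ∃ z : ℍ, qParam 1 (z : ℂ) = q :=
  ⟨⟨_, Function.Periodic.im_invQParam_pos_of_norm_lt_one one_pos hq1 hq⟩,
    Function.Periodic.qParam_right_inv one_ne_zero hq⟩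

lemma im_of_norm_qParam {z : ℍ} {Y : ℝ} (h : ‖qParam 1 (z : ℂ)‖ = Real.exp (-2 * π * Y)) :
    z.im = Y := by
  rw [Function.Periodic.norm_qParam, Real.exp_eq_exp] at h
  have := Real.pi_pos
  have h2 : (-2 * π) * (z : ℂ).im = (-2 * π) * Y := by simpa using h
  exact mul_left_cancel₀ (by nlinarith) h2

/-- Δ has no zero in the upper half plane, so `qDisc` is nonzero at small positive q. -/
lemma analyticOrderAt_qDisc_zero : analyticOrderAt qDisc 0 ≠ ⊤ := by
  intro h
  rw [analyticOrderAt_eq_top, Metric.eventually_nhds_iff] at h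
  obtain ⟨ε, hε, h⟩ := h
  set t : ℝ := min (ε / 2) (1 / 2)
  have ht : 0 < t := by positivity
  have htn : ‖(t : ℂ)‖ = t := by simp [abs_of_pos ht]
  obtain ⟨z, hz⟩ := exists_qParam (q := (t : ℂ)) (by exact_mod_cast ht.ne')
    (by rw [htn]; exact (min_le_right _ _).trans_lt (by norm_num))
  have h1 := h (y := (t : ℂ)) (by
    rw [dist_zero_right, htn]; exact (min_le_left _ _).trans_lt (by linarith))
  rw [← hz, qDisc_qParam] at h1
  exact mul_ne_zero (ModularForm.discriminant_ne_zero _) (ModularForm.discriminant_ne_zero _) h1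

/-- E_k is not cuspidal, so Im(z)^(k/2)|E_k(z)| is unbounded. One factor Δ makes every power of E_k
a cusp form, to which Hecke's bound applies. -/
lemma exists_cuspForm_eq_mul_pow {k : ℕ} (hk : 3 ≤ k) (N : ℕ) :
    ∃ g : CuspForm 𝒮ℒ ((12 + N * k : ℕ) : ℤ),
      ∀ z, g z = ModularForm.discriminant z * ModularForm.E hk z ^ N := by
  induction N with
  | zero => exact ⟨CuspForm.mcast (by norm_num) CuspForm.discriminant, fun z ↦ by
      simp; rfl⟩
  | succ N ih =>
    obtain ⟨g, hg⟩ := ih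
    refine ⟨CuspForm.mcast (by push_cast; ring) (g.mulModularForm (ModularForm.E hk)), fun z ↦ ?_⟩
    change g z * ModularForm.E hk z = _
    rw [hg, pow_succ, mul_assoc]

lemma scale_im (z : ℍ) : (scale 7 z).im = 7 * z.im := by
  change ((7 : ℕ) * (z : ℂ)).im = _
  simp

lemma exists_norm_E_pow_mul_le {k : ℕ} (hk : 3 ≤ k) (N : ℕ) :
    ∃ C : ℝ, 0 < C ∧ ∀ z : ℍ, ‖ModularForm.discriminant z‖ * ‖ModularForm.E hk z‖ ^ N ≤
      C / z.im ^ (((12 + N * k : ℕ) : ℝ) / 2) := by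
  obtain ⟨g, hg⟩ := exists_cuspForm_eq_mul_pow hk N
  obtain ⟨C, hC⟩ := CuspFormClass.exists_bound g
  refine ⟨max C 1, by positivity, fun z ↦ ?_⟩
  have := hC z
  rw [hg, norm_mul, norm_pow] at this
  refine this.trans ?_
  push_cast
  have := z.im_pos
  gcongr
  exact le_max_left _ _

lemma norm_eisenstein_le {k : ℕ} (hk : 3 ≤ k) (z : ℍ) :
    ‖eisenstein 7 hk z‖ ≤ ‖ModularForm.E hk (scale 7 z)‖ + ‖ModularForm.E hk z‖ := by
  have h7 : ‖(7 : ℂ) ^ (k / 2) + 1‖ = 7 ^ (k / 2) + 1 := by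
    have : (7 : ℂ) ^ (k / 2) + 1 = (((7 : ℝ) ^ (k / 2) + 1 : ℝ) : ℂ) := by push_cast; ring
    rw [this, Complex.norm_real, Real.norm_of_nonneg (by positivity)]
  rw [eisenstein, norm_mul, norm_div, norm_one]
  push_cast
  rw [h7, one_div, inv_mul_le_iff₀ (by positivity)]
  refine (norm_add_le _ _).trans ?_
  rw [norm_mul, norm_pow]
  have h1 : (1 : ℝ) ≤ 7 ^ (k / 2) := one_le_pow₀ (by norm_num)
  have := norm_nonneg (ModularForm.E hk (scale 7 z))
  have := norm_nonneg (ModularForm.E hk z)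
  simp only [Complex.norm_ofNat]
  nlinarith

/-- Here A, B stand for |Δ| at z and 7z, and e, e' for |E_k| there. After splitting the N-th power
of the sum, each N-th power is paired with Δ at the same point, and the other Δ is bounded by
itself. -/
lemma mul_le_of_le_add {A B e e' x Z Z' : ℝ} (hA : 0 ≤ A) (hB : 0 ≤ B) (he : 0 ≤ e) (he' : 0 ≤ e')
    (hx : 0 ≤ x) (hxe : x ≤ e' + e) {N : ℕ} (hA1 : A * e ^ N ≤ Z) (hB1 : B * e' ^ N ≤ Z)
    (hA2 : A ≤ Z') (hB2 : B ≤ Z') (hZ : 0 ≤ Z) :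
    x ^ N * (A * B) ≤ 2 ^ N * (2 * (Z * Z')) := by
  have hf : x ^ N ≤ 2 ^ N * (e' ^ N + e ^ N) := by
    have h1 : x ≤ 2 * max e' e := hxe.trans (by linarith [le_max_left e' e, le_max_right e' e])
    refine (pow_le_pow_left₀ hx h1 N).trans ?_
    rw [mul_pow]
    have := pow_nonneg he N
    have := pow_nonneg he' N
    gcongr
    rcases max_cases e' e with h | h <;> rw [h.1] <;> linarith
  calc x ^ N * (A * B) ≤ 2 ^ N * (e' ^ N + e ^ N) * (A * B) := by gcongr
    _ = 2 ^ N * ((B * e' ^ N) * A + (A * e ^ N) * B) := by ring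
    _ ≤ 2 ^ N * (Z * Z' + Z * Z') := by gcongr
    _ = _ := by ring

lemma exists_norm_eisenstein_pow_mul_le {k : ℕ} (hk : 3 ≤ k) (N : ℕ) :
    ∃ C : ℝ, 0 < C ∧ ∀ z : ℍ,
      ‖eisenstein 7 hk z ^ N * (ModularForm.discriminant z * ModularForm.discriminant (scale 7 z))‖ ≤
      C / z.im ^ (((N * k + 24 : ℕ) : ℝ) / 2) := by
  obtain ⟨C₁, hC₁, h₁⟩ := exists_norm_E_pow_mul_le hk N
  obtain ⟨C₂, hC₂, h₂⟩ := exists_norm_E_pow_mul_le hk 0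
  refine ⟨2 ^ N * (2 * (C₁ * C₂)), by positivity, fun z ↦ ?_⟩
  have hy := z.im_pos
  set y := z.im
  set a : ℝ := ((12 + N * k : ℕ) : ℝ) / 2
  have hsplit : y ^ (((N * k + 24 : ℕ) : ℝ) / 2) = y ^ a * y ^ (((12 + 0 * k : ℕ) : ℝ) / 2) := by
    rw [← Real.rpow_add hy]
    congr 1
    simp only [a]
    push_cast
    ring
  have h7 : ∀ b : ℝ, 0 ≤ b → ∀ C : ℝ, 0 < C → C / (scale 7 z).im ^ b ≤ C / y ^ b := by
    intro b hb C hC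
    rw [scale_im]
    gcongr
    linarith
  set A := ‖ModularForm.discriminant z‖
  set B := ‖ModularForm.discriminant (scale 7 z)‖
  set e := ‖ModularForm.E hk z‖
  set e' := ‖ModularForm.E hk (scale 7 z)‖
  have hA1 : A * e ^ N ≤ C₁ / y ^ a := h₁ z
  have hB1 : B * e' ^ N ≤ C₁ / y ^ a := (h₁ (scale 7 z)).trans (h7 _ (by positivity) _ hC₁)
  have hA2 : A ≤ C₂ / y ^ (((12 + 0 * k : ℕ) : ℝ) / 2) := by simpa using h₂ z
  have hB2 : B ≤ C₂ / y ^ (((12 + 0 * k : ℕ) : ℝ) / 2) := by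
    have h := (h₂ (scale 7 z)).trans (h7 _ (by positivity) _ hC₂)
    rwa [pow_zero, mul_one] at h
  have hA0 : 0 ≤ A := norm_nonneg _
  have hB0 : 0 ≤ B := norm_nonneg _
  have he0 : 0 ≤ e := norm_nonneg _
  have he0' : 0 ≤ e' := norm_nonneg _
  rw [norm_mul, norm_pow, norm_mul, hsplit]
  refine (mul_le_of_le_add hA0 hB0 he0 he0' (norm_nonneg _) (norm_eisenstein_le hk z)
    hA1 hB1 hA2 hB2 (by positivity)).trans_eq ?_
  field_simp

lemma analyticOrderAt_qEis_ne_top {k : ℕ} (hk : 3 ≤ k) (hk2 : Even k) {q : ℂ} (hq : ‖q‖ < 1) :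
    analyticOrderAt (qEis hk) q ≠ ⊤ := by
  refine (analyticOnNhd_qEis hk).analyticOrderAt_ne_top_of_isPreconnected (x := 0)
      (convex_ball (0 : ℂ) 1).isPreconnected (by simp) (by simpa using hq) ?_
  rw [(analyticOnNhd_qEis hk 0 (by simp)).analyticOrderAt_eq_zero.mpr (by simp [qEis_zero hk hk2])]
  simp

/-! ### Zeros above a horocycle, and integration over its height -/

/-- This is Jensen's formula for `qEis hk ^ N * qDisc` at radius exp(−2πY). The power N dilutes the
weight 24 of the two discriminants. -/
theorem horocycle_inequality {k : ℕ} (hk : 3 ≤ k) (hk2 : Even k) (N : ℕ) {H : ℝ} (hH : 0 < H) :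
    ∃ K : ℝ, ∀ Y : ℝ, 0 < Y → Y ≤ H → ∀ T : Finset ℂ,
      (∀ q ∈ T, q ≠ 0 ∧ ‖q‖ < Real.exp (-2 * π * Y)) →
        ∑ q ∈ T, N * (analyticOrderNatAt (qEis hk) q : ℝ) *
          Real.log (Real.exp (-2 * π * Y) / ‖q‖) ≤
        K + ((N * k + 24 : ℕ) : ℝ) / 2 * Real.log (H / Y) := by
  set G : ℂ → ℂ := qEis hk ^ N * qDisc with hGdef
  have hG : AnalyticOnNhd ℂ G (ball 0 1) := ((analyticOnNhd_qEis hk).pow N).mul analyticOnNhd_qDisc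
  have hord : ∀ q ∈ ball (0 : ℂ) 1,
      analyticOrderAt G q = N • analyticOrderAt (qEis hk) q + analyticOrderAt qDisc q := by
    intro q hq
    rw [hGdef, analyticOrderAt_mul ((analyticOnNhd_qEis hk q hq).pow N) (analyticOnNhd_qDisc q hq),
      analyticOrderAt_pow (analyticOnNhd_qEis hk q hq)]
  have hfE : ∀ q ∈ ball (0 : ℂ) 1, analyticOrderAt (qEis hk) q ≠ ⊤ := fun q hq ↦
    analyticOrderAt_qEis_ne_top hk hk2 (by simpa using hq)
  have hfD : ∀ q ∈ ball (0 : ℂ) 1, analyticOrderAt qDisc q ≠ ⊤ := fun q hq ↦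
    analyticOnNhd_qDisc.analyticOrderAt_ne_top_of_isPreconnected (x := 0)
      (convex_ball (0 : ℂ) 1).isPreconnected (by simp) hq analyticOrderAt_qDisc_zero
  have hordN : ∀ q ∈ ball (0 : ℂ) 1,
      analyticOrderAt G q ≠ ⊤ ∧ N * analyticOrderNatAt (qEis hk) q ≤ analyticOrderNatAt G q := by
    intro q hq
    have h := hord q hq
    obtain ⟨a, ha⟩ := ENat.ne_top_iff_exists.mp (hfE q hq)
    obtain ⟨b, hb⟩ := ENat.ne_top_iff_exists.mp (hfD q hq)
    rw [← ha, ← hb, nsmul_eq_mul] at h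
    have h' : analyticOrderAt G q = ((N * a + b : ℕ) : ℕ∞) := by rw [h]; push_cast; rfl
    refine ⟨by rw [h']; exact ENat.natCast_ne_top _, ?_⟩
    rw [analyticOrderNatAt, analyticOrderNatAt, h', ← ha, ENat.toNat_natCast, ENat.toNat_natCast]
    exact Nat.le_add_right _ _
  obtain ⟨K, hK⟩ := jensen_sum_le hG (hordN 0 (by simp)).1 (Real.exp_pos (-2 * π * H))
  obtain ⟨C, hC, hCb⟩ := exists_norm_eisenstein_pow_mul_le hk N
  set a : ℝ := ((N * k + 24 : ℕ) : ℝ) / 2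
  have ha : 0 ≤ a := by positivity
  -- The bound C / Y^a is rewritten as (C / H^a)(H / Y)^a; the maximum with 1 ensures 1 ≤ M in
  -- `jensen_sum_le`.
  set C' : ℝ := max 1 (C / H ^ a)
  refine ⟨K + Real.log C', fun Y hY hYH T hT ↦ ?_⟩
  have hpi := Real.pi_pos
  have hHY : 1 ≤ H / Y := by rwa [one_le_div hY]
  have hM : 1 ≤ C' * (H / Y) ^ a := one_le_mul_of_one_le_of_one_le (le_max_left _ _)
    (Real.one_le_rpow hHY ha)
  have key := hK (Real.exp (-2 * π * Y)) (C' * (H / Y) ^ a)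
    (Real.exp_le_exp.mpr (by nlinarith)) (Real.exp_lt_one_iff.mpr (by nlinarith)) hM ?_ T hT
  · rw [Real.log_mul (by positivity) (by positivity), Real.log_rpow (by positivity)] at key
    refine le_trans ?_ (key.trans (by linarith))
    refine Finset.sum_le_sum fun q hq ↦ ?_
    obtain ⟨hq0, hq1⟩ := hT q hq
    have hqb : q ∈ ball (0 : ℂ) 1 := by
      simpa using hq1.trans (Real.exp_lt_one_iff.mpr (by nlinarith))
    have hlog : 0 ≤ Real.log (Real.exp (-2 * π * Y) / ‖q‖) := by
      apply Real.log_nonneg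
      rw [one_le_div (norm_pos_iff.mpr hq0)]
      exact hq1.le
    have := (hordN q hqb).2
    gcongr
    exact_mod_cast this
  · intro q hq
    have hqpos : 0 < ‖q‖ := hq ▸ Real.exp_pos _
    obtain ⟨z, rfl⟩ := exists_qParam (q := q) (norm_pos_iff.mp hqpos)
      (hq ▸ Real.exp_lt_one_iff.mpr (by nlinarith))
    have hz := im_of_norm_qParam hq
    have hGz : G (qParam 1 (z : ℂ)) = eisenstein 7 hk z ^ N *
        (ModularForm.discriminant z * ModularForm.discriminant (scale 7 z)) := by
      simp [hGdef, qEis_qParam, qDisc_qParam]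
    rw [hGz]
    refine (hCb z).trans ?_
    rw [hz, Real.div_rpow hH.le hY.le, ← mul_div_assoc]
    gcongr
    have : C / H ^ a ≤ C' := le_max_right _ _
    rwa [div_le_iff₀ (by positivity)] at this

/-- This Mellin transform turns the truncated linear weight of a zero of height t into the power
t^s. -/
lemma integral_max_sub_mul_rpow {s t H : ℝ} (hs : 1 < s) (ht : 0 < t) (htH : t ≤ H) :
    ∫ Y in (0 : ℝ)..H, max (t - Y) 0 * Y ^ (s - 2) = t ^ s / (s * (s - 1)) := by
  have hint : ∀ a b : ℝ, IntervalIntegrable (fun Y : ℝ ↦ max (t - Y) 0 * Y ^ (s - 2))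
      MeasureTheory.volume a b := fun a b ↦
    (intervalIntegral.intervalIntegrable_rpow' (by linarith)).continuousOn_mul (by fun_prop)
  rw [← intervalIntegral.integral_add_adjacent_intervals (hint 0 t) (hint t H)]
  have h2 : ∫ Y in t..H, max (t - Y) 0 * Y ^ (s - 2) = 0 := by
    rw [← intervalIntegral.integral_zero (a := t) (b := H) (μ := MeasureTheory.volume)]
    refine intervalIntegral.integral_congr fun Y hY ↦ ?_
    rw [Set.uIcc_of_le htH] at hY
    simp [max_eq_right (sub_nonpos.mpr hY.1)]
  have h1 : ∫ Y in (0 : ℝ)..t, max (t - Y) 0 * Y ^ (s - 2) =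
      ∫ Y in (0 : ℝ)..t, (t * Y ^ (s - 2) - Y ^ (s - 1)) := by
    refine intervalIntegral.integral_congr_ae (Eventually.of_forall fun Y hY ↦ ?_)
    rw [Set.uIoc_of_le ht.le] at hY
    rw [max_eq_left (by linarith [hY.2]), sub_mul, show s - 1 = (s - 2) + 1 by ring,
      Real.rpow_add_one hY.1.ne']
    ring
  rw [h1, h2, intervalIntegral.integral_sub
    ((intervalIntegral.intervalIntegrable_rpow' (by linarith)).const_mul t)
    (intervalIntegral.intervalIntegrable_rpow' (by linarith)),
    intervalIntegral.integral_const_mul, integral_rpow (by left; linarith),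
    integral_rpow (by left; linarith), Real.zero_rpow (by linarith), Real.zero_rpow (by linarith)]
  rw [show s - 2 + 1 = s - 1 by ring, show s - 1 + 1 = s by ring]
  have h3 : t * t ^ (s - 1) = t ^ s := by
    rw [show t ^ s = t ^ ((s - 1) + 1) by ring_nf, Real.rpow_add_one ht.ne', mul_comm]
  have : s - 1 ≠ 0 := by linarith
  have : s ≠ 0 := by linarith
  field_simp
  linear_combination s * h3

/-- The height in the upper half plane of a point with parameter `q`. -/
def qHeight (q : ℂ) : ℝ := -Real.log ‖q‖ / (2 * π)

lemma norm_eq_exp_qHeight {q : ℂ} (hq : q ≠ 0) : ‖q‖ = Real.exp (-2 * π * qHeight q) := by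
  have := Real.pi_pos
  rw [qHeight, show -2 * π * (-Real.log ‖q‖ / (2 * π)) = Real.log ‖q‖ by field_simp,
    Real.exp_log (norm_pos_iff.mpr hq)]

lemma qHeight_qParam (z : ℍ) : qHeight (qParam 1 (z : ℂ)) = z.im := by
  have := Real.pi_pos
  rw [qHeight, Function.Periodic.norm_qParam, Real.log_exp]
  simp

theorem sum_order_mul_height_rpow_le {k : ℕ} (hk : 3 ≤ k) (hk2 : Even k) (N : ℕ) {H : ℝ}
    (hH : 0 < H) :
    ∃ K : ℝ, ∀ s : ℝ, 1 < s → s < 2 → ∀ T : Finset ℂ,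
      (∀ q ∈ T, q ≠ 0 ∧ ‖q‖ < 1 ∧ qHeight q ≤ H) →
        2 * π * N * ∑ q ∈ T, (analyticOrderNatAt (qEis hk) q : ℝ) * qHeight q ^ s ≤
        s * H ^ (s - 1) * (K + ((N * k + 24 : ℕ) : ℝ) / 2 / ((s - 1) * (2 - s))) := by
  obtain ⟨K, hK⟩ := horocycle_inequality hk hk2 N hH
  refine ⟨K, fun s hs hs2 T hT ↦ ?_⟩
  set a : ℝ := ((N * k + 24 : ℕ) : ℝ) / 2
  have ha : 0 ≤ a := by positivity
  have hpi := Real.pi_pos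
  set m : ℂ → ℝ := fun q ↦ (analyticOrderNatAt (qEis hk) q : ℝ)
  have ht : ∀ q ∈ T, 0 < qHeight q := fun q hq ↦ by
    have h := Real.log_neg (norm_pos_iff.mpr (hT q hq).1) (hT q hq).2.1
    rw [qHeight]
    exact div_pos (by linarith) (by positivity)
  -- The logarithm is replaced by ((H/Y)^ε − 1)/ε, so that only powers are integrated. With ε =
  -- (s−1)² the exponent s − 1 − ε factors as (s−1)(2−s), and the terms of size a/ε cancel down to a
  -- simple pole at s = 1.
  set ε : ℝ := (s - 1) ^ 2
  have hs1 : 0 < s - 1 := by linarith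
  have hε : 0 < ε := by positivity
  have hεs : ε < s - 1 := by simp only [ε]; nlinarith
  have hpt : ∀ Y : ℝ, 0 < Y → Y ≤ H →
      ∑ q ∈ T, (2 * π * N * m q) * max (qHeight q - Y) 0 ≤
        K + a / ε * ((H / Y) ^ ε - 1) := by
    intro Y hY hYH
    classical
    have h := hK Y hY hYH (T.filter fun q ↦ Y < qHeight q) (by
      intro q hq
      rw [Finset.mem_filter] at hq
      refine ⟨(hT q hq.1).1, ?_⟩
      rw [norm_eq_exp_qHeight (hT q hq.1).1, Real.exp_lt_exp]
      nlinarith [hq.2])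
    have hlog : Real.log (H / Y) ≤ ((H / Y) ^ ε - 1) / ε := by
      rw [le_div_iff₀ hε, mul_comm, ← Real.log_rpow (by positivity)]
      exact Real.log_le_sub_one_of_pos (by positivity)
    calc ∑ q ∈ T, (2 * π * N * m q) * max (qHeight q - Y) 0
        = ∑ q ∈ T.filter (fun q ↦ Y < qHeight q), N * m q *
            Real.log (Real.exp (-2 * π * Y) / ‖q‖) := by
          rw [Finset.sum_filter]
          refine Finset.sum_congr rfl fun q hq ↦ ?_
          rw [norm_eq_exp_qHeight (hT q hq).1, ← Real.exp_sub, Real.log_exp]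
          split_ifs with hc
          · rw [max_eq_left (by linarith)]
            ring
          · rw [max_eq_right (by linarith), mul_zero]
      _ ≤ K + a * Real.log (H / Y) := h
      _ ≤ K + a * (((H / Y) ^ ε - 1) / ε) := by gcongr
      _ = _ := by ring
  have hI : ∀ q : ℂ, IntervalIntegrable (fun Y : ℝ ↦ max (qHeight q - Y) 0 * Y ^ (s - 2))
      MeasureTheory.volume 0 H := fun q ↦
    (intervalIntegral.intervalIntegrable_rpow' (by linarith)).continuousOn_mul (by fun_prop)
  have hI1 : IntervalIntegrable (fun Y : ℝ ↦ Y ^ (s - 2)) MeasureTheory.volume 0 H :=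
    intervalIntegral.intervalIntegrable_rpow' (by linarith)
  have hI2 : IntervalIntegrable (fun Y : ℝ ↦ Y ^ (s - 2 - ε)) MeasureTheory.volume 0 H :=
    intervalIntegral.intervalIntegrable_rpow' (by linarith)
  have hint : ∫ Y in (0 : ℝ)..H, (∑ q ∈ T, (2 * π * N * m q) *
        (max (qHeight q - Y) 0 * Y ^ (s - 2))) ≤
      ∫ Y in (0 : ℝ)..H, ((K - a / ε) * Y ^ (s - 2) + a / ε * H ^ ε * Y ^ (s - 2 - ε)) := by
    refine intervalIntegral.integral_mono_on_of_le_Ioo hH.le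
      (by simpa only [Finset.sum_fn] using
        IntervalIntegrable.sum T fun q _ ↦ (hI q).const_mul (2 * π * N * m q))
      ((hI1.const_mul _).add (hI2.const_mul _)) fun Y hY ↦ ?_
    have h := mul_le_mul_of_nonneg_right (hpt Y hY.1 hY.2.le) (Real.rpow_nonneg hY.1.le (s - 2))
    rw [Finset.sum_mul] at h
    calc _ = ∑ q ∈ T, 2 * π * N * m q * max (qHeight q - Y) 0 * Y ^ (s - 2) :=
          Finset.sum_congr rfl fun q _ ↦ by ring
      _ ≤ _ := h
      _ = _ := by
          rw [Real.div_rpow hH.le hY.1.le, Real.rpow_sub hY.1 (s - 2) ε]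
          ring
  rw [intervalIntegral.integral_finsetSum fun q _ ↦ (hI q).const_mul _,
    intervalIntegral.integral_add (hI1.const_mul _) (hI2.const_mul _),
    intervalIntegral.integral_const_mul, intervalIntegral.integral_const_mul,
    integral_rpow (by left; linarith), integral_rpow (by left; linarith),
    Real.zero_rpow (by linarith), Real.zero_rpow (by linarith)] at hint
  simp_rw [intervalIntegral.integral_const_mul] at hint
  rw [Finset.sum_congr rfl fun q hq ↦ by
    rw [integral_max_sub_mul_rpow hs (ht q hq) (hT q hq).2.2]] at hint
  have hH' : H ^ ε * H ^ (s - 2 - ε + 1) = H ^ (s - 1) := by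
    rw [← Real.rpow_add hH]; ring_nf
  rw [show s - 2 + 1 = s - 1 by ring, sub_zero, sub_zero] at hint
  have hsub : s - 2 - ε + 1 = (s - 1) * (2 - s) := by simp only [ε]; ring
  calc 2 * π * N * ∑ q ∈ T, m q * qHeight q ^ s
      = s * (s - 1) * ∑ q ∈ T, 2 * π * N * m q * (qHeight q ^ s / (s * (s - 1))) := by
        rw [Finset.mul_sum, Finset.mul_sum]
        refine Finset.sum_congr rfl fun q _ ↦ ?_
        field_simp
    _ ≤ s * (s - 1) * ((K - a / ε) * (H ^ (s - 1) / (s - 1)) +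
          a / ε * H ^ ε * (H ^ (s - 2 - ε + 1) / (s - 2 - ε + 1))) := by gcongr
    _ = _ := by
      have : a / ε * H ^ ε * (H ^ (s - 2 - ε + 1) / (s - 2 - ε + 1)) =
          a / ε * (H ^ (s - 1) / ((s - 1) * (2 - s))) := by
        rw [← hH', hsub]; ring
      rw [this]
      have h2s : (2 - s) ≠ 0 := by linarith
      simp only [ε]
      field_simp
      ring

/-! ### Orders of vanishing and their invariance -/

/-- The derivative of z ↦ q never vanishes, so q is a local coordinate. -/
lemma order_eq_analyticOrderAt_qEis {k : ℕ} (hk : 3 ≤ k) (z : ℍ) :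
    order (eisenstein 7 hk) z = analyticOrderAt (qEis hk) (qParam 1 (z : ℂ)) := by
  have hderiv : deriv (qParam 1) (z : ℂ) ≠ 0 := by
    have : HasDerivAt (qParam 1) (Complex.exp (2 * π * Complex.I * z / (1 : ℝ)) *
        (2 * π * Complex.I * 1 / (1 : ℝ))) (z : ℂ) := by
      unfold qParam
      exact (((hasDerivAt_id (z : ℂ)).const_mul (2 * π * Complex.I)).div_const _).cexp
    rw [this.deriv]
    have := Real.pi_ne_zero
    simp [Complex.exp_ne_zero, this, Complex.I_ne_zero]
  rw [← analyticOrderAt_comp_of_deriv_ne_zero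
    (Function.Periodic.differentiable_qParam.analyticAt _) hderiv, order]
  refine analyticOrderAt_congr ?_
  filter_upwards [isOpen_upperHalfPlaneSet.mem_nhds z.im_pos] with w hw
  rw [ofComplex_apply_of_im_pos hw, ← qEis_qParam]
  rfl

lemma order_ne_top {k : ℕ} (hk : 3 ≤ k) (hk2 : Even k) (z : ℍ) :
    order (eisenstein 7 hk) z ≠ ⊤ := by
  rw [order_eq_analyticOrderAt_qEis]
  exact analyticOrderAt_qEis_ne_top hk hk2
    (Function.Periodic.norm_qParam_lt_one one_pos z.im_pos)

lemma analyticAt_eisenstein_ofComplex {k : ℕ} (hk : 3 ≤ k) (z : ℍ) :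
    AnalyticAt ℂ (fun w : ℂ ↦ eisenstein 7 hk (ofComplex w)) z := by
  have h : AnalyticAt ℂ (qEis hk ∘ qParam 1) (z : ℂ) :=
    (analyticOnNhd_qEis hk _ (by
      simpa using Function.Periodic.norm_qParam_lt_one one_pos z.im_pos)).comp
      (Function.Periodic.differentiable_qParam.analyticAt _)
  refine h.congr ?_
  filter_upwards [isOpen_upperHalfPlaneSet.mem_nhds z.im_pos] with w hw
  rw [ofComplex_apply_of_im_pos hw, ← qEis_qParam]
  rfl

lemma one_le_order_of_eq_zero {k : ℕ} (hk : 3 ≤ k) {z : ℍ} (hz : eisenstein 7 hk z = 0) :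
    1 ≤ order (eisenstein 7 hk) z := by
  rw [Order.one_le_iff_ne_zero, order,
    (analyticAt_eisenstein_ofComplex hk z).analyticOrderAt_ne_zero]
  simpa using hz

/-- Invariance of the order of vanishing under a real Möbius transformation. -/
lemma order_eq_of_moebius {k : ℕ} (hk : 3 ≤ k) {a b c d : ℝ} (hdet : a * d - b * c ≠ 0) {C : ℂ}
    (hC : C ≠ 0) {j : ℕ}
    (hf : ∀ z w : ℍ, (w : ℂ) * (c * z + d) = a * z + b →
      eisenstein 7 hk w = C * (c * z + d) ^ j * eisenstein 7 hk z)
    {z w : ℍ} (h : (w : ℂ) * (c * z + d) = a * z + b) :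
    order (eisenstein 7 hk) w = order (eisenstein 7 hk) z := by
  have hden : (c * z + d : ℂ) ≠ 0 := by
    intro h0
    rw [h0, mul_zero] at h
    have : ((a * d - b * c : ℝ) : ℂ) = 0 := by
      push_cast
      linear_combination (a : ℂ) * h0 + (c : ℂ) * h
    exact hdet (by exact_mod_cast this)
  set g : ℂ → ℂ := fun u ↦ (a * u + b) / (c * u + d) with hg
  have hgz : g z = w := by
    rw [hg]
    simp only
    rw [← h]
    field_simp
  have hgan : AnalyticAt ℂ g z :=
    AnalyticAt.div (by fun_prop) (by fun_prop) hden
  have hgd : deriv g z ≠ 0 := by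
    have h1 : HasDerivAt (fun u : ℂ ↦ (a : ℂ) * u + b) (a * 1) z :=
      ((hasDerivAt_id (z : ℂ)).const_mul (a : ℂ)).add_const _
    have h2 : HasDerivAt (fun u : ℂ ↦ (c : ℂ) * u + d) (c * 1) z :=
      ((hasDerivAt_id (z : ℂ)).const_mul (c : ℂ)).add_const _
    have h3 : HasDerivAt g _ (z : ℂ) := h1.div h2 hden
    rw [h3.deriv]
    refine div_ne_zero ?_ (pow_ne_zero _ hden)
    have : ((a * d - b * c : ℝ) : ℂ) ≠ 0 := by exact_mod_cast hdet
    convert! this using 1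
    push_cast
    ring
  have hcomp := analyticOrderAt_comp_of_deriv_ne_zero
    (f := fun u : ℂ ↦ eisenstein 7 hk (ofComplex u)) hgan hgd
  rw [hgz] at hcomp
  rw [order, ← hcomp, order]
  have hev : ((fun u : ℂ ↦ eisenstein 7 hk (ofComplex u)) ∘ g) =ᶠ[𝓝 (z : ℂ)]
      (fun u : ℂ ↦ C * (c * u + d) ^ j) * fun u : ℂ ↦ eisenstein 7 hk (ofComplex u) := by
    have him : ∀ᶠ u in 𝓝 (z : ℂ), 0 < (g u).im :=
      hgan.continuousAt.eventually (by
        rw [hgz]; exact isOpen_upperHalfPlaneSet.mem_nhds w.im_pos)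
    have hd : ∀ᶠ u in 𝓝 (z : ℂ), (c * u + d : ℂ) ≠ 0 :=
      ContinuousAt.eventually_ne (by fun_prop) hden
    filter_upwards [isOpen_upperHalfPlaneSet.mem_nhds z.im_pos, him, hd] with u hu hu' hu''
    simp only [Function.comp_apply, Pi.mul_apply]
    rw [ofComplex_apply_of_im_pos hu, ofComplex_apply_of_im_pos hu']
    refine hf ⟨u, hu⟩ ⟨g u, hu'⟩ ?_
    exact div_mul_cancel₀ _ hu''
  rw [analyticOrderAt_congr hev, analyticOrderAt_mul (by fun_prop)
    (analyticAt_eisenstein_ofComplex hk z)]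
  have h0 : analyticOrderAt (fun u : ℂ ↦ C * (c * u + d) ^ j) (z : ℂ) = 0 := by
    rw [AnalyticAt.analyticOrderAt_eq_zero (by fun_prop)]
    exact mul_ne_zero hC (pow_ne_zero _ hden)
  rw [h0, zero_add]

lemma linear_ne_zero_of_det {a b c d : ℤ} (h : a * d - b * c = 1) (z : ℍ) :
    (c * z + d : ℂ) ≠ 0 := by
  have := UpperHalfPlane.linear_ne_zero (cd := ![(c : ℝ), (d : ℝ)]) z (by
    intro h0
    have hc : (c : ℝ) = 0 := by simpa using congrFun h0 0
    have hd : (d : ℝ) = 0 := by simpa using congrFun h0 1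
    norm_cast at hc hd
    simp [hc, hd] at h)
  simpa using this

lemma E_moebius {k : ℕ} (hk : 3 ≤ k) {a b c d : ℤ} (h : a * d - b * c = 1) {z w : ℍ}
    (hw : (w : ℂ) * (c * z + d) = a * z + b) :
    ModularForm.E hk w = (c * z + d) ^ k * ModularForm.E hk z := by
  let γ : SL(2, ℤ) := ⟨!![a, b; c, d], by rw [Matrix.det_fin_two_of, h]⟩
  have hγ : γ • z = w := by
    ext1
    rw [coe_specialLinearGroup_apply]
    have := linear_ne_zero_of_det h z
    simp only [γ]
    simp
    rw [← hw, mul_div_assoc, div_self this, mul_one]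
  have := SlashInvariantForm.slash_action_eqn'' (ModularForm.E hk)
    (γ := (γ : GL (Fin 2) ℝ)) (MonoidHom.mem_range.mpr ⟨γ, rfl⟩) z
  rw [← ModularGroup.sl_moeb, hγ, ModularGroup.denom_apply] at this
  simpa [γ] using this

lemma coe_scale (z : ℍ) : (scale 7 z : ℂ) = 7 * z := by
  simp [scale]

lemma eisenstein_moebius {k : ℕ} (hk : 3 ≤ k) {a b c d : ℤ} (h : a * d - 7 * b * c = 1) {z w : ℍ}
    (hw : (w : ℂ) * (7 * c * z + d) = a * z + b) :
    eisenstein 7 hk w = (7 * c * z + d) ^ k * eisenstein 7 hk z := by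
  have h1 : ModularForm.E hk w = (7 * c * z + d) ^ k * ModularForm.E hk z := by
    have := E_moebius hk (a := a) (b := b) (c := 7 * c) (d := d) (by linarith) (z := z) (w := w)
      (by push_cast; exact hw)
    simpa using this
  have h2 : ModularForm.E hk (scale 7 w) = (7 * c * z + d) ^ k * ModularForm.E hk (scale 7 z) := by
    have := E_moebius hk (a := a) (b := 7 * b) (c := c) (d := d) (by linarith)
      (z := scale 7 z) (w := scale 7 w)
      (by rw [coe_scale, coe_scale]; push_cast; linear_combination 7 * hw)
    rw [this, coe_scale]
    ring
  rw [eisenstein, eisenstein, h1, h2]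
  ring

lemma order_moebius {k : ℕ} (hk : 3 ≤ k) {a b c d : ℤ} (h : a * d - 7 * b * c = 1) {z w : ℍ}
    (hw : (w : ℂ) * (7 * c * z + d) = a * z + b) :
    order (eisenstein 7 hk) w = order (eisenstein 7 hk) z := by
  refine order_eq_of_moebius hk (a := a) (b := b) (c := 7 * c) (d := d) (C := 1) (j := k)
    ?_ one_ne_zero ?_ (by push_cast; exact hw)
  · have : ((a * d - 7 * b * c : ℤ) : ℝ) ≠ 0 := by rw [h]; simp
    push_cast at this
    intro h0
    exact this (by linarith)
  · intro z w hw
    push_cast at hw ⊢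
    rw [one_mul]
    exact eisenstein_moebius hk h hw

/-! ### Orbits under Γ₀(7) -/

/-- The images of the points of `S` under distinct cosets of `Γ_∞` in `Γ₀(7)/±1` are distinct. -/
def FreeOrbits (S : Finset ℍ) : Prop :=
  ∀ z ∈ S, ∀ w ∈ S, ∀ a b c d : ℤ, a * d - 7 * b * c = 1 →
    (w : ℂ) * (7 * c * z + d) = a * z + b → z = w ∧ c = 0 ∧ a = d

lemma exists_moebius_image {c d : ℤ} (h : IsCoprime (7 * c) d) (z : ℍ) :
    ∃ w : ℍ, ∃ a b : ℤ, a * d - 7 * b * c = 1 ∧ (w : ℂ) * (7 * c * z + d) = a * z + b ∧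
      w.im = z.im / normSq (7 * c * z + d) := by
  obtain ⟨u, v, huv⟩ := h
  have hdet : v * d - (-u) * (7 * c) = 1 := by linarith
  let γ : SL(2, ℤ) := ⟨!![v, -u; 7 * c, d], by rw [Matrix.det_fin_two_of, hdet]⟩
  refine ⟨γ • z, v, -u, by linarith, ?_, ?_⟩
  · rw [coe_specialLinearGroup_apply]
    have := linear_ne_zero_of_det hdet z
    simp only [γ]
    push_cast at this
    simp
    rw [div_mul_cancel₀ _ this]
  · rw [ModularGroup.im_smul_eq_div_normSq, ModularGroup.denom_apply]
    simp [γ]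

lemma eq_add_int_of_qParam_eq {z w : ℍ} (h : qParam 1 (z : ℂ) = qParam 1 (w : ℂ)) :
    ∃ n : ℤ, (z : ℂ) = w + n := by
  simp only [qParam] at h
  rw [Complex.exp_eq_exp_iff_exists_int] at h
  obtain ⟨n, hn⟩ := h
  refine ⟨n, ?_⟩
  have h2 : (2 * π * Complex.I : ℂ) ≠ 0 := Complex.two_pi_I_ne_zero
  apply mul_left_cancel₀ h2
  simp only [Complex.ofReal_one, div_one] at hn
  linear_combination hn

/-- If γz = γ'z', then γ'⁻¹γ carries z to z', so freeness makes it ±1. The bottom rows of γ and γ'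
then agree up to sign, and c, c' ≥ 1 fixes the sign. -/
lemma eq_of_moebius_eq {S : Finset ℍ} (hS : FreeOrbits S) {z z' : ℍ} (hz : z ∈ S) (hz' : z' ∈ S)
    {a b c d a' b' c' d' : ℤ} (hdet : a * d - 7 * b * c = 1) (hdet' : a' * d' - 7 * b' * c' = 1)
    (hc : 1 ≤ c) (hc' : 1 ≤ c') {u : ℂ} (hu : u * (7 * c * z + d) = a * z + b)
    (hu' : u * (7 * c' * z' + d') = a' * z' + b') : z = z' ∧ c = c' ∧ d = d' := by
  have hrel : (z' : ℂ) * (7 * (a' * c - c' * a : ℤ) * z + (a' * d - 7 * c' * b : ℤ)) =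
      (d' * a - 7 * b' * c : ℤ) * z + (d' * b - b' * d : ℤ) := by
    push_cast
    linear_combination (7 * c' * z' + d') * hu - (7 * c * z + d) * hu'
  obtain ⟨rfl, hC, hAD⟩ := hS z hz z' hz' _ _ _ _
    (by linear_combination (a' * d' - 7 * b' * c') * hdet + hdet') hrel
  have hB : d' * b - b' * d = 0 := by
    rw [hC, ← hAD] at hrel
    have : ((d' * b - b' * d : ℤ) : ℂ) = 0 := by
      push_cast at hrel ⊢
      linear_combination -hrel
    exact_mod_cast this
  have hcA : c = c' * (d' * a - 7 * b' * c) := by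
    linear_combination (-c) * hdet' + d' * hC
  have hdA : d = d' * (d' * a - 7 * b' * c) := by
    linear_combination (-d) * hdet' - d' * hAD + 7 * c' * hB
  have hA1 : (d' * a - 7 * b' * c) * (d' * a - 7 * b' * c) = 1 := by
    nth_rewrite 2 [hAD]
    linear_combination (a' * d' - 7 * b' * c') * hdet + hdet' + 7 * (d' * b - b' * d) * hC
  rcases mul_self_eq_one_iff.mp hA1 with h | h
  · rw [h, mul_one] at hcA hdA
    exact ⟨rfl, hcA, hdA⟩
  · rw [h] at hcA
    omega

/-- Images of points of S under distinct cosets of Γ_∞ have distinct parameters q and the same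
orders of vanishing. Hence `sum_order_mul_height_rpow_le` applies to all of them together. Since c ≥
1, their heights are at most 1 / Im z. -/
theorem sum_orbit_le {k : ℕ} (hk : 3 ≤ k) (hk2 : Even k) {S : Finset ℍ} (hS : FreeOrbits S)
    (N : ℕ) :
    ∃ K H : ℝ, 0 < H ∧ ∀ s : ℝ, 1 < s → s < 2 → ∀ P : Finset (ℤ × ℤ),
      (∀ p ∈ P, 1 ≤ p.1 ∧ IsCoprime (7 * p.1) p.2) →
        2 * π * N * ∑ z ∈ S, ((order (eisenstein 7 hk) z).toNat : ℝ) *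
          ∑ p ∈ P, (z.im / normSq (7 * p.1 * z + p.2)) ^ s ≤
        s * H ^ (s - 1) * (K + ((N * k + 24 : ℕ) : ℝ) / 2 / ((s - 1) * (2 - s))) := by
  classical
  obtain ⟨H, hH, hSH⟩ : ∃ H : ℝ, 0 < H ∧ ∀ z ∈ S, 1 / z.im ≤ H := by
    refine ⟨1 + ∑ z ∈ S, 1 / z.im, ?_, fun z hz ↦ ?_⟩
    · have : 0 ≤ ∑ z ∈ S, 1 / z.im := Finset.sum_nonneg fun z _ ↦ by
        have := z.im_pos; positivity
      linarith
    · have := Finset.single_le_sum (f := fun z : ℍ ↦ 1 / z.im)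
        (fun z _ ↦ by have := z.im_pos; positivity) hz
      beta_reduce at this
      linarith
  obtain ⟨K, hK⟩ := sum_order_mul_height_rpow_le hk hk2 N hH
  refine ⟨K, H, hH, fun s hs hs2 P hP ↦ ?_⟩
  have hex : ∀ x : ℍ × (ℤ × ℤ), IsCoprime (7 * x.2.1) x.2.2 → ∃ w : ℍ, ∃ a b : ℤ,
      a * x.2.2 - 7 * b * x.2.1 = 1 ∧ (w : ℂ) * (7 * x.2.1 * x.1 + x.2.2) = a * x.1 + b ∧
      w.im = x.1.im / normSq (7 * x.2.1 * x.1 + x.2.2) := fun x hx ↦ exists_moebius_image hx x.1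
  choose! φ a b hφ using hex
  have hinj : Set.InjOn (fun x ↦ qParam 1 (φ x : ℂ)) (S ×ˢ P : Finset (ℍ × (ℤ × ℤ))) := by
    rintro ⟨z, c, d⟩ hx ⟨z', c', d'⟩ hx' heq
    simp only [Finset.coe_product, Set.mem_prod, Finset.mem_coe] at hx hx'
    obtain ⟨n, hn⟩ := eq_add_int_of_qParam_eq heq
    obtain ⟨hdet, hw, -⟩ := hφ (z, c, d) (hP _ hx.2).2
    obtain ⟨hdet', hw', -⟩ := hφ (z', c', d') (hP _ hx'.2).2
    have hc := (hP _ hx.2).1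
    have hc' := (hP _ hx'.2).1
    simp only at hdet hw hdet' hw' hc hc' hn
    -- Composing the first matrix with the translation by −n makes the two images equal, and not
    -- only their parameters.
    obtain ⟨rfl, rfl, rfl⟩ := eq_of_moebius_eq hS hx.1 hx'.1
      (a := a (z, c, d) - 7 * n * c) (b := b (z, c, d) - n * d) (c := c) (d := d)
      (by linear_combination hdet) hdet' hc hc' (u := φ (z', c', d'))
      (by push_cast; rw [hn] at hw; linear_combination hw) hw'
    rfl
  have key := hK s hs hs2 ((S ×ˢ P).image fun x ↦ qParam 1 (φ x : ℂ)) ?_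
  · refine le_trans (le_of_eq ?_) key
    rw [Finset.sum_image hinj, Finset.sum_product]
    congr 1
    refine Finset.sum_congr rfl fun z hz ↦ ?_
    rw [Finset.mul_sum]
    refine Finset.sum_congr rfl fun p hp ↦ ?_
    obtain ⟨hdet, hw, him⟩ := hφ (z, p) (hP _ hp).2
    rw [qHeight_qParam, him, analyticOrderNatAt, ← order_eq_analyticOrderAt_qEis hk,
      order_moebius hk hdet hw]
  · intro q hq
    obtain ⟨⟨z, p⟩, hx, rfl⟩ := Finset.mem_image.mp hq
    rw [Finset.mem_product] at hx
    refine ⟨Function.Periodic.qParam_ne_zero _,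
      Function.Periodic.norm_qParam_lt_one one_pos (φ (z, p)).im_pos, ?_⟩
    obtain ⟨hdet, hw, him⟩ := hφ (z, p) (hP _ hx.2).2
    rw [qHeight_qParam, him]
    refine le_trans ?_ (hSH z hx.1)
    have hy := z.im_pos
    have hc : (1 : ℝ) ≤ p.1 := by exact_mod_cast (hP _ hx.2).1
    have : z.im ^ 2 ≤ normSq (7 * p.1 * z + p.2) := by
      have : normSq (7 * p.1 * z + p.2) = (7 * p.1 * z.re + p.2) ^ 2 + (7 * p.1 * z.im) ^ 2 := by
        rw [normSq_apply]
        simp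
        ring
      rw [this]
      nlinarith [sq_nonneg (7 * p.1 * z.re + p.2), mul_le_mul_of_nonneg_right hc hy.le]
    rw [div_le_div_iff₀ (by nlinarith) hy]
    nlinarith

/-! ### The residue at s = 1 of the Eisenstein series in s -/

lemma arctan_add_sub_le {t h : ℝ} (ht : 0 ≤ t) (hh : 0 ≤ h) :
    Real.arctan (t + h) - Real.arctan t ≤ h / (1 + t ^ 2) := by
  have := Convex.image_sub_le_mul_sub_of_deriv_le (convex_Ici t) (f := Real.arctan)
    Real.continuous_arctan.continuousOn Real.differentiable_arctan.differentiableOn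
    (C := 1 / (1 + t ^ 2)) (fun x hx ↦ by
      rw [interior_Ici] at hx
      have hx : t < x := hx
      simp only [Real.deriv_arctan]
      exact one_div_le_one_div_of_le (by positivity) (by nlinarith))
        t (by simp) (t + h) (by simpa using hh) (by linarith)
  calc _ ≤ _ := this
    _ = _ := by ring

/-- For exponent −1 the terms, times h, dominate the increments of arctan, and arctan t ≤ t ≤ h
accounts for the −1. Passing to exponent −s costs (1 + L²)^(1−s), which tends to 1 as s → 1 because
L is fixed. -/
lemma le_sum_one_add_sq_rpow {t h L₀ L s : ℝ} {n : ℕ} (ht : 0 ≤ t) (hth : t ≤ h) (hh : 0 < h)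
    (hn : L₀ ≤ h * n) (hL : h * n ≤ L) (hs : 1 ≤ s) :
    (1 + L ^ 2) ^ (1 - s) * (Real.arctan L₀ / h - 1) ≤
      ∑ j ∈ Finset.range n, (1 + (t + h * j) ^ 2) ^ (-s) := by
  have htel : Real.arctan (t + h * n) - Real.arctan t ≤
      ∑ j ∈ Finset.range n, h / (1 + (t + h * j) ^ 2) := by
    have h1 : Real.arctan (t + h * n) - Real.arctan t =
        ∑ j ∈ Finset.range n, (Real.arctan (t + h * (j + 1 : ℕ)) - Real.arctan (t + h * j)) := by
      rw [Finset.sum_range_sub (fun j : ℕ ↦ Real.arctan (t + h * j))]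
      simp
    rw [h1]
    refine Finset.sum_le_sum fun j _ ↦ ?_
    have := arctan_add_sub_le (t := t + h * j) (h := h) (by positivity) hh.le
    convert! this using 3
    push_cast
    ring
  have hterm : ∀ j ∈ Finset.range n, (1 + L ^ 2) ^ (1 - s) * (1 / (1 + (t + h * j) ^ 2)) ≤
      (1 + (t + h * j) ^ 2) ^ (-s) := by
    intro j hj
    have hj' : (j : ℝ) + 1 ≤ n := by exact_mod_cast Finset.mem_range.mp hj
    have hle : t + h * j ≤ L := by nlinarith
    have h0 : 0 ≤ t + h * j := by positivity
    have hsq : (t + h * j) ^ 2 ≤ L ^ 2 := by gcongr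
    rw [show -s = (1 - s) + (-1) by ring, Real.rpow_add (by positivity), Real.rpow_neg_one, one_div]
    exact mul_le_mul_of_nonneg_right (Real.rpow_le_rpow_of_nonpos (by positivity)
      (by linarith) (by linarith)) (by positivity)
  refine le_trans ?_ (Finset.sum_le_sum hterm)
  rw [← Finset.mul_sum]
  gcongr
  have h2 : ∑ j ∈ Finset.range n, h / (1 + (t + h * j) ^ 2) =
      h * ∑ j ∈ Finset.range n, 1 / (1 + (t + h * j) ^ 2) := by
    rw [Finset.mul_sum]
    exact Finset.sum_congr rfl fun j _ ↦ by ring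
  have h3 : Real.arctan L₀ ≤ Real.arctan (t + h * n) := Real.arctan_mono (by linarith)
  have h4 : Real.arctan t ≤ t := by
    have := arctan_add_sub_le le_rfl ht
    simpa using this
  rw [h2] at htel
  rw [sub_le_iff_le_add, div_le_iff₀ hh]
  nlinarith

/-- The class of v modulo 7 is split at its first nonnegative member v + 7m. The other half,
reflected, starts at 7 − (v + 7m), so both halves are instances of the previous lemma with step 7/w.
-/
lemma le_sum_sq_add_sq_rpow {v w L₀ L s : ℝ} {n : ℕ} (hw : 0 < w)
    (hn : L₀ ≤ 7 / w * n) (hL : 7 / w * n ≤ L) (hs : 1 ≤ s) :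
    ∃ m : ℤ, w ^ (-(2 * s)) * ((1 + L ^ 2) ^ (1 - s) * (2 * w / 7 * Real.arctan L₀ - 2)) ≤
      ∑ j ∈ Finset.range n, (((v + 7 * (m + j : ℤ)) ^ 2 + w ^ 2) ^ (-s) +
        ((v + 7 * (m - 1 - j : ℤ)) ^ 2 + w ^ 2) ^ (-s)) := by
  set m : ℤ := ⌈-v / 7⌉
  have hm1 : -v / 7 ≤ m := Int.le_ceil _
  have hm2 : (m : ℝ) < -v / 7 + 1 := Int.ceil_lt_add_one _
  refine ⟨m, ?_⟩
  have h1 := le_sum_one_add_sq_rpow (t := (v + 7 * m) / w) (h := 7 / w) (by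
    apply div_nonneg _ hw.le; linarith) (by gcongr; linarith) (by positivity) hn hL hs
  have h2 := le_sum_one_add_sq_rpow (t := (7 - (v + 7 * m)) / w) (h := 7 / w) (by
    apply div_nonneg _ hw.le; linarith) (by gcongr; linarith) (by positivity) hn hL hs
  have hfac : ∀ u : ℝ, (u ^ 2 + w ^ 2) ^ (-s) = w ^ (-(2 * s)) * (1 + (u / w) ^ 2) ^ (-s) := by
    intro u
    rw [show -(2 * s) = (2 : ℝ) * (-s) by ring, Real.rpow_mul hw.le,
      ← Real.mul_rpow (by positivity) (by positivity)]
    congr 1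
    rw [Real.rpow_two]
    field_simp
    ring
  rw [Finset.sum_add_distrib]
  simp_rw [hfac]
  rw [← Finset.mul_sum, ← Finset.mul_sum, ← mul_add]
  gcongr
  have e1 : ∑ j ∈ Finset.range n, (1 + ((v + 7 * m) / w + 7 / w * j) ^ 2) ^ (-s) =
      ∑ j ∈ Finset.range n, (1 + ((v + 7 * (m + j : ℤ)) / w) ^ 2) ^ (-s) := by
    refine Finset.sum_congr rfl fun j _ ↦ ?_
    congr 3
    push_cast
    ring
  have e2 : ∑ j ∈ Finset.range n, (1 + ((7 - (v + 7 * m)) / w + 7 / w * j) ^ 2) ^ (-s) =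
      ∑ j ∈ Finset.range n, (1 + ((v + 7 * (m - 1 - j : ℤ)) / w) ^ 2) ^ (-s) := by
    refine Finset.sum_congr rfl fun j _ ↦ ?_
    congr 2
    push_cast
    ring
  rw [← e1, ← e2]
  refine le_trans (le_of_eq ?_) (add_le_add h1 h2)
  field_simp
  ring

/-- As 2s ≥ 2, the sum is at most ζ(2)(1 − 7⁻²) = 8π²/49. -/
lemma sum_rpow_neg_le {G : Finset ℕ} (hG : ∀ g ∈ G, ¬ 7 ∣ g) {s : ℝ} (hs : 1 ≤ s) :
    ∑ g ∈ G, (g : ℝ) ^ (-(2 * s)) ≤ 8 * π ^ 2 / 49 := by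
  classical
  have h2 := hasSum_zeta_two
  have h7 : HasSum (fun n : ℕ ↦ 1 / ((7 * n : ℕ) : ℝ) ^ 2) (1 / 49 * (π ^ 2 / 6)) := by
    convert! h2.mul_left (1 / 49) using 2 with n
    push_cast
    ring
  have hle : ∑ g ∈ G, 1 / (g : ℝ) ^ 2 ≤ π ^ 2 / 6 - 1 / 49 * (π ^ 2 / 6) := by
    rw [← h7.tsum_eq, le_sub_iff_add_le, add_comm, ← le_sub_iff_add_le]
    refine h7.summable.tsum_le_of_sum_le fun U ↦ ?_
    rw [le_sub_iff_add_le, ← h2.tsum_eq]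
    rw [← Finset.sum_image (f := fun n : ℕ ↦ 1 / (n : ℝ) ^ 2) (g := fun n : ℕ ↦ 7 * n)
      (by intro a _ b _ h; simpa using h), ← Finset.sum_union]
    · exact h2.summable.sum_le_tsum _ fun _ _ ↦ by positivity
    · rw [Finset.disjoint_right]
      intro g hg hg'
      obtain ⟨n, -, rfl⟩ := Finset.mem_image.mp hg'
      exact hG _ hg (dvd_mul_right _ _)
  calc ∑ g ∈ G, (g : ℝ) ^ (-(2 * s)) ≤ ∑ g ∈ G, 1 / (g : ℝ) ^ 2 := by
        refine Finset.sum_le_sum fun g hg ↦ ?_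
        have hg1 : (1 : ℝ) ≤ g := by
          have : g ≠ 0 := by rintro rfl; exact hG 0 hg (dvd_zero _)
          exact_mod_cast Nat.one_le_iff_ne_zero.mpr this
        rw [one_div, ← Real.rpow_natCast, ← Real.rpow_neg (by linarith)]
        exact Real.rpow_le_rpow_of_exponent_le hg1 (by push_cast; linarith)
    _ ≤ _ := hle
    _ = _ := by ring

/-- Passing from pairs `(c, d)` with `7 ∤ d` to primitive ones. -/
lemma exists_primitive_sum_ge {ι : Type*} (I : Finset ι) (ψ : ι → ℤ × ℤ) (hinj : Set.InjOn ψ I)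
    (hψ : ∀ i ∈ I, 1 ≤ (ψ i).1 ∧ ¬ 7 ∣ (ψ i).2) {s : ℝ} (hs : 1 ≤ s) (F : ℤ × ℤ → ℝ)
    (hF0 : ∀ p, 0 ≤ F p)
    (hF : ∀ (g : ℕ) (c d : ℤ), 1 ≤ g → F (g * c, g * d) = (g : ℝ) ^ (-(2 * s)) * F (c, d)) :
    ∃ P : Finset (ℤ × ℤ), (∀ p ∈ P, 1 ≤ p.1 ∧ IsCoprime (7 * p.1) p.2) ∧
      ∑ i ∈ I, F (ψ i) ≤ 8 * π ^ 2 / 49 * ∑ p ∈ P, F p := by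
  classical
  let γ : ι → ℕ := fun i ↦ Int.gcd (ψ i).1 (ψ i).2
  let δ : ι → ℤ × ℤ := fun i ↦ ((ψ i).1 / γ i, (ψ i).2 / γ i)
  have hγ : ∀ i ∈ I, 1 ≤ γ i := fun i hi ↦ by
    have : (ψ i).1 ≠ 0 := by have := (hψ i hi).1; omega
    exact Nat.one_le_iff_ne_zero.mpr (by simp [γ, Int.gcd_eq_zero_iff, this])
  have h1 : ∀ i, (γ i : ℤ) * (δ i).1 = (ψ i).1 := fun i ↦ Int.mul_ediv_cancel' (Int.gcd_dvd_left ..)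
  have h2 : ∀ i, (γ i : ℤ) * (δ i).2 = (ψ i).2 := fun i ↦
    Int.mul_ediv_cancel' (Int.gcd_dvd_right ..)
  have hψeq : ∀ i, ψ i = (γ i * (δ i).1, γ i * (δ i).2) := fun i ↦ by rw [h1, h2]
  refine ⟨I.image δ, ?_, ?_⟩
  · intro p hp
    obtain ⟨i, hi, rfl⟩ := Finset.mem_image.mp hp
    have hg := hγ i hi
    constructor
    · by_contra! hlt
      have h3 := h1 i
      have h4 := (hψ i hi).1
      nlinarith
    · refine IsCoprime.mul_left ?_ ?_
      · rw [Prime.coprime_iff_not_dvd (by norm_num : Prime (7 : ℤ))]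
        intro h
        exact (hψ i hi).2 (by rw [← h2]; exact h.mul_left _)
      · rw [Int.isCoprime_iff_gcd_eq_one]
        exact Int.gcd_ediv_gcd_ediv_gcd (by have := hγ i hi; simp only [γ] at this; omega)
  · have hGm : ∀ g ∈ I.image γ, ¬ 7 ∣ g := by
      intro g hg
      obtain ⟨i, hi, rfl⟩ := Finset.mem_image.mp hg
      intro h
      refine (hψ i hi).2 (dvd_trans ?_ (Int.gcd_dvd_right (ψ i).1 (ψ i).2))
      exact_mod_cast h
    -- A pair is recovered from its gcd and its primitive part, so the sum is dominated by the
    -- product of a sum over gcds prime to 7 and a sum over primitive pairs.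
    have hinj' : Set.InjOn (fun i ↦ (γ i, δ i)) I := by
      intro i hi j hj hij
      simp only [Prod.mk.injEq] at hij
      apply hinj hi hj
      rw [hψeq i, hψeq j, hij.1, hij.2]
    calc ∑ i ∈ I, F (ψ i) = ∑ i ∈ I, (γ i : ℝ) ^ (-(2 * s)) * F (δ i) := by
          refine Finset.sum_congr rfl fun i hi ↦ ?_
          rw [hψeq i, hF _ _ _ (hγ i hi)]
      _ = ∑ x ∈ I.image (fun i ↦ (γ i, δ i)), (x.1 : ℝ) ^ (-(2 * s)) * F x.2 := by
          rw [Finset.sum_image hinj']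
      _ ≤ ∑ x ∈ I.image γ ×ˢ I.image δ, (x.1 : ℝ) ^ (-(2 * s)) * F x.2 := by
          refine Finset.sum_le_sum_of_subset_of_nonneg ?_ fun x _ _ ↦ by
            have := hF0 x.2; positivity
          intro x hx
          obtain ⟨i, hi, rfl⟩ := Finset.mem_image.mp hx
          exact Finset.mem_product.mpr ⟨Finset.mem_image_of_mem _ hi, Finset.mem_image_of_mem _ hi⟩
      _ = (∑ g ∈ I.image γ, (g : ℝ) ^ (-(2 * s))) * ∑ p ∈ I.image δ, F p := by
          rw [Finset.sum_mul_sum, Finset.sum_product]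
      _ ≤ _ := by
          gcongr
          · exact Finset.sum_nonneg fun p _ ↦ hF0 p
          · exact sum_rpow_neg_le hGm hs

/-- For each c the d prime to 7 form six classes modulo 7, each treated by `le_sum_sq_add_sq_rpow`
with w = 7c Im z. Taking ⌈L₀ c Im z⌉ terms on either side puts the truncation between L₀ and L₀ + 1
/ Im z for every c ≥ 1. -/
lemma exists_sum_normSq_rpow_ge (z : ℍ) (L₀ : ℝ) (hL₀ : 0 ≤ L₀) {s : ℝ} (hs : 1 ≤ s) (M : ℕ) :
    ∃ P : Finset (ℤ × ℤ), (∀ p ∈ P, 1 ≤ p.1 ∧ IsCoprime (7 * p.1) p.2) ∧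
      ∑ c ∈ Finset.Icc 1 M, 6 * ((7 * c * z.im) ^ (-(2 * s)) *
        ((1 + (L₀ + 1 / z.im) ^ 2) ^ (1 - s) * (2 * (7 * c * z.im) / 7 * Real.arctan L₀ - 2))) ≤
      8 * π ^ 2 / 49 * ∑ p ∈ P, (normSq (7 * p.1 * z + p.2)) ^ (-s) := by
  classical
  have hy := z.im_pos
  set x := z.re
  set y := z.im
  have hnorm : ∀ c d : ℤ, normSq (7 * c * z + d) = (7 * c * x + d) ^ 2 + (7 * c * y) ^ 2 := by
    intro c d
    rw [normSq_apply]
    simp [x, y]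
    ring
  set nn : ℕ → ℕ := fun c ↦ ⌈L₀ * (c * y)⌉₊
  have hmex : ∀ c a : ℕ, 1 ≤ c → ∃ m : ℤ, (7 * c * y) ^ (-(2 * s)) * ((1 + (L₀ + 1 / y) ^ 2) ^ (1 - s)
      * (2 * (7 * c * y) / 7 * Real.arctan L₀ - 2)) ≤
      ∑ j ∈ Finset.range (nn c), (((7 * c * x + a + 7 * (m + j : ℤ)) ^ 2 + (7 * c * y) ^ 2) ^ (-s) +
        ((7 * c * x + a + 7 * (m - 1 - j : ℤ)) ^ 2 + (7 * c * y) ^ 2) ^ (-s)) := by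
    intro c a hc
    have hc' : (1 : ℝ) ≤ c := by exact_mod_cast hc
    have hcy : 0 < c * y := by positivity
    have e : 7 / (7 * c * y) = 1 / (c * y) := by field_simp
    refine le_sum_sq_add_sq_rpow (by positivity) ?_ ?_ hs
    · rw [e, one_div, ← div_eq_inv_mul, le_div_iff₀ hcy]
      exact Nat.le_ceil _
    · rw [e, one_div, ← div_eq_inv_mul, div_le_iff₀ hcy]
      have h1 := (Nat.ceil_lt_add_one (a := L₀ * (c * y)) (by positivity)).le
      have h2 : 1 ≤ 1 / y * (c * y) := by field_simp; exact hc'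
      calc ((nn c : ℕ) : ℝ) ≤ _ := h1
        _ ≤ _ := by rw [add_mul]; linarith
  choose! m hm using hmex
  let I : Finset (Σ _ : (ℕ × ℕ) × Bool, ℕ) :=
    ((Finset.Icc 1 M ×ˢ Finset.Icc 1 6) ×ˢ (Finset.univ : Finset Bool)).sigma
      fun t ↦ Finset.range (nn t.1.1)
  let ψ : (Σ _ : (ℕ × ℕ) × Bool, ℕ) → ℤ × ℤ := fun i ↦
    (i.1.1.1, i.1.1.2 + 7 * bif i.1.2 then m i.1.1.1 i.1.1.2 + i.2 else m i.1.1.1 i.1.1.2 - 1 - i.2)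
  have hIm : ∀ c a b j, (⟨((c, a), b), j⟩ : Σ _ : (ℕ × ℕ) × Bool, ℕ) ∈ I →
      1 ≤ c ∧ 1 ≤ a ∧ a ≤ 6 := by
    intro c a b j h
    simp only [I, Finset.mem_sigma, Finset.mem_product, Finset.mem_Icc] at h
    exact ⟨h.1.1.1.1, h.1.1.2.1, h.1.1.2.2⟩
  have hprim := exists_primitive_sum_ge I ψ ?_ ?_ hs
    (fun p ↦ (normSq (7 * p.1 * z + p.2)) ^ (-s)) (fun p ↦ Real.rpow_nonneg (normSq_nonneg _) _) ?_
  · obtain ⟨P, hP, hle⟩ := hprim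
    refine ⟨P, hP, le_trans ?_ hle⟩
    rw [Finset.sum_sigma, Finset.sum_product, Finset.sum_product]
    refine Finset.sum_le_sum fun c hc ↦ ?_
    rw [Finset.mem_Icc] at hc
    have h6 : (6 : ℝ) = ∑ a ∈ Finset.Icc 1 6, (1 : ℝ) := by simp
    rw [h6, Finset.sum_mul]
    refine Finset.sum_le_sum fun a ha ↦ ?_
    rw [one_mul]
    refine (hm c a hc.1).trans (le_of_eq ?_)
    simp only [Fintype.univ_bool, Finset.mem_singleton, Bool.true_eq_false, not_false_eq_true,
      Finset.sum_insert, Finset.sum_singleton]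
    rw [Finset.sum_add_distrib]
    congr 1
    · refine Finset.sum_congr rfl fun j _ ↦ ?_
      simp only [ψ, hnorm]
      push_cast
      simp only [cond_true]
      congr 2
      push_cast
      ring
    · refine Finset.sum_congr rfl fun j _ ↦ ?_
      simp only [ψ, hnorm]
      push_cast
      simp only [cond_false]
      congr 2
      push_cast
      ring
  · rintro ⟨⟨⟨c, a⟩, b⟩, j⟩ hi ⟨⟨⟨c', a'⟩, b'⟩, j'⟩ hi' h
    obtain ⟨-, h1, h2⟩ := hIm _ _ _ _ hi
    obtain ⟨-, h1', h2'⟩ := hIm _ _ _ _ hi'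
    simp only [ψ, Prod.mk.injEq, Nat.cast_inj] at h
    obtain ⟨rfl, h⟩ := h
    have haa : a = a' := by
      generalize (bif b then m c a + j else m c a - 1 - j) = u at h
      generalize (bif b' then m c a' + j' else m c a' - 1 - j') = u' at h
      omega
    subst haa
    cases b <;> cases b' <;> simp only [cond_true, cond_false] at h
    · have : j = j' := by omega
      rw [this]
    · omega
    · omega
    · have : j = j' := by omega
      rw [this]
  · rintro ⟨⟨⟨c, a⟩, b⟩, j⟩ hi
    obtain ⟨h0, h1, h2⟩ := hIm _ _ _ _ hi
    refine ⟨by simpa [ψ] using h0, ?_⟩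
    simp only [ψ]
    generalize (bif b then m c a + j else m c a - 1 - j) = u
    omega
  · intro g c d hg
    have hg' : (0 : ℝ) < g := by exact_mod_cast hg
    simp only
    have : normSq (7 * ((g * c : ℤ) : ℂ) * z + ((g * d : ℤ) : ℂ)) =
        (g : ℝ) ^ 2 * normSq (7 * c * z + d) := by
      rw [hnorm, hnorm]
      push_cast
      ring
    rw [this, Real.mul_rpow (by positivity) (normSq_nonneg _), ← Real.rpow_natCast,
      ← Real.rpow_mul hg'.le]
    congr 2
    push_cast
    ring

/-- The main terms summed over c give ζ(2s−1), and the errors at most ζ(2) ≤ 2. Subtracting 1 from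
ζ(2s−1) pays for cutting the sum at a finite M; this is harmless because ζ(2s−1) → ∞ as s → 1. -/
lemma exists_sum_normSq_rpow_ge_of_one_lt (z : ℍ) (L₀ : ℝ) (hL₀ : 0 ≤ L₀) {s : ℝ} (hs : 1 < s) :
    ∃ P : Finset (ℤ × ℤ), (∀ p ∈ P, 1 ≤ p.1 ∧ IsCoprime (7 * p.1) p.2) ∧
      49 / (8 * π ^ 2) * (12 * (7 * z.im) ^ (-(2 * s)) * (1 + (L₀ + 1 / z.im) ^ 2) ^ (1 - s) *
        (Real.arctan L₀ * z.im * (∑' n : ℕ, 1 / (n : ℝ) ^ (2 * s - 1) - 1) - 2)) ≤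
      ∑ p ∈ P, (normSq (7 * p.1 * z + p.2)) ^ (-s) := by
  have hy := z.im_pos
  have hsum : Summable fun n : ℕ ↦ 1 / (n : ℝ) ^ (2 * s - 1) :=
    Real.summable_one_div_nat_rpow.mpr (by linarith)
  obtain ⟨M, hM⟩ : ∃ M : ℕ, ∑' n : ℕ, 1 / (n : ℝ) ^ (2 * s - 1) - 1 ≤
      ∑ c ∈ Finset.Icc 1 M, 1 / (c : ℝ) ^ (2 * s - 1) := by
    have h := hsum.hasSum.tendsto_sum_nat.eventually
      (lt_mem_nhds (sub_one_lt (∑' n : ℕ, 1 / (n : ℝ) ^ (2 * s - 1))))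
    obtain ⟨M, hM⟩ := h.exists
    refine ⟨M, hM.le.trans ?_⟩
    rw [Finset.range_eq_Ico]
    -- The term n = 0 is 1/0 = 0.
    refine (Finset.sum_le_sum_of_subset_of_nonneg (t := insert 0 (Finset.Icc 1 M)) ?_
      fun _ _ _ ↦ by positivity).trans_eq ?_
    · intro n hn
      simp only [Finset.mem_Ico, Finset.mem_insert, Finset.mem_Icc] at hn ⊢
      omega
    · rw [Finset.sum_insert (by simp), Nat.cast_zero, Real.zero_rpow (by linarith)]
      simp
  have hM2 : ∑ c ∈ Finset.Icc 1 M, (c : ℝ) ^ (-(2 * s)) ≤ 2 := by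
    have h2 := hasSum_zeta_two
    have hπ : π ^ 2 / 6 ≤ 2 := by nlinarith [Real.pi_pos, Real.pi_lt_d2]
    refine le_trans (le_trans (Finset.sum_le_sum fun c hc ↦ ?_)
      (h2.summable.sum_le_tsum (Finset.Icc 1 M) fun _ _ ↦ by positivity)) (h2.tsum_eq ▸ hπ)
    have hc1 : (1 : ℝ) ≤ c := by exact_mod_cast (Finset.mem_Icc.mp hc).1
    rw [one_div, ← Real.rpow_natCast, ← Real.rpow_neg (by linarith)]
    exact Real.rpow_le_rpow_of_exponent_le hc1 (by push_cast; linarith)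
  obtain ⟨P, hP, hle⟩ := exists_sum_normSq_rpow_ge z L₀ hL₀ hs.le M
  refine ⟨P, hP, ?_⟩
  have hπ := Real.pi_pos
  rw [div_mul_eq_mul_div, div_le_iff₀ (by positivity)]
  set D := (1 + (L₀ + 1 / z.im) ^ 2) ^ (1 - s)
  have hD : 0 ≤ D := by positivity
  have hA : 0 ≤ Real.arctan L₀ := Real.arctan_nonneg.mpr hL₀
  have hE : 0 ≤ (7 * z.im) ^ (-(2 * s)) := by positivity
  have hform : ∑ c ∈ Finset.Icc 1 M, 6 * ((7 * c * z.im) ^ (-(2 * s)) *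
        (D * (2 * (7 * c * z.im) / 7 * Real.arctan L₀ - 2))) =
      12 * (7 * z.im) ^ (-(2 * s)) * D * (Real.arctan L₀ * z.im *
        (∑ c ∈ Finset.Icc 1 M, 1 / (c : ℝ) ^ (2 * s - 1)) -
        ∑ c ∈ Finset.Icc 1 M, (c : ℝ) ^ (-(2 * s))) := by
    rw [Finset.mul_sum, ← Finset.sum_sub_distrib, Finset.mul_sum]
    refine Finset.sum_congr rfl fun c hc ↦ ?_
    have hc1 : (0 : ℝ) < c := by exact_mod_cast (Finset.mem_Icc.mp hc).1
    rw [show 7 * c * z.im = c * (7 * z.im) by ring, Real.mul_rpow hc1.le (by positivity),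
      one_div, ← Real.rpow_neg hc1.le, show -(2 * s - 1) = -(2 * s) + 1 by ring,
      Real.rpow_add_one hc1.ne']
    ring
  rw [hform] at hle
  have hmono : 12 * (7 * z.im) ^ (-(2 * s)) * D * (Real.arctan L₀ * z.im *
        (∑' n : ℕ, 1 / (n : ℝ) ^ (2 * s - 1) - 1) - 2) ≤
      12 * (7 * z.im) ^ (-(2 * s)) * D * (Real.arctan L₀ * z.im *
        (∑ c ∈ Finset.Icc 1 M, 1 / (c : ℝ) ^ (2 * s - 1)) -
        ∑ c ∈ Finset.Icc 1 M, (c : ℝ) ^ (-(2 * s))) := by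
    gcongr
  linarith [hmono.trans hle]

/-- The residue at `s = 1` of the Eisenstein series attached to the cosets of `Γ_∞` in `Γ₀(7)`. -/
lemma eventually_exists_sum_im_rpow_ge (z : ℍ) {ε : ℝ} (hε : 0 < ε) :
    ∀ᶠ s : ℝ in 𝓝[>] 1, ∃ P : Finset (ℤ × ℤ), (∀ p ∈ P, 1 ≤ p.1 ∧ IsCoprime (7 * p.1) p.2) ∧
      3 / (8 * π) - ε ≤ (s - 1) * ∑ p ∈ P, (z.im / normSq (7 * p.1 * z + p.2)) ^ s := by
  have hy := z.im_pos
  have hπ := Real.pi_pos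
  -- The target 3/(8π) is the reciprocal of the area 8π/3 of Γ₀(7)\ℍ; it is reached as arctan L₀ →
  -- π/2.
  obtain ⟨L₀, hL, hL₀⟩ : ∃ L₀ : ℝ, 3 / (8 * π) - ε < 3 / (4 * π ^ 2) * Real.arctan L₀ ∧ 0 ≤ L₀ := by
    have h := (Real.tendsto_arctan_atTop.mono_right nhdsWithin_le_nhds).const_mul (3 / (4 * π ^ 2))
    have heq : 3 / (4 * π ^ 2) * (π / 2) = 3 / (8 * π) := by field_simp; norm_num
    rw [heq] at h
    exact ((h.eventually (lt_mem_nhds (by linarith : 3 / (8 * π) - ε < 3 / (8 * π)))).and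
      (eventually_ge_atTop 0)).exists
  set A := Real.arctan L₀
  set Z : ℝ → ℝ := fun s ↦ ∑' n : ℕ, 1 / (n : ℝ) ^ s
  set Φ : ℝ → ℝ := fun s ↦ 49 / (8 * π ^ 2) * (12 * (7 * z.im) ^ (-(2 * s)) *
    (1 + (L₀ + 1 / z.im) ^ 2) ^ (1 - s) * z.im ^ s *
      (A * z.im * ((s - 1) * Z (2 * s - 1) - (s - 1)) - 2 * (s - 1)))
  have hZ : Tendsto (fun s : ℝ ↦ (s - 1) * Z (2 * s - 1)) (𝓝[>] 1) (𝓝 (1 / 2)) := by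
    have h1 : Tendsto (fun s : ℝ ↦ 2 * s - 1) (𝓝[>] 1) (𝓝[>] 1) := by
      refine tendsto_nhdsWithin_iff.mpr ⟨?_, ?_⟩
      · have : Tendsto (fun s : ℝ ↦ 2 * s - 1) (𝓝 1) (𝓝 (2 * 1 - 1)) := by
          apply Continuous.tendsto; fun_prop
        norm_num at this
        exact this.mono_left nhdsWithin_le_nhds
      · filter_upwards [self_mem_nhdsWithin] with s hs
        simp only [Set.mem_Ioi] at hs ⊢
        linarith
    have h2 := (tendsto_sub_mul_tsum_nat_rpow.comp h1).const_mul (1 / 2)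
    rw [mul_one] at h2
    refine h2.congr fun s ↦ ?_
    simp only [Function.comp_apply, Z]
    ring
  -- At s = 1 the powers of Im z cancel and (s−1)ζ(2s−1) → 1/2, leaving 49/(8π²) · 12/49 · A/2 =
  -- 3A/(4π²).
  have hΦ : Tendsto Φ (𝓝[>] 1) (𝓝 (3 / (4 * π ^ 2) * A)) := by
    have hid : Tendsto (fun s : ℝ ↦ s - 1) (𝓝[>] 1) (𝓝 0) := by
      have : Tendsto (fun s : ℝ ↦ s - 1) (𝓝 1) (𝓝 (1 - 1)) := by
        apply Continuous.tendsto; fun_prop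
      rw [sub_self] at this
      exact this.mono_left nhdsWithin_le_nhds
    have hpre : Tendsto (fun s : ℝ ↦ 12 * (7 * z.im) ^ (-(2 * s)) *
        (1 + (L₀ + 1 / z.im) ^ 2) ^ (1 - s) * z.im ^ s) (𝓝[>] 1)
        (𝓝 (12 * (7 * z.im) ^ (-(2 * 1) : ℝ) *
        (1 + (L₀ + 1 / z.im) ^ 2) ^ (1 - 1 : ℝ) * z.im ^ (1 : ℝ))) := by
      refine Tendsto.mono_left (Continuous.tendsto ?_ _) nhdsWithin_le_nhds
      refine ((continuous_const.mul (Continuous.rpow continuous_const (by fun_prop) ?_)).mul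
        (Continuous.rpow continuous_const (by fun_prop) ?_)).mul
        (Continuous.rpow continuous_const continuous_id ?_)
      · intro _; left; positivity
      · intro _; left; positivity
      · intro _; left; positivity
    have h := ((hpre.mul (((hZ.sub hid).const_mul (A * z.im)).sub (hid.const_mul 2)))).const_mul
      (49 / (8 * π ^ 2))
    convert! h using 2
    rw [show (-(2 * 1) : ℝ) = -(2 : ℕ) by norm_num, Real.rpow_neg (by positivity),
      Real.rpow_natCast, sub_self, Real.rpow_zero, Real.rpow_one]
    field_simp
    ring
  filter_upwards [hΦ.eventually (lt_mem_nhds hL), self_mem_nhdsWithin] with s hs hs1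
  have hs1 : 1 < s := hs1
  obtain ⟨P, hP, hle⟩ := exists_sum_normSq_rpow_ge_of_one_lt z L₀ hL₀ hs1
  refine ⟨P, hP, hs.le.trans ?_⟩
  have hrw : ∑ p ∈ P, (z.im / normSq (7 * p.1 * z + p.2)) ^ s =
      z.im ^ s * ∑ p ∈ P, (normSq (7 * p.1 * z + p.2)) ^ (-s) := by
    rw [Finset.mul_sum]
    refine Finset.sum_congr rfl fun p _ ↦ ?_
    rw [Real.div_rpow hy.le (normSq_nonneg _), Real.rpow_neg (normSq_nonneg _), div_eq_mul_inv]
  rw [hrw]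
  have hpos : 0 ≤ (s - 1) * z.im ^ s := mul_nonneg (by linarith) (by positivity)
  calc Φ s = (s - 1) * z.im ^ s * _ := by simp only [Φ]; ring
    _ ≤ (s - 1) * z.im ^ s * _ := mul_le_mul_of_nonneg_left hle hpos
    _ = _ := by ring

/-! ### The valence inequality for Γ₀(7) -/

/-- An upper bound for the number of zeros of the Eisenstein series modulo `Γ₀(7)`. -/
theorem three_mul_sum_order_le {k : ℕ} (hk : 3 ≤ k) (hk2 : Even k) {S : Finset ℍ}
    (hS : FreeOrbits S) :
    3 * ∑ z ∈ S, (order (eisenstein 7 hk) z).toNat ≤ 2 * k := by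
  classical
  have hπ := Real.pi_pos
  set m : ℍ → ℕ := fun z ↦ (order (eisenstein 7 hk) z).toNat
  -- A general N leads to 3Nμ ≤ 2Nk + 48; N = 49 is the least value for which integrality absorbs
  -- the 48.
  obtain ⟨K, H, hH, hKH⟩ := sum_orbit_le hk hk2 hS 49
  set a : ℝ := ((49 * k + 24 : ℕ) : ℝ) / 2
  set μ : ℝ := ∑ z ∈ S, (m z : ℝ)
  have hμ : 0 ≤ μ := Finset.sum_nonneg fun _ _ ↦ by positivity
  have hε : ∀ ε : ℝ, 0 < ε → 2 * π * 49 * (μ * (3 / (8 * π) - ε)) ≤ a := by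
    intro ε hε
    have hev : ∀ᶠ s : ℝ in 𝓝[>] 1, ∀ z ∈ S, ∃ P : Finset (ℤ × ℤ),
        (∀ p ∈ P, 1 ≤ p.1 ∧ IsCoprime (7 * p.1) p.2) ∧
        3 / (8 * π) - ε ≤ (s - 1) * ∑ p ∈ P, (z.im / normSq (7 * p.1 * z + p.2)) ^ s :=
      (Finset.eventually_all S).mpr fun z _ ↦ eventually_exists_sum_im_rpow_ge z hε
    have hlim : Tendsto (fun s : ℝ ↦ s * H ^ (s - 1) * (K * (s - 1) + a / (2 - s))) (𝓝[>] 1)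
        (𝓝 a) := by
      have h1 : ContinuousAt (fun s : ℝ ↦ s * H ^ (s - 1) * (K * (s - 1) + a / (2 - s))) 1 := by
        refine (continuousAt_id.mul (ContinuousAt.rpow continuousAt_const (by fun_prop)
          (Or.inl hH.ne'))).mul ?_
        refine ContinuousAt.add (by fun_prop) ?_
        exact continuousAt_const.div (by fun_prop) (by norm_num)
      have h2 := h1.tendsto
      norm_num at h2
      exact h2.mono_left nhdsWithin_le_nhds
    refine ge_of_tendsto hlim ?_
    filter_upwards [hev, Ioo_mem_nhdsGT (show (1 : ℝ) < 2 by norm_num)] with s hs hs12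
    choose! P hP hPs using hs
    have hs1 : 0 < s - 1 := by linarith [hs12.1]
    have h2s : 0 < 2 - s := by linarith [hs12.2]
    have key := hKH s hs12.1 hs12.2 (S.biUnion P) (by
      intro p hp
      obtain ⟨z, hz, hp⟩ := Finset.mem_biUnion.mp hp
      exact hP z hz p hp)
    have hlow : μ * (3 / (8 * π) - ε) ≤ (s - 1) * ∑ z ∈ S, (m z : ℝ) *
        ∑ p ∈ S.biUnion P, (z.im / normSq (7 * p.1 * z + p.2)) ^ s := by
      rw [Finset.sum_mul, Finset.mul_sum]
      refine Finset.sum_le_sum fun z hz ↦ ?_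
      rw [mul_left_comm]
      refine mul_le_mul_of_nonneg_left ((hPs z hz).trans ?_) (by positivity)
      refine mul_le_mul_of_nonneg_left ?_ hs1.le
      refine Finset.sum_le_sum_of_subset_of_nonneg (Finset.subset_biUnion_of_mem P hz)
        fun p _ _ ↦ Real.rpow_nonneg (div_nonneg z.im_pos.le (normSq_nonneg _)) _
    calc 2 * π * 49 * (μ * (3 / (8 * π) - ε)) ≤ 2 * π * 49 * ((s - 1) * ∑ z ∈ S, (m z : ℝ) *
          ∑ p ∈ S.biUnion P, (z.im / normSq (7 * p.1 * z + p.2)) ^ s) := by gcongr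
      _ = (s - 1) * (2 * π * (49 : ℕ) * ∑ z ∈ S, (m z : ℝ) *
          ∑ p ∈ S.biUnion P, (z.im / normSq (7 * p.1 * z + p.2)) ^ s) := by push_cast; ring
      _ ≤ (s - 1) * (s * H ^ (s - 1) * (K + a / ((s - 1) * (2 - s)))) := by gcongr
      _ = _ := by field_simp
  have hfin : 2 * π * 49 * (μ * (3 / (8 * π))) ≤ a := by
    have hlim : Tendsto (fun ε : ℝ ↦ 2 * π * 49 * (μ * (3 / (8 * π) - ε))) (𝓝[>] 0)
        (𝓝 (2 * π * 49 * (μ * (3 / (8 * π) - 0)))) :=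
      Tendsto.mono_left (Continuous.tendsto (by fun_prop) _) nhdsWithin_le_nhds
    rw [sub_zero] at hlim
    refine le_of_tendsto hlim ?_
    filter_upwards [self_mem_nhdsWithin] with ε h using hε ε h
  have h1 : 2 * π * 49 * (μ * (3 / (8 * π))) = 147 / 4 * μ := by field_simp; ring
  rw [h1] at hfin
  have h2 : 147 * μ ≤ 98 * k + 48 := by
    simp only [a] at hfin
    push_cast at hfin
    linarith
  have h3 : μ = ((∑ z ∈ S, m z : ℕ) : ℝ) := by simp [μ]
  rw [h3] at h2
  have h4 : 147 * ∑ z ∈ S, m z ≤ 98 * k + 48 := by exact_mod_cast h2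
  change 3 * ∑ z ∈ S, m z ≤ 2 * k
  omega

/-! ### Reduction theory in the fundamental domain -/

/-- With n = |z|² and X = |Re z| the form is |7cz ± d|², affine in (n, X). When cd > 0 it is
controlled by the corners (1/7, 5/14) and (2/7, 1/2). There it becomes 7c² − 5cd + d² ≥ 1 and 14c² −
7cd + d² ≥ 2, positive definite integral forms of discriminants −3 and −7. -/
lemma one_lt_quadratic_of_bottom_row {n X : ℝ} (hX0 : 0 ≤ X) (hX : X ≤ 1 / 2) (hn : 1 / 7 ≤ n)
    (hn2 : X - 3 / 14 ≤ n) (hne : ¬ (n = 1 / 7 ∧ X = 5 / 14)) {c : ℤ} (hc : c ≠ 0) (d : ℤ) :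
    1 < 49 * (c : ℝ) ^ 2 * n - 14 * c * d * X + (d : ℝ) ^ 2 := by
  have hc2 : (1 : ℝ) ≤ (c : ℝ) ^ 2 := by
    have : 0 < c ^ 2 := by positivity
    exact_mod_cast this
  rcases le_or_gt (c * d) 0 with hcd | hcd
  · have hcd' : (c : ℝ) * d ≤ 0 := by exact_mod_cast hcd
    nlinarith [sq_nonneg (d : ℝ), mul_nonneg (neg_nonneg.mpr hcd') hX0,
      mul_le_mul_of_nonneg_left hn (sq_nonneg (c : ℝ))]
  have hcd' : (0 : ℝ) < (c : ℝ) * d := by exact_mod_cast hcd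
  have hP : (1 : ℝ) ≤ 7 * (c : ℝ) ^ 2 - 5 * c * d + (d : ℝ) ^ 2 := by
    have : 0 < 7 * c ^ 2 - 5 * c * d + d ^ 2 := by
      have : 0 < c ^ 2 := by positivity
      nlinarith [sq_nonneg (2 * d - 5 * c)]
    exact_mod_cast this
  rcases le_or_gt X (5 / 14) with hX5 | hX5
  · have h1 : 0 ≤ (c : ℝ) ^ 2 * (n - 1 / 7) := by
      apply mul_nonneg (sq_nonneg _); linarith
    have h2 : 0 ≤ (c : ℝ) * d * (5 / 14 - X) := mul_nonneg hcd'.le (by linarith)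
    by_contra! hle
    have h3 : (c : ℝ) ^ 2 * (n - 1 / 7) = 0 := by nlinarith
    have h4 : (c : ℝ) * d * (5 / 14 - X) = 0 := by nlinarith
    rcases mul_eq_zero.mp h3 with h | h
    · linarith
    rcases mul_eq_zero.mp h4 with h' | h'
    · linarith
    exact hne ⟨by linarith, by linarith⟩
  · have hR : (2 : ℝ) ≤ 14 * (c : ℝ) ^ 2 - 7 * c * d + (d : ℝ) ^ 2 := by
      have : 1 < 14 * c ^ 2 - 7 * c * d + d ^ 2 := by
        have : 0 < c ^ 2 := by positivity
        nlinarith [sq_nonneg (2 * d - 7 * c)]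
      exact_mod_cast this
    have h1 : 0 ≤ (c : ℝ) ^ 2 * (n - (X - 3 / 14)) := by
      apply mul_nonneg (sq_nonneg _); linarith
    have h2 := mul_le_mul_of_nonneg_left hP (show 0 ≤ 7 / 2 - 7 * X by linarith)
    have h3 := mul_le_mul_of_nonneg_left hR (show 0 ≤ 7 * X - 5 / 2 by linarith)
    nlinarith

/-- At the same corners the form becomes d² − 5dc + 7c² and 2d² − 7dc + 7c². The latter takes the
value 1 at (d, c) = ±(2, 1), and c = 0 can give the value 1 when n = 1/7. These are the two
exceptions, one on each circle. -/
lemma one_lt_quadratic_of_top_row {n X : ℝ} (hX0 : 0 ≤ X) (hX : X ≤ 1 / 2) (hn : 1 / 7 ≤ n)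
    (hn2 : X - 3 / 14 ≤ n) (hne : ¬ (n = 1 / 7 ∧ X = 5 / 14)) {d : ℤ} (hd : d ≠ 0) (c : ℤ) :
    1 < 7 * (d : ℝ) ^ 2 * n - 14 * d * c * X + 7 * (c : ℝ) ^ 2 ∨ (c = 0 ∧ n = 1 / 7) ∨
      (d = 2 * c ∧ n = X - 3 / 14 ∧ 5 / 14 < X) := by
  have hd2 : (1 : ℝ) ≤ (d : ℝ) ^ 2 := by
    have : 0 < d ^ 2 := by positivity
    exact_mod_cast this
  by_cases hc : c = 0
  · rcases hn.eq_or_lt with h | h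
    · exact Or.inr (Or.inl ⟨hc, h.symm⟩)
    · left
      simp only [hc, Int.cast_zero]
      nlinarith
  have hc2 : (1 : ℝ) ≤ (c : ℝ) ^ 2 := by
    have : 0 < c ^ 2 := by positivity
    exact_mod_cast this
  rcases le_or_gt (d * c) 0 with hcd | hcd
  · left
    have hcd' : (d : ℝ) * c ≤ 0 := by exact_mod_cast hcd
    nlinarith [mul_nonneg (neg_nonneg.mpr hcd') hX0,
      mul_le_mul_of_nonneg_left hn (sq_nonneg (d : ℝ))]
  have hcd' : (0 : ℝ) < (d : ℝ) * c := by exact_mod_cast hcd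
  have hP : (1 : ℝ) ≤ (d : ℝ) ^ 2 - 5 * d * c + 7 * (c : ℝ) ^ 2 := by
    have : 0 < d ^ 2 - 5 * d * c + 7 * c ^ 2 := by
      have : 0 < c ^ 2 := by positivity
      nlinarith [sq_nonneg (2 * d - 5 * c)]
    exact_mod_cast this
  rcases le_or_gt X (5 / 14) with hX5 | hX5
  · left
    have h1 : 0 ≤ (d : ℝ) ^ 2 * (n - 1 / 7) := by
      apply mul_nonneg (sq_nonneg _); linarith
    have h2 : 0 ≤ (d : ℝ) * c * (5 / 14 - X) := mul_nonneg hcd'.le (by linarith)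
    by_contra! hle
    have h3 : (d : ℝ) ^ 2 * (n - 1 / 7) = 0 := by nlinarith
    have h4 : (d : ℝ) * c * (5 / 14 - X) = 0 := by nlinarith
    rcases mul_eq_zero.mp h3 with h | h
    · linarith
    rcases mul_eq_zero.mp h4 with h' | h'
    · linarith
    exact hne ⟨by linarith, by linarith⟩
  · have h2 := mul_le_mul_of_nonneg_left hP (show 0 ≤ 7 / 2 - 7 * X by linarith)
    have hR0 : 0 < 2 * d ^ 2 - 7 * d * c + 7 * c ^ 2 := by
      have : 0 < c ^ 2 := by positivity
      nlinarith [sq_nonneg (4 * d - 7 * c)]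
    by_cases hR1 : 2 * d ^ 2 - 7 * d * c + 7 * c ^ 2 = 1
    · have hsq : (4 * d - 7 * c) ^ 2 + 7 * c ^ 2 = 8 := by linear_combination 8 * hR1
      have hcle : c ≤ 1 := by nlinarith [sq_nonneg (4 * d - 7 * c)]
      have hcge : -1 ≤ c := by nlinarith [sq_nonneg (4 * d - 7 * c)]
      have hdc : d = 2 * c := by
        have hc1 : c = 1 ∨ c = -1 := by omega
        rcases hc1 with rfl | rfl
        · have h5 : (d - 2) * (2 * d - 3) = 0 := by linarith
          rcases mul_eq_zero.mp h5 with h | h <;> omega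
        · have h5 : (d + 2) * (2 * d + 3) = 0 := by linarith
          rcases mul_eq_zero.mp h5 with h | h <;> omega
      rcases hn2.eq_or_lt with h | h
      · exact Or.inr (Or.inr ⟨hdc, h.symm, hX5⟩)
      · left
        have hR : (1 : ℝ) = 2 * (d : ℝ) ^ 2 - 7 * d * c + 7 * (c : ℝ) ^ 2 := by
          exact_mod_cast hR1.symm
        have h1 : 0 < (d : ℝ) ^ 2 * (n - (X - 3 / 14)) := by
          apply mul_pos <;> linarith
        nlinarith
    · left
      have hR : (2 : ℝ) ≤ 2 * (d : ℝ) ^ 2 - 7 * d * c + 7 * (c : ℝ) ^ 2 := by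
        have : 2 ≤ 2 * d ^ 2 - 7 * d * c + 7 * c ^ 2 := by omega
        exact_mod_cast this
      have h1 : 0 ≤ (d : ℝ) ^ 2 * (n - (X - 3 / 14)) := by
        apply mul_nonneg (sq_nonneg _); linarith
      have h3 := mul_le_mul_of_nonneg_left hR (show 0 ≤ 7 * X - 5 / 2 by linarith)
      nlinarith

lemma sqrt_le_norm_iff {a : ℝ} (w : ℂ) : √a ≤ ‖w‖ ↔ a ≤ normSq w := by
  rw [← Complex.sq_norm, Real.sqrt_le_left (norm_nonneg _)]

lemma one_div_sqrt_seven : 1 / √((7 : ℕ) : ℝ) = √(1 / 7) := by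
  rw [Real.sqrt_div (by norm_num), Real.sqrt_one]; norm_num

lemma one_div_two_mul_sqrt_seven : 1 / (2 * √((7 : ℕ) : ℝ)) = √(1 / 28) := by
  rw [show (1 / 28 : ℝ) = (1 / 2) ^ 2 * (1 / 7) by norm_num,
    Real.sqrt_mul (by norm_num), Real.sqrt_sq (by norm_num), ← one_div_sqrt_seven]
  field_simp

lemma normSq_add_half (z : ℍ) : normSq ((z : ℂ) + 1 / 2) = normSq (z : ℂ) + z.re + 1 / 4 := by
  rw [normSq_apply, normSq_apply]
  simp
  ring

lemma normSq_sub_half (z : ℍ) : normSq ((z : ℂ) - 1 / 2) = normSq (z : ℂ) - z.re + 1 / 4 := by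
  rw [normSq_apply, normSq_apply]
  simp
  ring

lemma mem_fundamentalDomain_iff (z : ℍ) : z ∈ fundamentalDomain 7 ↔
    (1 / 7 ≤ normSq (z : ℂ) ∧ -z.re - 3 / 14 ≤ normSq (z : ℂ) ∧ -1 / 2 ≤ z.re ∧ z.re ≤ 0) ∨
    (1 / 7 < normSq (z : ℂ) ∧ z.re - 3 / 14 < normSq (z : ℂ) ∧ 0 ≤ z.re ∧ z.re < 1 / 2) := by
  have h1 : ∀ (a : ℝ) (w : ℂ), √a < ‖w‖ ↔ √a < √(normSq w) := fun a w ↦ by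
    rw [← Complex.sq_norm, Real.sqrt_sq (norm_nonneg _)]
  rw [fundamentalDomain, one_div_sqrt_seven, one_div_two_mul_sqrt_seven]
  simp only [Set.mem_union, Set.mem_ofPred_eq, sqrt_le_norm_iff, h1,
    Real.sqrt_lt_sqrt_iff (show (0 : ℝ) ≤ 1 / 7 by norm_num),
    Real.sqrt_lt_sqrt_iff (show (0 : ℝ) ≤ 1 / 28 by norm_num), normSq_add_half, normSq_sub_half]
  refine or_congr (and_congr_right' (and_congr_left' ?_)) (and_congr_right' (and_congr_left' ?_))
  · constructor <;> intro h <;> linarith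
  · constructor <;> intro h <;> linarith

lemma mem_arc_iff (z : ℍ) : z ∈ arc 7 ↔ z ∈ fundamentalDomain 7 ∧
    (normSq (z : ℂ) = 1 / 7 ∨ normSq (z : ℂ) = -z.re - 3 / 14) := by
  have h1 : ∀ (a : ℝ) (w : ℂ), 0 ≤ a → (‖w‖ = √a ↔ normSq w = a) := fun a w ha ↦ by
    rw [← Complex.sq_norm, eq_comm, Real.sqrt_eq_iff_eq_sq ha (norm_nonneg _), eq_comm]
  rw [arc, one_div_sqrt_seven, one_div_two_mul_sqrt_seven]
  simp only [Set.mem_inter_iff, Set.mem_ofPred_eq, h1 _ _ (show (0 : ℝ) ≤ 1 / 7 by norm_num),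
    h1 _ _ (show (0 : ℝ) ≤ 1 / 28 by norm_num), normSq_add_half]
  refine and_congr_right' (or_congr Iff.rfl ?_)
  constructor <;> intro h <;> linarith

/-- The points of the fundamental domain other than the vertex of order three. -/
def PuncturedDomain : Set ℍ :=
  {z | z ∈ fundamentalDomain 7 ∧ ¬ (normSq (z : ℂ) = 1 / 7 ∧ z.re = -5 / 14)}

lemma normSq_linear (z : ℍ) (r s : ℝ) :
    normSq (r * z + s) = r ^ 2 * normSq (z : ℂ) + 2 * r * s * z.re + s ^ 2 := by
  rw [normSq_apply, normSq_apply]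
  simp
  ring

lemma one_lt_normSq_bottom_row {z : ℍ} (hz : z ∈ PuncturedDomain) {c : ℤ} (hc : c ≠ 0) (d : ℤ) :
    1 < normSq (7 * c * z + d) := by
  obtain ⟨hz, hne⟩ := hz
  have hform : normSq (7 * c * z + d) =
      49 * (c : ℝ) ^ 2 * normSq (z : ℂ) + 14 * c * d * z.re + (d : ℝ) ^ 2 := by
    have := normSq_linear z (7 * c) d
    push_cast at this
    rw [this]
    ring
  rw [hform]
  rcases (mem_fundamentalDomain_iff z).mp hz with ⟨h1, h2, h3, h4⟩ | ⟨h1, h2, h3, h4⟩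
  · have := one_lt_quadratic_of_bottom_row (n := normSq (z : ℂ)) (X := -z.re) (by linarith)
      (by linarith) h1 h2 (fun h ↦ hne ⟨h.1, by linarith [h.2]⟩) hc d
    linarith
  · have := one_lt_quadratic_of_bottom_row (n := normSq (z : ℂ)) (X := z.re) h3
      h4.le h1.le h2.le (fun h ↦ h1.ne' h.1) hc (-d)
    push_cast at this
    nlinarith

lemma one_lt_normSq_top_row {z : ℍ} (hz : z ∈ PuncturedDomain) {d : ℤ} (hd : d ≠ 0) (c : ℤ) :
    1 < 7 * normSq (d * z - c) ∨ (c = 0 ∧ normSq (z : ℂ) = 1 / 7 ∧ z.re ≤ 0) ∨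
      (d = -2 * c ∧ normSq (z : ℂ) = -z.re - 3 / 14 ∧ z.re < -5 / 14) := by
  obtain ⟨hz, hne⟩ := hz
  have hform : 7 * normSq (d * z - c) =
      7 * (d : ℝ) ^ 2 * normSq (z : ℂ) - 14 * d * c * z.re + 7 * (c : ℝ) ^ 2 := by
    have := normSq_linear z d (-c)
    push_cast at this
    rw [sub_eq_add_neg, this]
    ring
  rw [hform]
  rcases (mem_fundamentalDomain_iff z).mp hz with ⟨h1, h2, h3, h4⟩ | ⟨h1, h2, h3, h4⟩
  · rcases one_lt_quadratic_of_top_row (n := normSq (z : ℂ)) (X := -z.re) (by linarith)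
      (by linarith) h1 h2 (fun h ↦ hne ⟨h.1, by linarith [h.2]⟩) hd (-c) with h | h | h
    · left
      push_cast at h
      nlinarith
    · exact Or.inr (Or.inl ⟨by simpa using h.1, h.2, h4⟩)
    · exact Or.inr (Or.inr ⟨by linarith [h.1], h.2.1, by linarith [h.2.2]⟩)
  · rcases one_lt_quadratic_of_top_row (n := normSq (z : ℂ)) (X := z.re) h3
      h4.le h1.le h2.le (fun h ↦ h1.ne' h.1) hd c with h | h | h
    · exact Or.inl h
    · exact absurd h.2 h1.ne'
    · exact absurd h.2.1 h2.ne'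

lemma im_mul_normSq_of_moebius {a b c d : ℝ} {z w : ℍ} (h : (w : ℂ) * (c * z + d) = a * z + b) :
    w.im * normSq (c * z + d) = (a * d - b * c) * z.im := by
  have h1 : (w : ℂ) * (normSq (c * z + d) : ℝ) = (a * z + b) * (c * (starRingEnd ℂ z) + d) := by
    rw [← h, ← Complex.mul_conj]
    simp
    ring
  have h2 := congrArg Complex.im h1
  simp at h2
  linear_combination h2

lemma re_mem_Ico {z : ℍ} (hz : z ∈ PuncturedDomain) : -1 / 2 ≤ z.re ∧ z.re < 1 / 2 := by
  rcases (mem_fundamentalDomain_iff z).mp hz.1 with h | h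
  · exact ⟨h.2.2.1, by linarith [h.2.2.2]⟩
  · exact ⟨by linarith [h.2.2.1], h.2.2.2⟩

/-- If c ≠ 0, the map and its inverse would both strictly lower heights. So it is a translation up
to sign, and a trivial one, as both real parts lie in [−1/2, 1/2). -/
lemma eq_of_moebius_mem_puncturedDomain {z w : ℍ} (hz : z ∈ PuncturedDomain)
    (hw : w ∈ PuncturedDomain) {a b c d : ℤ} (hdet : a * d - 7 * b * c = 1)
    (h : (w : ℂ) * (7 * c * z + d) = a * z + b) : z = w ∧ c = 0 ∧ a = d := by
  have hdetR : (a : ℝ) * d - 7 * b * c = 1 := by exact_mod_cast hdet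
  have hdetC : (a : ℂ) * d - 7 * b * c = 1 := by exact_mod_cast hdet
  have h1 : w.im * normSq (7 * c * z + d) = z.im := by
    have := im_mul_normSq_of_moebius (a := a) (b := b) (c := 7 * c) (d := d) (z := z) (w := w)
      (by push_cast; exact h)
    push_cast at this
    rw [this]
    linear_combination z.im * hdetR
  have hinv : (z : ℂ) * (7 * (-c : ℤ) * w + a) = d * w + (-b : ℤ) := by
    push_cast
    linear_combination -h
  have h2 : z.im * normSq (7 * (-c : ℤ) * w + a) = w.im := by
    have := im_mul_normSq_of_moebius (a := d) (b := (-b : ℤ)) (c := 7 * (-c : ℤ)) (d := a)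
      (z := w) (w := z) (by push_cast at hinv ⊢; exact hinv)
    push_cast at this ⊢
    rw [this]
    linear_combination w.im * hdetR
  have hc : c = 0 := by
    by_contra hc
    have h3 := one_lt_normSq_bottom_row hz hc d
    have h4 := one_lt_normSq_bottom_row hw (neg_ne_zero.mpr hc) a
    nlinarith [z.im_pos, w.im_pos]
  subst hc
  have had : a * d = 1 := by linarith
  have hadeq : a = d := by
    rcases Int.mul_eq_one_iff_eq_one_or_neg_one.mp had with h | h <;> omega
  subst hadeq
  refine ⟨?_, rfl, rfl⟩
  have hre : w.re * a = a * z.re + b := by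
    have := congrArg Complex.re h
    simpa using this
  have haa : (a : ℝ) * a = 1 := by exact_mod_cast had
  have hre2 : w.re = z.re + ((b * a : ℤ) : ℝ) := by
    push_cast
    linear_combination a * hre + (z.re - w.re) * haa
  have hb : b * a = 0 := by
    obtain ⟨h3, h4⟩ := re_mem_Ico hz
    obtain ⟨h5, h6⟩ := re_mem_Ico hw
    have h7 : ((b * a : ℤ) : ℝ) < 1 := by linarith
    have h8 : (-1 : ℝ) < ((b * a : ℤ) : ℝ) := by linarith
    have h7' : b * a < 1 := by exact_mod_cast h7
    have h8' : -1 < b * a := by exact_mod_cast h8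
    omega
  have hb0 : b = 0 := by
    rcases mul_eq_zero.mp hb with h | h
    · exact h
    · rw [h] at had; simp at had
  subst hb0
  have ha0 : (a : ℂ) ≠ 0 := by
    intro h0
    have : a = 0 := by exact_mod_cast h0
    simp [this] at had
  ext1
  apply mul_right_cancel₀ ha0
  simp only [Int.cast_zero, mul_zero, zero_mul, zero_add, add_zero] at h
  linear_combination -h

/-! ### The Fricke involution and the valence inequality for its group -/

/-- The Fricke involution `z ↦ -1 / (7 z)`. -/
def frickeInv (z : ℍ) : ℍ :=
  ⟨-1 / (7 * z), by
    have hz : (z : ℂ) ≠ 0 := z.ne_zero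
    have h : (-1 / (7 * z) : ℂ) = -(starRingEnd ℂ z) / ((7 * normSq (z : ℂ) : ℝ) : ℂ) := by
      have h1 : ((normSq (z : ℂ) : ℝ) : ℂ) = z * starRingEnd ℂ z := (Complex.mul_conj _).symm
      have h2 : starRingEnd ℂ (z : ℂ) ≠ 0 := by simpa using hz
      push_cast
      rw [h1]
      field_simp
    rw [h, Complex.div_ofReal_im]
    have : 0 < normSq (z : ℂ) := normSq_pos.mpr hz
    have := z.im_pos
    simp only [Complex.neg_im, Complex.conj_im, neg_neg]
    positivity⟩

lemma frickeInv_mul (z : ℍ) : (frickeInv z : ℂ) * (7 * z) = -1 := by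
  have hz : (z : ℂ) ≠ 0 := z.ne_zero
  simp only [frickeInv]
  field_simp

lemma frickeInv_frickeInv (z : ℍ) : frickeInv (frickeInv z) = z := by
  ext1
  have h1 := frickeInv_mul z
  have h2 := frickeInv_mul (frickeInv z)
  have h3 : (frickeInv z : ℂ) ≠ 0 := (frickeInv z).ne_zero
  apply mul_right_cancel₀ (mul_ne_zero (by norm_num : (7 : ℂ) ≠ 0) h3)
  rw [h2, ← h1]
  ring

/-- The points of the fundamental domain which are not elliptic. -/
def RegularDomain : Set ℍ :=
  {z | z ∈ PuncturedDomain ∧ ¬ (normSq (z : ℂ) = 1 / 7 ∧ z.re = 0) ∧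
    ¬ (normSq (z : ℂ) = 2 / 7 ∧ z.re = -1 / 2)}

/-- The composite map and its inverse cannot both lower heights, so z and w have equal height and
lie on the same circle of the arc. Then Re w = −Re z or Re w = −1 − Re z. As only the left half of
the boundary belongs to the domain, z would be one of the excluded points with real part 0 or −1/2.
-/
lemma not_moebius_frickeInv {z w : ℍ} (hz : z ∈ RegularDomain)
    (hw : w ∈ PuncturedDomain) {a b c d : ℤ} (hdet : a * d - 7 * b * c = 1)
    (h : (w : ℂ) * (7 * c * frickeInv z + d) = a * frickeInv z + b) : False := by
  obtain ⟨hz, hz1, hz2⟩ := hz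
  have hdetR : (a : ℝ) * d - 7 * b * c = 1 := by exact_mod_cast hdet
  have hu := frickeInv_mul z
  have hrel : (w : ℂ) * (7 * (d * z - c)) = 7 * b * z - a := by
    linear_combination 7 * z * h + (a - 7 * c * w) * hu
  have hrel' : (z : ℂ) * (7 * (d * w - b)) = 7 * c * w - a := by
    linear_combination hrel
  have hd : d ≠ 0 := by
    rintro rfl
    have : 7 * (b * c) = -1 := by linear_combination -hdet
    omega
  have hpos := z.im_pos
  have hpos' := w.im_pos
  have h1 : w.im * (7 * normSq (d * z - c)) = z.im := by
    have := im_mul_normSq_of_moebius (a := 7 * b) (b := -a) (c := 7 * d) (d := -(7 * c)) (z := z)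
      (w := w) (by push_cast; linear_combination hrel)
    have h7 : normSq (((7 * d : ℝ) : ℂ) * z + ((-(7 * c) : ℝ) : ℂ)) =
        49 * normSq (d * z - c) := by
      rw [show ((7 * d : ℝ) : ℂ) * z + ((-(7 * c) : ℝ) : ℂ) = (7 : ℝ) * (d * z - c) by
        push_cast; ring, normSq_mul, normSq_ofReal]
      norm_num
    rw [h7] at this
    linear_combination this / 7 + z.im * hdetR
  have h2 : z.im * (7 * normSq (d * w - b)) = w.im := by
    have := im_mul_normSq_of_moebius (a := 7 * c) (b := -a) (c := 7 * d) (d := -(7 * b)) (z := w)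
      (w := z) (by push_cast; linear_combination hrel')
    have h7 : normSq (((7 * d : ℝ) : ℂ) * w + ((-(7 * b) : ℝ) : ℂ)) =
        49 * normSq (d * w - b) := by
      rw [show ((7 * d : ℝ) : ℂ) * w + ((-(7 * b) : ℝ) : ℂ) = (7 : ℝ) * (d * w - b) by
        push_cast; ring, normSq_mul, normSq_ofReal]
      norm_num
    rw [h7] at this
    linear_combination this / 7 + w.im * hdetR
  have him := congrArg Complex.im hrel
  simp at him
  rcases one_lt_normSq_top_row hz hd c with hA | ⟨hc, hn, hx⟩ | ⟨hdc, hn, hx⟩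
  · rcases one_lt_normSq_top_row hw hd b with hB | ⟨hb, hn', hx'⟩ | ⟨hdb, hn', hx'⟩
    · nlinarith
    · have hform := normSq_linear w d (-b)
      subst hb
      have had : a * d = 1 := by linarith
      have hd1 : (d : ℝ) ^ 2 = 1 := by
        rcases Int.mul_eq_one_iff_eq_one_or_neg_one.mp had with h | h <;> rw [h.2] <;> norm_num
      have h3 : normSq (d * w - (0 : ℤ)) = 1 / 7 := by
        push_cast at hform ⊢
        rw [sub_eq_add_neg, hform, hn', hd1]
        ring
      rw [h3] at h2
      nlinarith
    · have hform := normSq_linear w d (-b)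
      have hb1 : (b : ℝ) ^ 2 = 1 := by
        have hdvd : b ∣ 1 := ⟨-2 * a - 7 * c, by rw [hdb] at hdet; linear_combination -hdet⟩
        rcases Int.isUnit_iff.mp (isUnit_of_dvd_one hdvd) with h | h <;> rw [h] <;> norm_num
      have h3 : normSq (d * w - b) = 1 / 7 := by
        push_cast at hform ⊢
        rw [sub_eq_add_neg, hform, hn', hdb]
        push_cast
        linear_combination (1 / 7) * hb1
      rw [h3] at h2
      nlinarith
  · subst hc
    have had : a * d = 1 := by linarith
    have hdd : d = 1 ∨ d = -1 := by
      rcases Int.mul_eq_one_iff_eq_one_or_neg_one.mp had with h | h <;> omega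
    have hd1 : (d : ℝ) ^ 2 = 1 := by rcases hdd with h | h <;> rw [h] <;> norm_num
    have h3 : normSq (d * z - (0 : ℤ)) = 1 / 7 := by
      have hform := normSq_linear z d 0
      push_cast at hform ⊢
      rw [add_zero] at hform
      rw [sub_zero, hform, hn, hd1]
      ring
    rw [h3] at h1
    have hyy : w.im = z.im := by linarith
    rcases one_lt_normSq_top_row hw hd b with hB | ⟨hb, hn', hx'⟩ | ⟨hdb, hn', hx'⟩
    · nlinarith
    · subst hb
      have h5 : (d : ℝ) * z.im * (w.re + z.re) = 0 := by
        rw [hyy] at him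
        simp at him
        linear_combination him / 7
      have h6 : w.re + z.re = 0 := by
        rcases mul_eq_zero.mp h5 with h | h
        · rcases mul_eq_zero.mp h with h | h
          · exact absurd (by exact_mod_cast h) hd
          · linarith
        · exact h
      exact hz1 ⟨hn, by linarith⟩
    · omega
  · have hcu : c = 1 ∨ c = -1 := by
      have hdvd : c ∣ 1 := ⟨-2 * a - 7 * b, by rw [hdc] at hdet; linear_combination -hdet⟩
      exact Int.isUnit_iff.mp (isUnit_of_dvd_one hdvd)
    have hc1 : (c : ℝ) ^ 2 = 1 := by rcases hcu with h | h <;> rw [h] <;> norm_num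
    have h3 : normSq (d * z - c) = 1 / 7 := by
      have hform := normSq_linear z d (-c)
      push_cast at hform ⊢
      rw [sub_eq_add_neg, hform, hn, hdc]
      push_cast
      linear_combination (1 / 7) * hc1
    rw [h3] at h1
    have hyy : w.im = z.im := by linarith
    rcases one_lt_normSq_top_row hw hd b with hB | ⟨hb, hn', hx'⟩ | ⟨hdb, hn', hx'⟩
    · nlinarith
    · subst hb
      have had : a * d = 1 := by linarith
      rcases Int.mul_eq_one_iff_eq_one_or_neg_one.mp had with h | h <;> omega
    · have hbc : b = c := by omega
      subst hbc
      have h5 : (b : ℝ) * z.im * (w.re + z.re + 1) = 0 := by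
        have hdR : (d : ℝ) = -2 * b := by exact_mod_cast hdc
        rw [hyy, hdR] at him
        linear_combination -him / 14
      have hb0 : (b : ℝ) ≠ 0 := by
        intro h0
        rw [h0] at hc1
        norm_num at hc1
      have h6 : w.re + z.re + 1 = 0 := by
        rcases mul_eq_zero.mp h5 with h | h
        · rcases mul_eq_zero.mp h with h | h
          · exact absurd h hb0
          · linarith
        · exact h
      have h7 := (re_mem_Ico hz).1
      have h8 := (re_mem_Ico hw).1
      exact hz2 ⟨by linarith, by linarith⟩

lemma E_of_mul_eq_neg_one {k : ℕ} (hk : 3 ≤ k) {z w : ℍ} (h : (w : ℂ) * z = -1) :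
    ModularForm.E hk w = (z : ℂ) ^ k * ModularForm.E hk z := by
  have := E_moebius hk (a := 0) (b := -1) (c := 1) (d := 0) (by norm_num) (z := z) (w := w)
    (by push_cast; linear_combination h)
  simpa using this

lemma seven_pow_half_mul_self {k : ℕ} (hk2 : Even k) : (7 : ℂ) ^ (k / 2) * 7 ^ (k / 2) = 7 ^ k := by
  rw [← pow_add, ← two_mul, Nat.two_mul_div_two_of_even hk2]

lemma eisenstein_frickeInv {k : ℕ} (hk : 3 ≤ k) (hk2 : Even k) {z w : ℍ}
    (h : (w : ℂ) * (7 * z) = -1) :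
    eisenstein 7 hk w = 7 ^ (k / 2) * (z : ℂ) ^ k * eisenstein 7 hk z := by
  have h1 := E_of_mul_eq_neg_one hk (z := z) (w := scale 7 w)
    (by rw [coe_scale]; linear_combination h)
  have h2 := E_of_mul_eq_neg_one hk (z := scale 7 z) (w := w) (by rw [coe_scale]; exact h)
  rw [eisenstein, eisenstein, h1, h2, coe_scale, mul_pow]
  have := seven_pow_half_mul_self hk2
  push_cast
  linear_combination (1 / ((7 : ℂ) ^ (k / 2) + 1) * (z : ℂ) ^ k * ModularForm.E hk (scale 7 z)) *
    -this

lemma order_frickeInv {k : ℕ} (hk : 3 ≤ k) (hk2 : Even k) (z : ℍ) :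
    order (eisenstein 7 hk) (frickeInv z) = order (eisenstein 7 hk) z := by
  refine order_eq_of_moebius hk (a := 0) (b := -1) (c := 7) (d := 0) (C := 7 ^ (k / 2) / 7 ^ k)
    (j := k) (by norm_num) (by simp) ?_ ?_
  · intro z w hw
    push_cast at hw ⊢
    rw [eisenstein_frickeInv hk hk2 (z := z) (w := w) (by linear_combination hw), add_zero, mul_pow]
    field_simp
  · push_cast
    linear_combination frickeInv_mul z

/-- The fixed point `i / √7` of the Fricke involution. -/
def frickeFixed : ℍ := ⟨Complex.I / (√7 : ℝ), by
  rw [Complex.div_ofReal_im, Complex.I_im]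
  positivity⟩

lemma coe_frickeFixed : (frickeFixed : ℂ) = Complex.I / (√7 : ℝ) := rfl

lemma frickeFixed_sq : 7 * (frickeFixed : ℂ) ^ 2 = -1 := by
  rw [coe_frickeFixed, div_pow, I_sq, ← ofReal_pow, Real.sq_sqrt (by norm_num)]
  norm_num

lemma frickeFixed_re : frickeFixed.re = 0 := by
  change (Complex.I / (√7 : ℝ)).re = 0
  rw [Complex.div_ofReal_re, Complex.I_re, zero_div]

lemma normSq_frickeFixed : normSq (frickeFixed : ℂ) = 1 / 7 := by
  rw [coe_frickeFixed, normSq_div, normSq_I, normSq_ofReal, Real.mul_self_sqrt (by norm_num)]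

lemma frickeFixed_mem : frickeFixed ∈ PuncturedDomain := by
  refine ⟨(mem_fundamentalDomain_iff _).mpr (Or.inl ?_), ?_⟩
  · rw [frickeFixed_re, normSq_frickeFixed]
    norm_num
  · rw [frickeFixed_re]
    norm_num

/-- At the fixed point the Fricke transformation law reads f = (−1)^(k/2) f, with k/2 odd. -/
lemma eisenstein_frickeFixed {k : ℕ} (hk : 3 ≤ k) (hk4 : k % 4 = 2) :
    eisenstein 7 hk frickeFixed = 0 := by
  obtain ⟨m, hm⟩ : ∃ m, k = 2 * (2 * m + 1) := ⟨k / 4, by omega⟩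
  have h := eisenstein_frickeInv hk ⟨2 * m + 1, by omega⟩ (z := frickeFixed) (w := frickeFixed)
    (by linear_combination frickeFixed_sq)
  have h1 : (7 : ℂ) ^ (k / 2) * (frickeFixed : ℂ) ^ k = -1 := by
    rw [show k / 2 = 2 * m + 1 by omega, hm, pow_mul, ← mul_pow, frickeFixed_sq]
    exact Odd.neg_one_pow ⟨m, rfl⟩
  rw [h1] at h
  linear_combination h / 2

lemma frickeInv_injective : Function.Injective frickeInv :=
  Function.LeftInverse.injective frickeInv_frickeInv

/-- The valence inequality for the Fricke group of level seven. -/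
theorem three_mul_sum_order_fricke_le {k : ℕ} (hk : 3 ≤ k) (hk2 : Even k) {T I : Finset ℍ}
    (hT : ∀ z ∈ T, z ∈ RegularDomain) (hI : I ⊆ {frickeFixed}) :
    3 * (2 * ∑ z ∈ T, (order (eisenstein 7 hk) z).toNat +
      ∑ z ∈ I, (order (eisenstein 7 hk) z).toNat) ≤ 2 * k := by
  classical
  have hTI : ∀ z ∈ T ∪ I, z ∈ PuncturedDomain := fun z hz ↦ by
    rcases Finset.mem_union.mp hz with h | h
    · exact (hT z h).1
    · rw [Finset.mem_singleton.mp (hI h)]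
      exact frickeFixed_mem
  have hdTI : Disjoint T I := by
    rw [Finset.disjoint_left]
    intro z hz hz'
    rw [Finset.mem_singleton.mp (hI hz')] at hz
    exact (hT _ hz).2.1 ⟨normSq_frickeFixed, frickeFixed_re⟩
  have hdis : Disjoint (T ∪ I) (T.image frickeInv) := by
    rw [Finset.disjoint_left]
    intro w hw hw'
    obtain ⟨z, hz, rfl⟩ := Finset.mem_image.mp hw'
    exact not_moebius_frickeInv (hT z hz) (hTI _ hw) (a := 1) (b := 0) (c := 0) (d := 1)
      (by norm_num) (by push_cast; ring)
  -- The domain and its Fricke image together account for Γ₀(7). The point of I is its own image and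
  -- is taken once.
  have hfree : FreeOrbits ((T ∪ I) ∪ T.image frickeInv) := by
    intro z hz w hw a b c d hdet h
    rcases Finset.mem_union.mp hz with hz | hz <;> rcases Finset.mem_union.mp hw with hw | hw
    · exact eq_of_moebius_mem_puncturedDomain (hTI z hz) (hTI w hw) hdet h
    · obtain ⟨w, hw', rfl⟩ := Finset.mem_image.mp hw
      refine (not_moebius_frickeInv (hT w hw') (hTI z hz) (a := d) (b := -b) (c := -c) (d := a)
        (by linarith) ?_).elim
      push_cast
      linear_combination -h
    · obtain ⟨z, hz', rfl⟩ := Finset.mem_image.mp hz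
      exact (not_moebius_frickeInv (hT z hz') (hTI w hw) hdet h).elim
    · obtain ⟨z, hz', rfl⟩ := Finset.mem_image.mp hz
      obtain ⟨w, hw', rfl⟩ := Finset.mem_image.mp hw
      have hu := frickeInv_mul z
      have hv := frickeInv_mul w
      -- Conjugation by the Fricke involution turns (a, b; 7c, d) into (d, −c; −7b, a).
      have hrel : (w : ℂ) * (7 * (-b : ℤ) * z + a) = d * z + (-c : ℤ) := by
        push_cast
        linear_combination 7 * (w : ℂ) * z * h - z * (7 * c * frickeInv z + d) * hv +
          (c + w * a) * hu
      obtain ⟨rfl, hb, had⟩ := eq_of_moebius_mem_puncturedDomain (hT z hz').1 (hT w hw').1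
        (by linarith) hrel
      refine ⟨rfl, ?_, had.symm⟩
      rw [hb, had] at hrel
      have : ((c : ℤ) : ℂ) = 0 := by
        push_cast at hrel
        linear_combination hrel
      exact_mod_cast this
  have := three_mul_sum_order_le hk hk2 hfree
  rw [Finset.sum_union hdis, Finset.sum_union hdTI,
    Finset.sum_image (fun _ _ _ _ h ↦ frickeInv_injective h)] at this
  simp only [order_frickeInv hk hk2] at this
  linarith

lemma mem_regularDomain_of_notMem_arc {z : ℍ} (hz : z ∈ fundamentalDomain 7 \ arc 7) :
    z ∈ RegularDomain := by
  obtain ⟨hz, hz'⟩ := hz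
  rw [mem_arc_iff] at hz'
  push Not at hz'
  obtain ⟨h1, h2⟩ := hz' hz
  exact ⟨⟨hz, fun h ↦ h1 h.1⟩, fun h ↦ h1 h.1, fun h ↦ h2 (by rw [h.1, h.2]; norm_num)⟩

/-! ### Eisenstein series of large weight are close to 1 -/

/-- The q-expansion has real coefficients, and z ↦ −z̄ conjugates q. -/
lemma E_eq_of_neg_conj {k : ℕ} (hk : 3 ≤ k) (hk2 : Even k) {z w : ℍ}
    (h : (w : ℂ) = -starRingEnd ℂ z) :
    ModularForm.E hk w = starRingEnd ℂ (ModularForm.E hk z) := by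
  rw [EisensteinSeries.q_expansion_bernoulli hk hk2, EisensteinSeries.q_expansion_bernoulli hk hk2,
    map_sub, map_mul, conj_tsum]
  have h2 : starRingEnd ℂ (2 : ℂ) = 2 := Complex.conj_ofNat 2
  simp [h, ← Complex.exp_conj, h2]

lemma E_eq_of_sub_int {k : ℕ} (hk : 3 ≤ k) {z w : ℍ} (n : ℤ) (h : (w : ℂ) = z + n) :
    ModularForm.E hk w = ModularForm.E hk z := by
  have := E_moebius hk (a := 1) (b := n) (c := 0) (d := 1) (by norm_num) (z := z) (w := w)
    (by push_cast; rw [h]; ring)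
  simpa using this

/-- The term of the Eisenstein series of weight `k` at a pair of integers. -/
def eisTerm (k : ℕ) (z : ℍ) (p : ℤ × ℤ) : ℂ :=
  if IsCoprime p.1 p.2 then ((p.1 * z + p.2) ^ k : ℂ)⁻¹ else 0

lemma summable_eisTerm {k : ℕ} (hk : 3 ≤ k) (z : ℍ) : Summable (eisTerm k z) := by
  have h : Summable fun p : ℤ × ℤ ↦ ‖EisensteinSeries.eisSummand k ![p.1, p.2] z‖ :=
    (finTwoArrowEquiv ℤ).symm.summable_iff.mpr
      (EisensteinSeries.summable_norm_eisSummand (by exact_mod_cast hk) z)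
  refine Summable.of_norm_bounded h fun p ↦ ?_
  rw [eisTerm]
  split_ifs
  · simp [EisensteinSeries.eisSummand]
  · simp

lemma E_eq_tsum_eisTerm {k : ℕ} (hk : 3 ≤ k) (z : ℍ) :
    ModularForm.E hk z = 1 / 2 * ∑' p, eisTerm k z p := by
  rw [show ModularForm.E hk z =
    (1 / 2 : ℂ) • EisensteinSeries.eisensteinSeriesSIF (N := 1) 0 k z from rfl,
    EisensteinSeries.eisensteinSeriesSIF_apply 0 k z, eisensteinSeries, smul_eq_mul,
    tsum_subtype _ (fun v ↦ EisensteinSeries.eisSummand k v z), ← (finTwoArrowEquiv ℤ).symm.tsum_eq]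
  congr 1
  refine tsum_congr fun p ↦ ?_
  simp only [Set.indicator, EisensteinSeries.mem_gammaSet_one, eisTerm,
    EisensteinSeries.eisSummand]
  simp

lemma box_one : (Finset.box 1 : Finset (ℤ × ℤ)) =
    {(0, 1), (0, -1), (1, 0), (-1, 0), (1, 1), (-1, -1), (1, -1), (-1, 1)} := by
  decide

lemma sum_box_one_eisTerm {k : ℕ} (hk2 : Even k) (z : ℍ) :
    ∑ p ∈ Finset.box 1, eisTerm k z p =
      2 * (1 + ((z : ℂ) ^ k)⁻¹ + (((z : ℂ) + 1) ^ k)⁻¹ + (((z : ℂ) - 1) ^ k)⁻¹) := by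
  have h2 : (-(z : ℂ) + 1) ^ k = (z - 1) ^ k := by
    rw [← hk2.neg_pow]; ring
  have h3 : (-(z : ℂ) - 1) ^ k = (z + 1) ^ k := by
    rw [← hk2.neg_pow]; ring
  rw [box_one]
  have h4 : IsCoprime (0 : ℤ) (-1) := by norm_num
  have h5 : IsCoprime (-1 : ℤ) 0 := by norm_num
  have h6 : IsCoprime (-1 : ℤ) (-1) := by norm_num
  simp [eisTerm, hk2.neg_pow, isCoprime_one_left, isCoprime_one_right, h2, h3, h4, h5, h6,
    ← sub_eq_add_neg]
  ring

/-- On the standard domain |cz+d|² ≥ c² − |cd| + d² ≥ (3/4) max(|c|, |d|)². -/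
lemma normSq_linear_ge {z : ℍ} (hre : |z.re| ≤ 1 / 2) (hn : 1 ≤ normSq (z : ℂ)) {n : ℕ}
    {p : ℤ × ℤ} (hp : p ∈ Finset.box n) : 3 / 4 * (n : ℝ) ^ 2 ≤ normSq (p.1 * z + p.2 : ℂ) := by
  obtain ⟨c, d⟩ := p
  rw [Int.mem_box] at hp
  have hform := normSq_linear z c d
  push_cast at hform
  simp only
  rw [hform]
  have h1 : -(|(c : ℝ)| * |(d : ℝ)|) ≤ 2 * c * d * z.re := by
    have h2 : |2 * c * d * z.re| ≤ |(c : ℝ)| * |(d : ℝ)| := by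
      rw [abs_mul, abs_mul, abs_mul, abs_two]
      nlinarith [mul_nonneg (abs_nonneg (c : ℝ)) (abs_nonneg (d : ℝ))]
    exact (neg_le_neg h2).trans (neg_abs_le _)
  have h3 : |(c : ℝ)| ^ 2 ≤ (c : ℝ) ^ 2 * normSq (z : ℂ) := by
    rw [sq_abs]
    exact le_mul_of_one_le_right (sq_nonneg _) hn
  rw [← sq_abs (d : ℝ)]
  have hcn : |(c : ℝ)| = (c.natAbs : ℝ) := by rw [Nat.cast_natAbs, Int.cast_abs]
  have hdn : |(d : ℝ)| = (d.natAbs : ℝ) := by rw [Nat.cast_natAbs, Int.cast_abs]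
  rcases max_choice c.natAbs d.natAbs with h | h
  · rw [h] at hp
    rw [hp] at hcn
    rw [hcn] at h1 h3
    nlinarith [sq_nonneg (2 * |(d : ℝ)| - n)]
  · rw [h] at hp
    rw [hp] at hdn
    rw [hdn] at h1 ⊢
    nlinarith [sq_nonneg (2 * |(c : ℝ)| - n)]

lemma norm_pow_two_mul (w : ℂ) (j : ℕ) : ‖w ^ (2 * j)‖ = normSq w ^ j := by
  rw [norm_pow, pow_mul, Complex.sq_norm]

/-- The bound is shaped to telescope: the box of radius n + 2 has 8(n + 2) points, so all these
boxes together contribute at most 1/10. The constant 80 comes from (3/4)⁶ · 2⁹ > 80. -/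
lemma norm_eisTerm_le {j : ℕ} (hj : 6 ≤ j) {z : ℍ} (hre : |z.re| ≤ 1 / 2)
    (hn : 1 ≤ normSq (z : ℂ)) {n : ℕ} {p : ℤ × ℤ} (hp : p ∈ Finset.box (n + 2)) :
    ‖eisTerm (2 * j) z p‖ ≤ 1 / 80 / (n + 2) * (1 / (n + 1) - 1 / (n + 2)) := by
  have hR : (0 : ℝ) ≤ 1 / 80 / (n + 2) * (1 / (n + 1) - 1 / (n + 2)) := by
    have : (0 : ℝ) ≤ 1 / (n + 1) - 1 / (n + 2) := by
      rw [sub_nonneg]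
      gcongr
      norm_num
    positivity
  rw [eisTerm]
  split_ifs with hcop
  swap
  · simpa using hR
  rw [norm_inv, norm_pow_two_mul]
  have h1 := normSq_linear_ge hre hn hp
  push_cast at h1
  set x : ℝ := (n : ℝ) + 2 with hx
  have hx2 : 2 ≤ x := by rw [hx]; linarith [(Nat.cast_nonneg n : (0 : ℝ) ≤ n)]
  have h2 : (3 / 4 * x ^ 2) ^ 6 ≤ normSq (p.1 * z + p.2 : ℂ) ^ j :=
    calc (3 / 4 * x ^ 2) ^ 6 ≤ (3 / 4 * x ^ 2) ^ j := pow_le_pow_right₀ (by nlinarith) hj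
      _ ≤ _ := by gcongr
  have h3 : 80 * x ^ 3 ≤ (3 / 4 * x ^ 2) ^ 6 := by
    have : (2 : ℝ) ^ 9 ≤ x ^ 9 := by gcongr
    have h5 : (3 / 4 * x ^ 2) ^ 6 = (3 / 4) ^ 6 * x ^ 9 * x ^ 3 := by ring
    rw [h5]
    gcongr
    norm_num at this ⊢
    linarith
  have h4 : 1 / (80 * x ^ 3) ≤ 1 / 80 / x * (1 / (n + 1) - 1 / x) := by
    have hn1 : (n : ℝ) + 1 = x - 1 := by rw [hx]; ring
    have hx1 : 0 < x - 1 := by linarith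
    rw [hn1, div_sub_div _ _ hx1.ne' (by positivity), div_div, div_mul_div_comm,
      div_le_div_iff₀ (by positivity) (by positivity)]
    nlinarith [mul_nonneg (sq_nonneg x) (by linarith : (0:ℝ) ≤ x)]
  refine le_trans ?_ h4
  rw [← one_div]
  exact one_div_le_one_div_of_le (by positivity) (h3.trans h2)

lemma sum_norm_eisTerm_le {j : ℕ} (hj : 6 ≤ j) {z : ℍ} (hre : |z.re| ≤ 1 / 2)
    (hn : 1 ≤ normSq (z : ℂ)) (N : ℕ) :
    ∑ n ∈ Finset.range N, ∑ p ∈ Finset.box (n + 2), ‖eisTerm (2 * j) z p‖ ≤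
      1 / 10 * (1 - 1 / (N + 1)) := by
  induction N with
  | zero => simp
  | succ N ih =>
    rw [Finset.sum_range_succ]
    have h1 : ∑ p ∈ Finset.box (N + 2), ‖eisTerm (2 * j) z p‖ ≤
        ∑ p ∈ (Finset.box (N + 2) : Finset (ℤ × ℤ)), 1 / 80 / (N + 2) *
          (1 / ((N : ℝ) + 1) - 1 / (N + 2)) :=
      Finset.sum_le_sum fun p hp ↦ norm_eisTerm_le hj hre hn hp
    rw [Finset.sum_const, Int.card_box (by omega), nsmul_eq_mul] at h1
    push_cast at h1 ⊢
    have h2 : 8 * ((N : ℝ) + 2) * (1 / 80 / (N + 2) * (1 / (N + 1) - 1 / (N + 2))) =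
        1 / 10 * (1 / (N + 1) - 1 / (N + 2)) := by
      field_simp
      norm_num
    rw [h2] at h1
    rw [show (N : ℝ) + 1 + 1 = N + 2 by ring]
    linarith

/-- On the standard fundamental domain of the modular group, an Eisenstein series of large weight
is close to the sum of its terms with coefficients at most one. -/
theorem norm_E_sub_one_le {j : ℕ} (hk : 3 ≤ 2 * j) (hj : 6 ≤ j) {z : ℍ} (hre : |z.re| ≤ 1 / 2)
    (hn : 1 ≤ normSq (z : ℂ)) :
    ‖ModularForm.E hk z - 1‖ ≤ (normSq (z : ℂ) ^ j)⁻¹ + (normSq ((z : ℂ) + 1) ^ j)⁻¹ +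
      (normSq ((z : ℂ) - 1) ^ j)⁻¹ + 1 / 20 := by
  classical
  have hs := summable_eisTerm hk z
  have h0 : eisTerm (2 * j) z (0, 0) = 0 := by simp [eisTerm, isCoprime_zero_left]
  have hsplit := hs.sum_add_tsum_subtype_compl (Finset.box 1)
  have htail : ‖∑' p : {p // p ∉ (Finset.box 1 : Finset (ℤ × ℤ))}, eisTerm (2 * j) z p‖ ≤
      1 / 10 := by
    refine (norm_tsum_le_tsum_norm (hs.norm.subtype _)).trans ?_
    refine Real.tsum_le_of_sum_le (fun _ ↦ norm_nonneg _) fun s ↦ ?_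
    set s' : Finset (ℤ × ℤ) := (s.image Subtype.val).erase (0, 0) with hs'
    have h1 : ∑ p ∈ s, ‖eisTerm (2 * j) z p‖ = ∑ p ∈ s', ‖eisTerm (2 * j) z p‖ := by
      rw [hs', Finset.sum_erase _ (by rw [h0, norm_zero]),
        Finset.sum_image (fun _ _ _ _ h ↦ Subtype.ext h)]
    rw [h1]
    obtain ⟨N, hN⟩ : ∃ N : ℕ, ∀ p ∈ s', max p.1.natAbs p.2.natAbs < N + 2 :=
      ⟨s'.sup fun p ↦ max p.1.natAbs p.2.natAbs, fun p hp ↦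
        (Finset.le_sup (f := fun p : ℤ × ℤ ↦ max p.1.natAbs p.2.natAbs) hp).trans_lt (by omega)⟩
    have hdisj : Set.PairwiseDisjoint (Finset.range N : Set ℕ)
        (fun n ↦ (Finset.box (n + 2) : Finset (ℤ × ℤ))) := by
      intro m _ n _ hmn
      simp only [Function.onFun]
      rw [Finset.disjoint_left]
      intro p hp hp'
      rw [Int.mem_box] at hp hp'
      omega
    have hsub : s' ⊆ (Finset.range N).biUnion fun n ↦ Finset.box (n + 2) := by
      intro p hp
      have hlt := hN p hp
      obtain ⟨hp0, hp1⟩ := Finset.mem_erase.mp hp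
      obtain ⟨⟨q, hq⟩, -, rfl⟩ := Finset.mem_image.mp hp1
      rw [Int.mem_box] at hq
      have hq0 : max q.1.natAbs q.2.natAbs ≠ 0 := fun h ↦
        hp0 (Prod.ext (by simp; omega) (by simp; omega))
      refine Finset.mem_biUnion.mpr ⟨max q.1.natAbs q.2.natAbs - 2, ?_, ?_⟩
      · rw [Finset.mem_range]
        simp only at hlt
        omega
      · rw [Int.mem_box]
        simp only
        omega
    refine (Finset.sum_le_sum_of_subset_of_nonneg hsub fun _ _ _ ↦ norm_nonneg _).trans ?_
    rw [Finset.sum_biUnion hdisj]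
    refine (sum_norm_eisTerm_le hj hre hn N).trans ?_
    have : (0 : ℝ) ≤ 1 / (N + 1) := by positivity
    linarith
  rw [E_eq_tsum_eisTerm, ← hsplit, sum_box_one_eisTerm (even_two_mul j)]
  set R := ∑' p : {p // p ∉ (Finset.box 1 : Finset (ℤ × ℤ))}, eisTerm (2 * j) z p
  rw [show (1 / 2 * (2 * (1 + ((z : ℂ) ^ (2 * j))⁻¹ + (((z : ℂ) + 1) ^ (2 * j))⁻¹ +
      (((z : ℂ) - 1) ^ (2 * j))⁻¹) + R) - 1 : ℂ) = ((z : ℂ) ^ (2 * j))⁻¹ +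
      (((z : ℂ) + 1) ^ (2 * j))⁻¹ + (((z : ℂ) - 1) ^ (2 * j))⁻¹ + 1 / 2 * R by ring]
  refine (norm_add₄_le).trans ?_
  simp only [norm_inv, norm_pow_two_mul, norm_mul]
  norm_num at htail ⊢
  linarith

lemma one_add_mul_add_sq_le_pow {x : ℝ} (hx : 0 ≤ x) (n : ℕ) :
    1 + n * x + n * (n - 1) / 2 * x ^ 2 ≤ (1 + x) ^ n := by
  induction n with
  | zero => simp
  | succ n ih =>
    rw [pow_succ (1 + x)]
    push_cast
    have h : (0 : ℝ) ≤ n * (n - 1) := by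
      rcases Nat.eq_zero_or_pos n with rfl | hn
      · simp
      · have : (1 : ℝ) ≤ n := by exact_mod_cast hn
        exact mul_nonneg (by linarith) (by linarith)
    nlinarith [mul_le_mul_of_nonneg_right ih (show 0 ≤ 1 + x by linarith),
      mul_nonneg h (pow_nonneg hx 3)]

/-- The binomial expansion is kept to second order; n(n−1)/2 ≥ (5/12)n² for n ≥ 6. -/
lemma inv_one_add_pow_le {x t : ℝ} (hx : 0 ≤ x) (ht : 0 ≤ t) {n : ℕ} (hn : 6 ≤ n)
    (h : t ≤ n * x) : ((1 + x) ^ n)⁻¹ ≤ (1 + t + 5 / 12 * t ^ 2)⁻¹ := by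
  refine inv_anti₀ (by positivity) (le_trans ?_ (one_add_mul_add_sq_le_pow hx n))
  have hn' : (6 : ℝ) ≤ n := by exact_mod_cast hn
  have h1 : t ^ 2 ≤ (n * x) ^ 2 := by gcongr
  have h2 : 0 ≤ (n : ℝ) * (n - 6) * x ^ 2 :=
    mul_nonneg (mul_nonneg (by linarith) (by linarith)) (sq_nonneg x)
  nlinarith

lemma inv_pow_le {N a : ℝ} (ha : 1 ≤ a) (haN : a ≤ N) {j : ℕ} (hj : 6 ≤ j) :
    (N ^ j)⁻¹ ≤ (a ^ 6)⁻¹ := by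
  refine inv_anti₀ (by positivity) ?_
  calc a ^ 6 ≤ a ^ j := pow_le_pow_right₀ ha hj
    _ ≤ N ^ j := by gcongr

lemma normSq_add_real (z : ℍ) (r : ℝ) :
    normSq ((z : ℂ) + r) = normSq (z : ℂ) + 2 * r * z.re + r ^ 2 := by
  have := normSq_linear z 1 r
  simpa using this

/-- The bound for an Eisenstein series at a point with an integral translate in the standard
fundamental domain. -/
lemma norm_E_sub_one_le_translate {j : ℕ} (hk : 3 ≤ 2 * j) (hj : 6 ≤ j) {z : ℍ} (n : ℤ)
    (hre : |z.re + n| ≤ 1 / 2) (hn : 1 ≤ normSq (z : ℂ) + 2 * n * z.re + n ^ 2) :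
    ‖ModularForm.E hk z - 1‖ ≤
      ((normSq (z : ℂ) + 2 * n * z.re + n ^ 2) ^ j)⁻¹ +
      ((normSq (z : ℂ) + 2 * (n + 1) * z.re + (n + 1) ^ 2) ^ j)⁻¹ +
      ((normSq (z : ℂ) + 2 * (n - 1) * z.re + (n - 1) ^ 2) ^ j)⁻¹ + 1 / 20 := by
  have hw : (((n : ℝ) +ᵥ z : ℍ) : ℂ) = (z : ℂ) + n := by
    rw [coe_vadd]; push_cast; ring
  have h0 := normSq_add_real z n
  have h1 := normSq_add_real z (n + 1)
  have h2 := normSq_add_real z (n - 1)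
  push_cast at h0 h1 h2
  have key := norm_E_sub_one_le hk hj (z := (n : ℝ) +ᵥ z)
    (by rw [vadd_re, add_comm]; exact hre) (by rw [hw, h0]; exact hn)
  rw [E_eq_of_sub_int hk n hw, hw, add_assoc (z : ℂ), add_sub_assoc (z : ℂ), h0, h1, h2] at key
  exact key

lemma norm_E_sub_one_lt_of_im_large {j : ℕ} (hk : 3 ≤ 2 * j) (hj : 6 ≤ j) {z : ℍ} (n : ℤ)
    (hre : |z.re + n| ≤ 1 / 2) (him : 4 ≤ normSq (z : ℂ) - z.re ^ 2) :
    ‖ModularForm.E hk z - 1‖ < 1 := by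
  have hN : ∀ r : ℝ, 4 ≤ normSq (z : ℂ) + 2 * r * z.re + r ^ 2 := fun r ↦ by
    nlinarith [sq_nonneg (z.re + r)]
  have h := norm_E_sub_one_le_translate hk hj n hre (by linarith [hN n])
  have h0 := inv_pow_le (by norm_num) (hN n) hj
  have h1 := inv_pow_le (by norm_num) (hN (n + 1)) hj
  have h2 := inv_pow_le (by norm_num) (hN (n - 1)) hj
  norm_num at h0 h1 h2
  linarith

lemma normSq_scale (z : ℍ) : normSq (scale 7 z : ℂ) = 49 * normSq (z : ℂ) := by
  rw [coe_scale, normSq_mul]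
  norm_num [normSq_apply]

lemma scale_re (z : ℍ) : (scale 7 z).re = 7 * z.re := by
  have := congrArg Complex.re (coe_scale z)
  simpa using this

/-- A translation by 0, 1 or 2 brings 7z into the standard domain; in the first two cases Im(7z) ≥
2. In the last, |7z+2|² = 1 + 10δ and |7z+3|² = 1 + 15δ, where δ vanishes at the vertex, at which 7z
+ 2 is a cube root of unity. The bound 0.085 ≤ jδ keeps the two large terms below 0.47 and 0.34. -/
lemma norm_E_scale_sub_one_lt_of_normSq_eq {j : ℕ} (hk : 3 ≤ 2 * j) (hj : 6 ≤ j) {z : ℍ}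
    (hz : normSq (z : ℂ) = 1 / 7) (h0 : z.re ≤ 0) (h1 : 0.085 ≤ j * (1 + 14 / 5 * z.re)) :
    ‖ModularForm.E hk (scale 7 z) - 1‖ < 1 := by
  have hj' : (6 : ℝ) ≤ j := by exact_mod_cast hj
  have hN := normSq_scale z
  have hr := scale_re z
  rw [hz] at hN
  have hδ : 0 < 1 + 14 / 5 * z.re := by
    by_contra! h
    nlinarith
  rcases le_or_gt (-1 / 14) z.re with h2 | h2
  · refine norm_E_sub_one_lt_of_im_large hk hj 0 ?_ ?_
    · rw [hr, abs_le]; push_cast; constructor <;> linarith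
    · rw [hN, hr]; nlinarith
  rcases le_or_gt (-3 / 14) z.re with h3 | h3
  · refine norm_E_sub_one_lt_of_im_large hk hj 1 ?_ ?_
    · rw [hr, abs_le]; push_cast; constructor <;> linarith
    · rw [hN, hr]; nlinarith
  have key := norm_E_sub_one_le_translate hk hj (z := scale 7 z) 2
    (by rw [hr, abs_le]; push_cast; constructor <;> linarith)
    (by rw [hN, hr]; push_cast; linarith)
  rw [hN, hr] at key
  set δ := 1 + 14 / 5 * z.re with hδ'
  rw [show (49 * (1 / 7) + 2 * ((2 : ℤ) : ℝ) * (7 * z.re) + ((2 : ℤ) : ℝ) ^ 2) = 1 + 10 * δ by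
      push_cast; linarith,
    show (49 * (1 / 7) + 2 * (((2 : ℤ) : ℝ) + 1) * (7 * z.re) + (((2 : ℤ) : ℝ) + 1) ^ 2) =
      1 + 15 * δ by push_cast; linarith] at key
  have e1 := inv_one_add_pow_le (x := 10 * δ) (t := 0.85) (by linarith) (by norm_num) hj
    (by linarith)
  have e2 := inv_one_add_pow_le (x := 15 * δ) (t := 1.275) (by linarith) (by norm_num) hj
    (by linarith)
  have e3 := inv_pow_le (a := 3) (by norm_num)
    (show 3 ≤ (49 * (1 / 7) + 2 * (((2 : ℤ) : ℝ) - 1) * (7 * z.re) + (((2 : ℤ) : ℝ) - 1) ^ 2) by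
      push_cast; linarith) hj
  norm_num at e1 e2 e3 key ⊢
  linarith

/-- Now the translation is by 3, with |7z+3|² = 1 + δ and |7z+2|² = 1 + 3δ. Near the vertex the
smaller of these grows with the angle four times more slowly than on the first circle, hence the
wider gap 3π/(8j) used below. -/
lemma norm_E_scale_sub_one_lt_of_normSq_eq_neg_re {j : ℕ} (hk : 3 ≤ 2 * j) (hj : 6 ≤ j) {z : ℍ}
    (hz : normSq (z : ℂ) = -z.re - 3 / 14) (h0 : -1 / 2 ≤ z.re)
    (h1 : 0.64 ≤ j * (-5 / 2 - 7 * z.re)) :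
    ‖ModularForm.E hk (scale 7 z) - 1‖ < 1 := by
  have hj' : (6 : ℝ) ≤ j := by exact_mod_cast hj
  have hN := normSq_scale z
  have hr := scale_re z
  rw [hz] at hN
  have hδ : 0 < -5 / 2 - 7 * z.re := by
    by_contra! h
    nlinarith
  have key := norm_E_sub_one_le_translate hk hj (z := scale 7 z) 3
    (by rw [hr, abs_le]; push_cast; constructor <;> linarith)
    (by rw [hN, hr]; push_cast; linarith)
  rw [hN, hr] at key
  set δ := -5 / 2 - 7 * z.re with hδ'
  rw [show (49 * (-z.re - 3 / 14) + 2 * ((3 : ℤ) : ℝ) * (7 * z.re) + ((3 : ℤ) : ℝ) ^ 2) = 1 + δ by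
      push_cast; linarith,
    show (49 * (-z.re - 3 / 14) + 2 * (((3 : ℤ) : ℝ) - 1) * (7 * z.re) + (((3 : ℤ) : ℝ) - 1) ^ 2) =
      1 + 3 * δ by push_cast; linarith] at key
  have e1 := inv_one_add_pow_le (x := δ) (t := 0.64) (by linarith) (by norm_num) hj
    (by linarith)
  have e2 := inv_one_add_pow_le (x := 3 * δ) (t := 1.92) (by linarith) (by norm_num) hj
    (by linarith)
  have e3 := inv_pow_le (a := 2) (by norm_num)
    (show 2 ≤ (49 * (-z.re - 3 / 14) + 2 * (((3 : ℤ) : ℝ) + 1) * (7 * z.re) +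
      (((3 : ℤ) : ℝ) + 1) ^ 2) by push_cast; linarith) hj
  norm_num at e1 e2 e3 key ⊢
  linarith

/-! ### The angles of the vertex -/

/-- The argument of `√7 z` at the vertex of order three. -/
def arcAngle₁ : ℝ := Real.arccos (-5 / (2 * √7))

/-- The argument of `√7 (2 z + 1)` at the vertex of order three. -/
def arcAngle₂ : ℝ := Real.arccos (2 / √7)

lemma sqrt_seven_sq : √7 ^ 2 = (7 : ℝ) := Real.sq_sqrt (by norm_num)

lemma sqrt_seven_bounds : 5 / 2 < √7 ∧ √7 < 3 :=
  ⟨by rw [Real.lt_sqrt (by norm_num)]; norm_num, by rw [Real.sqrt_lt' (by norm_num)]; norm_num⟩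

lemma cos_arcAngle₁ : √7 * Real.cos arcAngle₁ = -5 / 2 := by
  obtain ⟨h1, h2⟩ := sqrt_seven_bounds
  rw [arcAngle₁, Real.cos_arccos]
  · field_simp
  · rw [le_div_iff₀ (by positivity)]; linarith
  · rw [div_le_iff₀ (by positivity)]; linarith

lemma cos_arcAngle₂ : √7 * Real.cos arcAngle₂ = 2 := by
  obtain ⟨h1, h2⟩ := sqrt_seven_bounds
  rw [arcAngle₂, Real.cos_arccos]
  · field_simp
  · rw [le_div_iff₀ (by positivity)]; linarith
  · rw [div_le_iff₀ (by positivity)]; linarith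

lemma sin_arcAngle₁ : √7 * Real.sin arcAngle₁ = √3 / 2 := by
  have h0 : 0 ≤ Real.sin arcAngle₁ :=
    Real.sin_nonneg_of_nonneg_of_le_pi (Real.arccos_nonneg _) (Real.arccos_le_pi _)
  rw [← Real.sqrt_sq (show 0 ≤ √7 * Real.sin arcAngle₁ by positivity), mul_pow, Real.sin_sq,
    show √7 ^ 2 * (1 - Real.cos arcAngle₁ ^ 2) = √7 ^ 2 - (√7 * Real.cos arcAngle₁) ^ 2 by ring,
    cos_arcAngle₁, sqrt_seven_sq, show (7 - (-5 / 2) ^ 2 : ℝ) = 3 / 2 ^ 2 by norm_num,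
    Real.sqrt_div (by norm_num), Real.sqrt_sq (by norm_num)]

lemma sin_arcAngle₂ : √7 * Real.sin arcAngle₂ = √3 := by
  have h0 : 0 ≤ Real.sin arcAngle₂ :=
    Real.sin_nonneg_of_nonneg_of_le_pi (Real.arccos_nonneg _) (Real.arccos_le_pi _)
  rw [← Real.sqrt_sq (show 0 ≤ √7 * Real.sin arcAngle₂ by positivity), mul_pow, Real.sin_sq,
    show √7 ^ 2 * (1 - Real.cos arcAngle₂ ^ 2) = √7 ^ 2 - (√7 * Real.cos arcAngle₂) ^ 2 by ring,
    cos_arcAngle₂, sqrt_seven_sq]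
  norm_num

lemma arcAngle₂_lt : arcAngle₂ < π / 2 := by
  rw [arcAngle₂, Real.arccos_lt_pi_div_two]
  positivity

lemma arcAngle₂_pos : 0 < arcAngle₂ := by
  rw [arcAngle₂, Real.arccos_pos, div_lt_iff₀ (by positivity)]
  linarith [sqrt_seven_bounds.1]

lemma arcAngle₁_lt_pi : arcAngle₁ < π := by
  refine (Real.arccos_le_pi _).lt_of_ne fun h ↦ ?_
  have h1 := cos_arcAngle₁
  rw [show arcAngle₁ = π from h, Real.cos_pi] at h1
  linarith [sqrt_seven_bounds.1]

/-- The cosines agree by the addition formula. The sum is at most π, since otherwise `arcAngle₂` >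
π/3, contradicting √7 sin(`arcAngle₂` − π/3) = −√3/2. -/
lemma arcAngle₁_eq : arcAngle₁ = arcAngle₂ + 2 * π / 3 := by
  have h7 : (√7 : ℝ) ≠ 0 := by positivity
  have h3 : √3 * √3 = (3 : ℝ) := Real.mul_self_sqrt (by norm_num)
  have hπ := Real.pi_pos
  have hcos : Real.cos (2 * π / 3) = -(1 / 2) := by
    rw [show 2 * π / 3 = π - π / 3 by ring, Real.cos_pi_sub, Real.cos_pi_div_three]
  have hsin : Real.sin (2 * π / 3) = √3 / 2 := by
    rw [show 2 * π / 3 = π - π / 3 by ring, Real.sin_pi_sub, Real.sin_pi_div_three]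
  have key : Real.cos (arcAngle₂ + 2 * π / 3) = Real.cos arcAngle₁ := by
    apply mul_left_cancel₀ h7
    rw [cos_arcAngle₁, Real.cos_add, hcos, hsin]
    linear_combination (-1 / 2) * cos_arcAngle₂ - √3 / 2 * sin_arcAngle₂ - h3 / 2
  have hle : arcAngle₂ + 2 * π / 3 ≤ π := by
    by_contra! h
    have h1 : Real.cos (arcAngle₂ - π / 3) = -Real.cos (arcAngle₂ + 2 * π / 3) := by
      rw [← Real.cos_sub_pi, show arcAngle₂ + 2 * π / 3 - π = arcAngle₂ - π / 3 by ring]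
    have h2 : Real.sin (arcAngle₂ - π / 3) < 0 := by
      have : √7 * Real.sin (arcAngle₂ - π / 3) = -√3 / 2 := by
        rw [Real.sin_sub, Real.cos_pi_div_three, Real.sin_pi_div_three]
        linear_combination (1 / 2) * sin_arcAngle₂ - √3 / 2 * cos_arcAngle₂
      have h3 : 0 < √3 := by positivity
      by_contra! h4
      have : 0 ≤ √7 * Real.sin (arcAngle₂ - π / 3) := by positivity
      linarith
    have h4 := arcAngle₂_lt
    have h5 : 0 < Real.sin (arcAngle₂ - π / 3) :=
      Real.sin_pos_of_pos_of_lt_pi (by linarith) (by linarith)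
    linarith
  exact (Real.injOn_cos ⟨by linarith [arcAngle₂_pos], hle⟩
    ⟨Real.arccos_nonneg _, Real.arccos_le_pi _⟩ key).symm

lemma sqrt_three_gt : (1.73 : ℝ) < √3 := by
  rw [Real.lt_sqrt (by norm_num)]
  norm_num

/-- Jordan's inequality gives sin(π/(8j)) ≥ 1/(4j), and (2/5)(1.73/2)(1/4) = 0.0865. -/
lemma le_mul_of_le_arcAngle₁_sub {j : ℕ} (hj : 1 ≤ j) {θ : ℝ} (h0 : 0 ≤ θ)
    (hθ : θ ≤ arcAngle₁ - π / (8 * j)) : 0.085 ≤ j * (1 + 2 / 5 * (√7 * Real.cos θ)) := by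
  have hj' : (1 : ℝ) ≤ j := by exact_mod_cast hj
  have hπ := Real.pi_pos
  set Δ := π / (8 * j) with hΔ
  have hΔ0 : 0 ≤ Δ := by positivity
  have hΔ1 : Δ ≤ π / 2 := by
    rw [hΔ]
    gcongr
    linarith
  have h1 : Real.cos (arcAngle₁ - Δ) ≤ Real.cos θ :=
    Real.cos_le_cos_of_nonneg_of_le_pi h0 (by linarith [arcAngle₁_lt_pi]) hθ
  have h2 : √7 * Real.cos (arcAngle₁ - Δ) = -5 / 2 * Real.cos Δ + √3 / 2 * Real.sin Δ := by
    rw [Real.cos_sub]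
    linear_combination Real.cos Δ * cos_arcAngle₁ + Real.sin Δ * sin_arcAngle₁
  have h3 : 1 / (4 * j) ≤ Real.sin Δ := by
    refine le_trans (le_of_eq ?_) (Real.mul_le_sin hΔ0 hΔ1)
    rw [hΔ]
    field_simp
    norm_num
  have h4 := Real.cos_le_one Δ
  have h5 : √7 * Real.cos (arcAngle₁ - Δ) ≤ √7 * Real.cos θ := by gcongr
  have h6 : 1.73 / 2 * (1 / (4 * j)) ≤ √3 / 2 * Real.sin Δ := by
    gcongr
    exact sqrt_three_gt.le
  have h7 : 2 / 5 * (1.73 / 2 * (1 / (4 * j))) ≤ 1 + 2 / 5 * (√7 * Real.cos θ) := by linarith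
  calc (0.085 : ℝ) ≤ j * (2 / 5 * (1.73 / 2 * (1 / (4 * j)))) := by
        field_simp
        norm_num
    _ ≤ _ := by gcongr

/-- Similarly sin(3π/(8j)) ≥ 3/(4j), and 1.73 · (3/4)/2 = 0.64875. -/
lemma le_mul_of_arcAngle₂_add_le {j : ℕ} (hj : 1 ≤ j) {φ : ℝ} (h0 : φ ≤ π)
    (hφ : arcAngle₂ + 3 * π / (8 * j) ≤ φ) : 0.64 ≤ j * (1 - √7 * Real.cos φ / 2) := by
  have hj' : (1 : ℝ) ≤ j := by exact_mod_cast hj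
  have hπ := Real.pi_pos
  set Δ := 3 * π / (8 * j) with hΔ
  have hΔ0 : 0 ≤ Δ := by positivity
  have hΔ1 : Δ ≤ π / 2 := by
    rw [hΔ, div_le_div_iff₀ (by positivity) (by norm_num)]
    nlinarith
  have h1 : Real.cos φ ≤ Real.cos (arcAngle₂ + Δ) :=
    Real.cos_le_cos_of_nonneg_of_le_pi (by linarith [arcAngle₂_pos]) h0 hφ
  have h2 : √7 * Real.cos (arcAngle₂ + Δ) = 2 * Real.cos Δ - √3 * Real.sin Δ := by
    rw [Real.cos_add]
    linear_combination Real.cos Δ * cos_arcAngle₂ - Real.sin Δ * sin_arcAngle₂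
  have h3 : 3 / (4 * j) ≤ Real.sin Δ := by
    refine le_trans (le_of_eq ?_) (Real.mul_le_sin hΔ0 hΔ1)
    rw [hΔ]
    field_simp
    norm_num
  have h4 := Real.cos_le_one Δ
  have h5 : √7 * Real.cos φ ≤ √7 * Real.cos (arcAngle₂ + Δ) := by gcongr
  have h6 : 1.73 * (3 / (4 * j)) ≤ √3 * Real.sin Δ := by
    gcongr
    exact sqrt_three_gt.le
  have h7 : 1.73 * (3 / (4 * j)) / 2 ≤ 1 - √7 * Real.cos φ / 2 := by linarith
  calc (0.64 : ℝ) ≤ j * (1.73 * (3 / (4 * j)) / 2) := by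
        field_simp
        norm_num
    _ ≤ _ := by gcongr

/-! ### Zeros on the two arcs from sign changes -/

/-- The hypothesis gives 7^j E_k(7z) + E_k(z) = 2 · 7^j u^(−j) Re(u^j E_k(7z)). -/
lemma eisenstein_eq_zero_of_conj {j : ℕ} (hk : 3 ≤ 2 * j) {z : ℍ} {u : ℂ} (hu : ‖u‖ = 1)
    (hE : (u / (√7 : ℝ)) ^ (2 * j) * ModularForm.E hk z =
      starRingEnd ℂ (ModularForm.E hk (scale 7 z)))
    (h0 : (u ^ j * ModularForm.E hk (scale 7 z)).re = 0) : eisenstein 7 hk z = 0 := by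
  have hu0 : u ≠ 0 := by
    rintro rfl
    simp at hu
  have h7 : (((√7 : ℝ) : ℂ)) ^ (2 * j) = 7 ^ j := by
    rw [pow_mul, ← ofReal_pow, sqrt_seven_sq]
    norm_num
  have huu : u * starRingEnd ℂ u = 1 := by
    rw [Complex.mul_conj, ← Complex.sq_norm, hu]
    norm_num
  rw [div_pow, h7, div_mul_eq_mul_div, div_eq_iff (pow_ne_zero _ (by norm_num))] at hE
  have hre : u ^ j * ModularForm.E hk (scale 7 z) +
      starRingEnd ℂ (u ^ j * ModularForm.E hk (scale 7 z)) = 0 := by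
    rw [Complex.add_conj, h0]
    simp
  rw [map_mul, map_pow] at hre
  have huj : u ^ j * (starRingEnd ℂ u) ^ j = 1 := by rw [← mul_pow, huu, one_pow]
  have hmain : (7 : ℂ) ^ j * ModularForm.E hk (scale 7 z) + ModularForm.E hk z = 0 := by
    apply mul_left_cancel₀ (pow_ne_zero (2 * j) hu0)
    rw [show u ^ (2 * j) = u ^ j * u ^ j by ring] at hE ⊢
    linear_combination (7 ^ j * u ^ j) * hre + hE -
      7 ^ j * starRingEnd ℂ (ModularForm.E hk (scale 7 z)) * huj
  rw [eisenstein, Nat.mul_div_cancel_left j (by norm_num)]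
  push_cast
  rw [hmain, mul_zero]

/-- On |z| = 1/√7 one has −1/z = −7z̄, so z^k E_k(z) is the conjugate of E_k(7z). -/
lemma eisenstein_eq_zero_of_circle {j : ℕ} (hk : 3 ≤ 2 * j) {z : ℍ} {u : ℂ} (hu : ‖u‖ = 1)
    (hz : (z : ℂ) = u / (√7 : ℝ)) (h0 : (u ^ j * ModularForm.E hk (scale 7 z)).re = 0) :
    eisenstein 7 hk z = 0 := by
  have h7 : (((√7 : ℝ) : ℂ)) * (√7 : ℝ) = 7 := by
    rw [← sq, ← ofReal_pow, sqrt_seven_sq]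
    norm_num
  have h70 : (((√7 : ℝ) : ℂ)) ≠ 0 := by
    intro h
    rw [h] at h7
    norm_num at h7
  refine eisenstein_eq_zero_of_conj hk hu ?_ h0
  have huu : u * starRingEnd ℂ u = 1 := by
    rw [Complex.mul_conj, ← Complex.sq_norm, hu]
    norm_num
  have hw : (frickeInv z : ℂ) = -starRingEnd ℂ z := by
    apply mul_right_cancel₀ (mul_ne_zero (by norm_num : (7 : ℂ) ≠ 0) z.ne_zero)
    rw [frickeInv_mul, hz, map_div₀, Complex.conj_ofReal]
    field_simp
    linear_combination 7 * huu - h7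
  have h1 := E_of_mul_eq_neg_one hk (z := z) (w := scale 7 (frickeInv z))
    (by rw [coe_scale]; linear_combination frickeInv_mul z)
  rw [← hz, ← h1]
  refine E_eq_of_neg_conj hk (even_two_mul j) ?_
  rw [coe_scale, coe_scale, hw, map_mul, Complex.conj_ofNat]
  ring

/-- On |2z+1| = 1/√7 the matrix (7, 3; 2, 1) sends z to −7z̄. -/
lemma eisenstein_eq_zero_of_circle_half {j : ℕ} (hk : 3 ≤ 2 * j) {z : ℍ} {u : ℂ} (hu : ‖u‖ = 1)
    (hz : 2 * (z : ℂ) + 1 = u / (√7 : ℝ)) (h0 : (u ^ j * ModularForm.E hk (scale 7 z)).re = 0) :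
    eisenstein 7 hk z = 0 := by
  have h7 : (((√7 : ℝ) : ℂ)) * (√7 : ℝ) = 7 := by
    rw [← sq, ← ofReal_pow, sqrt_seven_sq]
    norm_num
  have h70 : (((√7 : ℝ) : ℂ)) ≠ 0 := by
    intro h
    rw [h] at h7
    norm_num at h7
  refine eisenstein_eq_zero_of_conj hk hu ?_ h0
  have huu : u * starRingEnd ℂ u = 1 := by
    rw [Complex.mul_conj, ← Complex.sq_norm, hu]
    norm_num
  have hzz : 7 * (2 * (z : ℂ) + 1) * (2 * starRingEnd ℂ (z : ℂ) + 1) = 1 := by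
    have hc : 2 * starRingEnd ℂ (z : ℂ) + 1 = starRingEnd ℂ u / (√7 : ℝ) := by
      have := congrArg (starRingEnd ℂ) hz
      simpa [Complex.conj_ofNat] using this
    rw [hc, hz]
    field_simp
    linear_combination 7 * huu - h7
  have him : 0 < (-(starRingEnd ℂ (scale 7 z : ℂ))).im := by
    simpa using (scale 7 z).im_pos
  let v : ℍ := ⟨-(starRingEnd ℂ (scale 7 z : ℂ)), him⟩
  have hv : (v : ℂ) = -(7 * starRingEnd ℂ (z : ℂ)) := by
    change -(starRingEnd ℂ (scale 7 z : ℂ)) = _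
    rw [coe_scale, map_mul, Complex.conj_ofNat]
  have h1 : ModularForm.E hk v = (2 * (z : ℂ) + 1) ^ (2 * j) * ModularForm.E hk z := by
    have := E_moebius hk (a := 7) (b := 3) (c := 2) (d := 1) (by norm_num) (z := z) (w := v)
      (by push_cast; rw [hv]; linear_combination (-1 / 2) * hzz)
    simpa using this
  rw [← hz, ← h1]
  exact E_eq_of_neg_conj hk (even_two_mul j) rfl

/-- At mπ/j the exponential factor is (−1)^m and F has positive real part, so consecutive values
have opposite signs. -/
lemma exists_zero_between {j : ℕ} (hj : 0 < j) {F : ℝ → ℂ} {m : ℤ}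
    (hF : ContinuousOn F (Set.Icc (m * π / j) ((m + 1 : ℤ) * π / j)))
    (h0 : ‖F (m * π / j) - 1‖ < 1) (h1 : ‖F ((m + 1 : ℤ) * π / j) - 1‖ < 1) :
    ∃ θ ∈ Set.Ioo (m * π / j : ℝ) ((m + 1 : ℤ) * π / j),
      (Complex.exp (θ * Complex.I) ^ j * F θ).re = 0 := by
  have hj' : (0 : ℝ) < j := by exact_mod_cast hj
  have hπ := Real.pi_pos
  have hpos : ∀ w : ℂ, ‖w - 1‖ < 1 → 0 < w.re := fun w hw ↦ by
    have := (abs_le.mp (Complex.abs_re_le_norm (w - 1))).1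
    simp only [Complex.sub_re, Complex.one_re] at this
    linarith
  have hjC : (j : ℂ) ≠ 0 := by exact_mod_cast hj.ne'
  have hle : (m * π / j : ℝ) ≤ (m + 1 : ℤ) * π / j := by
    push_cast
    gcongr
    linarith
  set g : ℝ → ℝ := fun θ ↦ (Complex.exp (θ * Complex.I) ^ j * F θ).re with hg
  have hgc : ContinuousOn g (Set.Icc (m * π / j) ((m + 1 : ℤ) * π / j)) := by
    refine Complex.continuous_re.comp_continuousOn (ContinuousOn.mul ?_ hF)
    exact Continuous.continuousOn (by fun_prop)
  have hval : ∀ n : ℤ, g (n * π / j) = (-1) ^ n * (F (n * π / j)).re := fun n ↦ by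
    have h : Complex.exp (((n * π / j : ℝ) : ℂ) * Complex.I) ^ j = (((-1 : ℝ) ^ n : ℝ) : ℂ) := by
      rw [← Complex.exp_nat_mul, ← Real.cos_int_mul_pi, show
        (j : ℂ) * (((n * π / j : ℝ) : ℂ) * Complex.I) = ((n * π : ℝ) : ℂ) * Complex.I by
          push_cast; field_simp, Complex.exp_mul_I, ← Complex.ofReal_cos, ← Complex.ofReal_sin,
        Real.sin_int_mul_pi]
      simp
    rw [hg]
    simp only
    rw [h, Complex.re_ofReal_mul]
  have e0 := hval m
  have e1 := hval (m + 1)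
  rw [zpow_add₀ (by norm_num), zpow_one] at e1
  have p0 := hpos _ h0
  have p1 := hpos _ h1
  rcases Int.even_or_odd m with hm | hm
  · rw [hm.neg_one_zpow] at e0 e1
    exact intermediate_value_Ioo' hle hgc ⟨by linarith, by linarith⟩
  · rw [hm.neg_one_zpow] at e0 e1
    exact intermediate_value_Ioo hle hgc ⟨by linarith, by linarith⟩

/-- Zeros on an arc, found from the sign changes of a real function of the angle. -/
lemma exists_finset_zeros {j : ℕ} (hk : 3 ≤ 2 * j) {a b : ℝ} (hb : 0 < b) {A B : ℤ} (hA : 0 < A)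
    (hB : B < j)
    (hlt : ∀ m : ℤ, A ≤ m → m ≤ B → ∀ z : ℍ, (z : ℂ) = a + b * Complex.exp ((m * π / j : ℝ) *
      Complex.I) → ‖ModularForm.E hk (scale 7 z) - 1‖ < 1)
    (hzero : ∀ (θ : ℝ) (z : ℍ), (z : ℂ) = a + b * Complex.exp (θ * Complex.I) →
      (Complex.exp (θ * Complex.I) ^ j * ModularForm.E hk (scale 7 z)).re = 0 →
      eisenstein 7 hk z = 0) :
    ∃ Z : Finset ℍ, B - A ≤ (Z.card : ℤ) ∧ ∀ z ∈ Z, eisenstein 7 hk z = 0 ∧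
      ∃ θ ∈ Set.Ioo (A * π / j : ℝ) (B * π / j),
        (z : ℂ) = a + b * Complex.exp (θ * Complex.I) := by
  classical
  have hj : 0 < j := by omega
  have hj' : (0 : ℝ) < j := by exact_mod_cast hj
  have hπ := Real.pi_pos
  have him : ∀ θ : ℝ, 0 < θ → θ < π → 0 < (a + b * Complex.exp (θ * Complex.I)).im := by
    intro θ h0 h1
    have : (a + b * Complex.exp (θ * Complex.I)).im = b * Real.sin θ := by
      rw [Complex.add_im, Complex.ofReal_im, Complex.im_ofReal_mul, Complex.exp_ofReal_mul_I_im,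
        zero_add]
    rw [this]
    exact mul_pos hb (Real.sin_pos_of_pos_of_lt_pi h0 h1)
  have hcoe : ∀ θ : ℝ, 0 < θ → θ < π →
      ((ofComplex (a + b * Complex.exp (θ * Complex.I)) : ℍ) : ℂ) =
        a + b * Complex.exp (θ * Complex.I) := fun θ h0 h1 ↦ by
    rw [ofComplex_apply_of_im_pos (him θ h0 h1)]
  set F : ℝ → ℂ := fun θ ↦
    ModularForm.E hk (scale 7 (ofComplex (a + b * Complex.exp (θ * Complex.I)))) with hF
  have hlow : ∀ m : ℤ, A ≤ m → (0 : ℝ) < m * π / j := fun m hm ↦ by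
    have : (0 : ℝ) < m := by exact_mod_cast hA.trans_le hm
    positivity
  have hhigh : ∀ m : ℤ, m ≤ B → (m * π / j : ℝ) < π := fun m hm ↦ by
    have : (m : ℝ) < j := by exact_mod_cast hm.trans_lt hB
    rw [div_lt_iff₀ hj']
    nlinarith
  have hFc : ContinuousOn F (Set.Ioo 0 π) := by
    have hE := (UpperHalfPlane.mdifferentiable_iff.mp (ModularForm.E hk).holo').continuousOn
    have hcomp : ContinuousOn (fun θ : ℝ ↦ (⇑(ModularForm.E hk) ∘ ofComplex)
        (7 * (a + b * Complex.exp (θ * Complex.I)))) (Set.Ioo 0 π) := by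
      refine hE.comp (Continuous.continuousOn (by fun_prop)) fun θ hθ ↦ ?_
      have := him θ hθ.1 hθ.2
      change 0 < (7 * (a + b * Complex.exp (θ * Complex.I))).im
      rw [show (7 : ℂ) = ((7 : ℝ) : ℂ) by norm_num, Complex.im_ofReal_mul]
      positivity
    refine hcomp.congr fun θ hθ ↦ ?_
    simp only [hF, Function.comp_apply]
    congr 1
    ext1
    have := him θ hθ.1 hθ.2
    rw [coe_scale, hcoe θ hθ.1 hθ.2, ofComplex_apply_of_im_pos]
    rw [show (7 : ℂ) = ((7 : ℝ) : ℂ) by norm_num, Complex.im_ofReal_mul]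
    positivity
  have hex : ∀ m : ℤ, m ∈ Finset.Ico A B → ∃ θ ∈ Set.Ioo (m * π / j : ℝ) ((m + 1 : ℤ) * π / j),
      (Complex.exp (θ * Complex.I) ^ j * F θ).re = 0 := by
    intro m hm
    rw [Finset.mem_Ico] at hm
    refine exists_zero_between hj (hFc.mono ?_) ?_ ?_
    · intro θ hθ
      exact ⟨(hlow m hm.1).trans_le hθ.1, hθ.2.trans_lt (hhigh _ (by omega))⟩
    · exact hlt m hm.1 hm.2.le _ (hcoe _ (hlow m hm.1) (hhigh m hm.2.le))
    · exact hlt (m + 1) (by omega) (by omega) _ (hcoe _ (hlow _ (by omega)) (hhigh _ (by omega)))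
  choose! θ hθ hθ0 using hex
  have hθpi : ∀ m ∈ Finset.Ico A B, 0 < θ m ∧ θ m < π := fun m hm ↦ by
    have h := hθ m hm
    rw [Finset.mem_Ico] at hm
    exact ⟨(hlow m hm.1).trans h.1, h.2.trans (hhigh _ (by omega))⟩
  have hmono : ∀ m ∈ Finset.Ico A B, ∀ n ∈ Finset.Ico A B, m < n → θ m < θ n := by
    intro m hm n hn hmn
    refine (hθ m hm).2.trans_le (le_trans ?_ (hθ n hn).1.le)
    gcongr
    exact_mod_cast hmn
  have hinj : Set.InjOn (fun m ↦ ofComplex (a + b * Complex.exp (θ m * Complex.I)))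
      (Finset.Ico A B : Finset ℤ) := by
    intro m hm n hn hmn
    have h1 : ((ofComplex (a + b * Complex.exp (θ m * Complex.I)) : ℍ) : ℂ) =
        (ofComplex (a + b * Complex.exp (θ n * Complex.I)) : ℍ) := congrArg _ hmn
    obtain ⟨hm0, hm1⟩ := hθpi m hm
    obtain ⟨hn0, hn1⟩ := hθpi n hn
    rw [hcoe _ hm0 hm1, hcoe _ hn0 hn1] at h1
    have h2 := congrArg Complex.re h1
    rw [Complex.add_re, Complex.add_re, Complex.re_ofReal_mul, Complex.re_ofReal_mul,
      Complex.exp_ofReal_mul_I_re, Complex.exp_ofReal_mul_I_re] at h2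
    have h3 : Real.cos (θ m) = Real.cos (θ n) := mul_left_cancel₀ hb.ne' (by linarith)
    have h4 := Real.injOn_cos ⟨hm0.le, hm1.le⟩ ⟨hn0.le, hn1.le⟩ h3
    rcases lt_trichotomy m n with h | h | h
    · exact absurd h4 (hmono m hm n hn h).ne
    · exact h
    · exact absurd h4 (hmono n hn m hm h).ne'
  refine ⟨(Finset.Ico A B).image fun m ↦ ofComplex (a + b * Complex.exp (θ m * Complex.I)),
    ?_, fun z hz ↦ ?_⟩
  · rw [Finset.card_image_of_injOn hinj, Int.card_Ico]
    exact Int.self_le_toNat _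
  · obtain ⟨m, hm, rfl⟩ := Finset.mem_image.mp hz
    obtain ⟨hm0, hm1⟩ := hθpi m hm
    refine ⟨hzero (θ m) _ (hcoe _ hm0 hm1) (hθ0 m hm), θ m, ?_, hcoe _ hm0 hm1⟩
    have h := hθ m hm
    rw [Finset.mem_Ico] at hm
    refine ⟨lt_of_le_of_lt ?_ h.1, h.2.trans_le ?_⟩
    · gcongr
      exact_mod_cast hm.1
    · gcongr
      exact_mod_cast hm.2

lemma re_of_coe_eq {a b θ : ℝ} {z : ℍ} (h : (z : ℂ) = a + b * Complex.exp (θ * Complex.I)) :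
    z.re = a + b * Real.cos θ := by
  have := congrArg Complex.re h
  rwa [Complex.add_re, Complex.ofReal_re, Complex.re_ofReal_mul,
    Complex.exp_ofReal_mul_I_re] at this

lemma normSq_of_coe_eq {a b θ : ℝ} {z : ℍ} (h : (z : ℂ) = a + b * Complex.exp (θ * Complex.I)) :
    normSq (z : ℂ) = a ^ 2 + 2 * a * b * Real.cos θ + b ^ 2 := by
  rw [h, normSq_apply, Complex.add_re, Complex.ofReal_re, Complex.re_ofReal_mul,
    Complex.exp_ofReal_mul_I_re, Complex.add_im, Complex.ofReal_im, Complex.im_ofReal_mul,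
    Complex.exp_ofReal_mul_I_im]
  linear_combination b ^ 2 * Real.sin_sq_add_cos_sq θ

lemma sqrt_seven_inv_sq : (1 / √7) ^ 2 = (1 / 7 : ℝ) := by
  rw [div_pow, sqrt_seven_sq, one_pow]

lemma seven_mul_inv_sqrt_seven : 7 * (1 / √7) = (√7 : ℝ) := by
  have := sqrt_seven_sq
  field_simp
  exact this.symm

/-- The multiples of π/j used run from π/2, the argument at i/√7, to `arcAngle₁` − π/(8j); the first
has index ⌈j/2⌉. The zeros are interior to the arc and so avoid the elliptic points. -/
lemma exists_zeros_circle {j : ℕ} (hk : 3 ≤ 2 * j) (hj : 6 ≤ j) :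
    ∃ Z : Finset ℍ, ⌊j * arcAngle₁ / π - 1 / 8⌋ - (((j + 1) / 2 : ℕ) : ℤ) ≤ (Z.card : ℤ) ∧
      ∀ z ∈ Z, eisenstein 7 hk z = 0 ∧ normSq (z : ℂ) = 1 / 7 ∧ -5 / 14 < z.re ∧ z.re < 0 := by
  have hj' : (6 : ℝ) ≤ j := by exact_mod_cast hj
  have hπ := Real.pi_pos
  have h7 : 0 < √7 := by positivity
  have hnorm : ∀ (θ : ℝ) (z : ℍ), (z : ℂ) = (0 : ℝ) + (1 / √7 : ℝ) *
      Complex.exp (θ * Complex.I) → normSq (z : ℂ) = 1 / 7 ∧ 7 * z.re = √7 * Real.cos θ := by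
    intro θ z hz
    refine ⟨?_, ?_⟩
    · rw [normSq_of_coe_eq hz, sqrt_seven_inv_sq]
      ring
    · rw [re_of_coe_eq hz, zero_add, ← mul_assoc, seven_mul_inv_sqrt_seven]
  have hlow : ∀ m : ℤ, (((j + 1) / 2 : ℕ) : ℤ) ≤ m → π / 2 ≤ (m * π / j : ℝ) := fun m hm ↦ by
    have : (j : ℝ) ≤ 2 * m := by
      have : (j : ℤ) ≤ 2 * m := by omega
      exact_mod_cast this
    rw [div_le_div_iff₀ (by norm_num) (by positivity)]
    nlinarith
  have hhigh : ∀ m : ℤ, m ≤ ⌊j * arcAngle₁ / π - 1 / 8⌋ →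
      (m * π / j : ℝ) ≤ arcAngle₁ - π / (8 * j) := fun m hm ↦ by
    have h1 : (m : ℝ) ≤ j * arcAngle₁ / π - 1 / 8 := Int.le_floor.mp hm
    calc (m * π / j : ℝ) ≤ (j * arcAngle₁ / π - 1 / 8) * π / j := by gcongr
      _ = arcAngle₁ - π / (8 * j) := by field_simp
  have hΔ : 0 < π / (8 * j) := by positivity
  have hex := exists_finset_zeros hk (a := 0) (b := 1 / √7) (by positivity)
    (A := (((j + 1) / 2 : ℕ) : ℤ)) (B := ⌊j * arcAngle₁ / π - 1 / 8⌋) (by omega) ?_ ?_ ?_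
  · obtain ⟨Z, hcard, hZ⟩ := hex
    refine ⟨Z, hcard, fun z hz ↦ ?_⟩
    obtain ⟨h0, θ, hθ, hzθ⟩ := hZ z hz
    obtain ⟨hn, hr⟩ := hnorm θ z hzθ
    have h1 := hlow _ le_rfl
    have h2 := hhigh _ le_rfl
    have h3 : Real.cos θ < 0 := Real.cos_neg_of_pi_div_two_lt_of_lt (h1.trans_lt hθ.1)
      (by linarith [hθ.2, arcAngle₁_lt_pi])
    have h4 : Real.cos arcAngle₁ < Real.cos θ := Real.cos_lt_cos_of_nonneg_of_le_pi
      (by linarith [hθ.1]) arcAngle₁_lt_pi.le (by linarith [hθ.2])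
    have h5 := mul_lt_mul_of_pos_left h4 h7
    have h6 := mul_neg_of_pos_of_neg h7 h3
    rw [cos_arcAngle₁] at h5
    exact ⟨h0, hn, by linarith, by linarith⟩
  · rw [Int.floor_lt]
    have : j * arcAngle₁ / π < j := by
      rw [div_lt_iff₀ hπ]
      exact mul_lt_mul_of_pos_left arcAngle₁_lt_pi (by linarith)
    push_cast
    linarith
  · intro m hmA hmB z hz
    obtain ⟨hn, hr⟩ := hnorm _ z hz
    have h1 := hlow m hmA
    have h2 := hhigh m hmB
    refine norm_E_scale_sub_one_lt_of_normSq_eq hk hj hn ?_ ?_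
    · have h3 : Real.cos (m * π / j) ≤ 0 := Real.cos_nonpos_of_pi_div_two_le_of_le h1
        (by linarith [arcAngle₁_lt_pi])
      have := mul_nonpos_of_nonneg_of_nonpos h7.le h3
      linarith
    · have := le_mul_of_le_arcAngle₁_sub (by omega) (by linarith) h2
      rw [← hr] at this
      linarith
  · intro θ z hz h0
    refine eisenstein_eq_zero_of_circle hk (Complex.norm_exp_ofReal_mul_I θ) ?_ h0
    rw [hz]
    push_cast
    ring

/-- Here the multiples run from `arcAngle₂` + 3π/(8j) to π/2, the argument at the point of real part
−1/2. -/
lemma exists_zeros_circle_half {j : ℕ} (hk : 3 ≤ 2 * j) (hj : 6 ≤ j) :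
    ∃ Z : Finset ℍ, ((j / 2 : ℕ) : ℤ) - ⌈j * arcAngle₂ / π + 3 / 8⌉ ≤ (Z.card : ℤ) ∧
      ∀ z ∈ Z, eisenstein 7 hk z = 0 ∧ normSq (z : ℂ) = -z.re - 3 / 14 ∧ -1 / 2 < z.re ∧
        z.re < -5 / 14 := by
  have hj' : (6 : ℝ) ≤ j := by exact_mod_cast hj
  have hπ := Real.pi_pos
  have h7 : 0 < √7 := by positivity
  have hnorm : ∀ (θ : ℝ) (z : ℍ), (z : ℂ) = (-1 / 2 : ℝ) + (1 / √7 / 2 : ℝ) *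
      Complex.exp (θ * Complex.I) →
      normSq (z : ℂ) = -z.re - 3 / 14 ∧ 7 * z.re = -7 / 2 + √7 * Real.cos θ / 2 := by
    intro θ z hz
    refine ⟨?_, ?_⟩
    · rw [normSq_of_coe_eq hz, re_of_coe_eq hz]
      linear_combination sqrt_seven_inv_sq / 4
    · rw [re_of_coe_eq hz]
      linear_combination Real.cos θ / 2 * seven_mul_inv_sqrt_seven
  have hhigh : ∀ m : ℤ, m ≤ ((j / 2 : ℕ) : ℤ) → (m * π / j : ℝ) ≤ π / 2 := fun m hm ↦ by
    have : 2 * (m : ℝ) ≤ j := by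
      have : 2 * m ≤ (j : ℤ) := by omega
      exact_mod_cast this
    rw [div_le_div_iff₀ (by positivity) (by norm_num)]
    nlinarith
  have hlow : ∀ m : ℤ, ⌈j * arcAngle₂ / π + 3 / 8⌉ ≤ m →
      arcAngle₂ + 3 * π / (8 * j) ≤ (m * π / j : ℝ) := fun m hm ↦ by
    have h1 : j * arcAngle₂ / π + 3 / 8 ≤ (m : ℝ) := Int.ceil_le.mp hm
    calc arcAngle₂ + 3 * π / (8 * j) = (j * arcAngle₂ / π + 3 / 8) * π / j := by field_simp
      _ ≤ (m * π / j : ℝ) := by gcongr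
  have hΔ : 0 < 3 * π / (8 * j) := by positivity
  have hφ := arcAngle₂_pos
  have hex := exists_finset_zeros hk (a := -1 / 2) (b := 1 / √7 / 2) (by positivity)
    (A := ⌈j * arcAngle₂ / π + 3 / 8⌉) (B := ((j / 2 : ℕ) : ℤ)) (Int.ceil_pos.mpr (by positivity))
    (by omega) ?_ ?_
  · obtain ⟨Z, hcard, hZ⟩ := hex
    refine ⟨Z, hcard, fun z hz ↦ ?_⟩
    obtain ⟨h0, θ, hθ, hzθ⟩ := hZ z hz
    obtain ⟨hn, hr⟩ := hnorm θ z hzθ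
    have h1 := hlow _ le_rfl
    have h2 := hhigh _ le_rfl
    have h3 : 0 < Real.cos θ := Real.cos_pos_of_mem_Ioo ⟨by linarith [hθ.1], hθ.2.trans_le h2⟩
    have h4 : Real.cos θ < Real.cos arcAngle₂ := Real.cos_lt_cos_of_nonneg_of_le_pi
      hφ.le (by linarith [hθ.2]) (by linarith [hθ.1])
    have h5 := mul_lt_mul_of_pos_left h4 h7
    have h6 := mul_pos h7 h3
    rw [cos_arcAngle₂] at h5
    exact ⟨h0, hn, by linarith, by linarith⟩
  · intro m hmA hmB z hz
    obtain ⟨hn, hr⟩ := hnorm _ z hz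
    have h1 := hlow m hmA
    have h2 := hhigh m hmB
    refine norm_E_scale_sub_one_lt_of_normSq_eq_neg_re hk hj hn ?_ ?_
    · have h3 : 0 ≤ Real.cos (m * π / j) := Real.cos_nonneg_of_mem_Icc ⟨by linarith, h2⟩
      have := mul_nonneg h7.le h3
      linarith
    · have := le_mul_of_arcAngle₂_add_le (by omega) (by linarith) h1
      rw [hr]
      convert! this using 1
      ring
  · intro θ z hz h0
    refine eisenstein_eq_zero_of_circle_half hk (Complex.norm_exp_ofReal_mul_I θ) ?_ h0
    rw [hz]
    push_cast
    ring

/-! ### The final count -/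

lemma mem_regularDomain_of_circle {z : ℍ} (hn : normSq (z : ℂ) = 1 / 7) (h1 : -5 / 14 < z.re)
    (h2 : z.re < 0) : z ∈ RegularDomain ∩ arc 7 := by
  have hF : z ∈ fundamentalDomain 7 := (mem_fundamentalDomain_iff z).mpr
    (Or.inl ⟨hn.ge, by linarith, by linarith, h2.le⟩)
  exact ⟨⟨⟨hF, fun h ↦ h1.ne' h.2⟩, fun h ↦ h2.ne h.2, fun h ↦ by linarith [h.2]⟩,
    (mem_arc_iff z).mpr ⟨hF, Or.inl hn⟩⟩

lemma mem_regularDomain_of_circle_half {z : ℍ} (hn : normSq (z : ℂ) = -z.re - 3 / 14)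
    (h1 : -1 / 2 < z.re) (h2 : z.re < -5 / 14) : z ∈ RegularDomain ∩ arc 7 := by
  have hF : z ∈ fundamentalDomain 7 := (mem_fundamentalDomain_iff z).mpr
    (Or.inl ⟨by linarith, hn.ge, h1.le, by linarith⟩)
  exact ⟨⟨⟨hF, fun h ↦ h2.ne h.2⟩, fun h ↦ by linarith [h.2], fun h ↦ h1.ne' h.2⟩,
    (mem_arc_iff z).mpr ⟨hF, Or.inr hn⟩⟩

lemma one_le_toNat_order {k : ℕ} (hk : 3 ≤ k) (hk2 : Even k) {z : ℍ}
    (hz : eisenstein 7 hk z = 0) : 1 ≤ (order (eisenstein 7 hk) z).toNat := by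
  have h := one_le_order_of_eq_zero hk hz
  rwa [← ENat.natCast_toNat (order_ne_top hk hk2 z), ← Nat.cast_one, Nat.cast_le] at h

/-- Zeros in T and Z are regular and count twice in the valence inequality; for odd j the forced
zero at i/√7 counts once. -/
lemma three_mul_sum_order_add_card_le {j : ℕ} (hk : 3 ≤ 2 * j) {T Z : Finset ℍ}
    (hT : ∀ z ∈ T, z ∈ fundamentalDomain 7 \ arc 7)
    (hZ : ∀ z ∈ Z, eisenstein 7 hk z = 0 ∧ z ∈ RegularDomain ∩ arc 7) :
    3 * (2 * (∑ z ∈ T, (order (eisenstein 7 hk) z).toNat + Z.card) + j % 2) ≤ 4 * j := by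
  classical
  have hdis : Disjoint T Z := Finset.disjoint_left.mpr fun z hz hz' ↦ (hT z hz).2 (hZ z hz').2.2
  have hreg : ∀ z ∈ T ∪ Z, z ∈ RegularDomain := fun z hz ↦ by
    rcases Finset.mem_union.mp hz with h | h
    · exact mem_regularDomain_of_notMem_arc (hT z h)
    · exact (hZ z h).2.1
  have hcard : Z.card ≤ ∑ z ∈ Z, (order (eisenstein 7 hk) z).toNat := by
    rw [Finset.card_eq_sum_ones]
    exact Finset.sum_le_sum fun z hz ↦ one_le_toNat_order hk (even_two_mul j) (hZ z hz).1
  obtain ⟨I, hI, hIsum⟩ : ∃ I : Finset ℍ, I ⊆ {frickeFixed} ∧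
      j % 2 ≤ ∑ z ∈ I, (order (eisenstein 7 hk) z).toNat := by
    rcases Nat.mod_two_eq_zero_or_one j with h | h
    · exact ⟨∅, Finset.empty_subset _, by simp [h]⟩
    · refine ⟨{frickeFixed}, subset_rfl, ?_⟩
      rw [Finset.sum_singleton, h]
      exact one_le_toNat_order hk (even_two_mul j) (eisenstein_frickeFixed hk (by omega))
  have key := three_mul_sum_order_fricke_le hk (even_two_mul j) hreg hI
  rw [Finset.sum_union hdis] at key
  omega

/-- Rounding loses less than 2 and the gaps lose 1/8 + 3/8, so the right side exceeds 6(2j/3 − 5/2)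
= 4j − 15. -/
lemma floor_sub_ceil_ge (j : ℕ) :
    4 * (j : ℤ) - 14 ≤ 6 * (⌊j * arcAngle₁ / π - 1 / 8⌋ - ⌈j * arcAngle₂ / π + 3 / 8⌉) := by
  have hπ := Real.pi_ne_zero
  have h1 := Int.lt_floor_add_one (j * arcAngle₁ / π - 1 / 8)
  have h2 := Int.ceil_lt_add_one (j * arcAngle₂ / π + 3 / 8)
  have h3 : j * arcAngle₁ / π = j * arcAngle₂ / π + 2 * j / 3 := by
    rw [arcAngle₁_eq]
    field_simp
  have h4 : 4 * (j : ℝ) - 15 < 6 * ((⌊j * arcAngle₁ / π - 1 / 8⌋ : ℝ) -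
      (⌈j * arcAngle₂ / π + 3 / 8⌉ : ℝ)) := by linarith
  have h5 : 4 * (j : ℤ) - 15 <
      6 * (⌊j * arcAngle₁ / π - 1 / 8⌋ - ⌈j * arcAngle₂ / π + 3 / 8⌉) := by exact_mod_cast h4
  omega

theorem sum_toNat_order_le_two {j : ℕ} (hk : 3 ≤ 2 * j) {T : Finset ℍ}
    (hT : ∀ z ∈ T, z ∈ fundamentalDomain 7 \ arc 7) :
    ∑ z ∈ T, (order (eisenstein 7 hk) z).toNat ≤ 2 := by
  classical
  rcases lt_or_ge j 6 with hj | hj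
  · have := three_mul_sum_order_add_card_le hk hT (Z := ∅) (by simp)
    rw [Finset.card_empty] at this
    interval_cases j <;> omega
  · obtain ⟨Z₁, hc₁, hZ₁⟩ := exists_zeros_circle hk hj
    obtain ⟨Z₂, hc₂, hZ₂⟩ := exists_zeros_circle_half hk hj
    have hdis : Disjoint Z₁ Z₂ := Finset.disjoint_left.mpr fun z hz hz' ↦ by
      linarith [(hZ₁ z hz).2.2.1, (hZ₂ z hz').2.2.2]
    have key := three_mul_sum_order_add_card_le hk hT (Z := Z₁ ∪ Z₂) fun z hz ↦ by
      rcases Finset.mem_union.mp hz with h | h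
      · obtain ⟨h0, h1, h2, h3⟩ := hZ₁ z h
        exact ⟨h0, mem_regularDomain_of_circle h1 h2 h3⟩
      · obtain ⟨h0, h1, h2, h3⟩ := hZ₂ z h
        exact ⟨h0, mem_regularDomain_of_circle_half h1 h2 h3⟩
    rw [Finset.card_union_of_disjoint hdis] at key
    -- Since ⌊j/2⌋ − ⌈j/2⌉ = −(j mod 2), the bounds combine to 6 · sum ≤ 14 + 3(j mod 2) ≤ 17.
    have hfc := floor_sub_ceil_ge j
    omega

end Fricke

end

end

theorem mainTheorem7 (k : ℕ) (hk : 4 ≤ k) (hk_even : Even k) :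
    Fricke.numZeros (Fricke.eisenstein 7 (show 3 ≤ k by omega))
      (Fricke.fundamentalDomain 7 \ Fricke.arc 7) ≤ 2 := by
  obtain ⟨j, rfl⟩ := hk_even.two_dvd
  refine iSup₂_le fun T hT ↦ ?_
  have h := Fricke.sum_toNat_order_le_two (show 3 ≤ 2 * j by omega) (T := T) fun z hz ↦ hT hz
  calc ∑ z ∈ T, Fricke.order (Fricke.eisenstein 7 (show 3 ≤ 2 * j by omega)) z
      = ((∑ z ∈ T, (Fricke.order (Fricke.eisenstein 7 (show 3 ≤ 2 * j by omega)) z).toNat : ℕ) :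
          ℕ∞) := by
        rw [Nat.cast_sum]
        exact Finset.sum_congr rfl fun z _ ↦
          (ENat.natCast_toNat (Fricke.order_ne_top _ hk_even z)).symm
    _ ≤ 2 := by exact_mod_cast h
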